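/- **Setting.** Let $\mathfrak B\subset\mathbb R^3$ be a strongly convex body of revolution with mass $m>0$ and principal moments of inertia $\mathbb I_1=\mathbb I_2>0$, $\mathbb I_3>0$, written in body coordinates centred at the centre of mass and with axis of symmetry $e_3$. For $\boldsymbol\gamma\in S^2$ let $s(\boldsymbol\gamma)=(\varrho(\gamma_3)\gamma_1,\varrho(\gamma_3)\gamma_2,\zeta(\gamma_3))$, with $\varrho,\zeta$ smooth on $[-1,1]$, be the point of the surface with inward unit normal $\boldsymbol\gamma$. The body rolls without slipping on a horizontal plane under a constant vertical gravitational force of strength $\mathrm g$. Put $$Q=\{(g,\boldsymbol a)\in SO(3)\times\mathbb R^3 : a_3=-\langle\boldsymbol\gamma,s\rangle\},$$ where $\boldsymbol\alpha,\boldsymbol\beta,\boldsymbol\gamma$ are the rows of $g$ and $s=s(\boldsymbol\gamma)$; let $\boldsymbol\lambda$ be the left Maurer–Cartan forms of $SO(3)$ and $\boldsymbol\Omega=\boldsymbol\lambda(\dot g)$ the angular velocity in body coordinates. The kinetic energy metric is $\kappa((\dot g,\dot{\boldsymbol a}),(\dot g',\dot{\boldsymbol a}'))=\langle\mathbb I\boldsymbol\Omega,\boldsymbol\Omega'\rangle+m\langle\dot{\boldsymbol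 a},\dot{\boldsymbol a}'\rangle$, the energy is $\frac12\kappa+m\mathrm g\,a_3$, and the constraint distribution $D\subset TQ$ is given by $\boldsymbol\Omega\times s+g^T\dot{\boldsymbol a}=0$. Let $\mathcal M=\kappa^\flat(D)\subset T^*Q$ with projection $\tau:\mathcal M\to Q$, let $\Theta$ and $\Omega_{\mathcal M}=-d\Theta$ be the restrictions to $\mathcal M$ of the canonical forms of $T^*Q$, let $\mathcal H_{\mathcal M}$ be the restricted hamiltonian, and let $\mathcal C_x=\{v\in T_x\mathcal M: T\tau(v)\in D\}$. Let $$B=m\,\varrho\,\langle\boldsymbol\gamma,s\rangle\,\langle\boldsymbol\Omega,d\boldsymbol\lambda\rangle .$$ The bivectors $\pi_{nh}$ and $\pi_B$ are defined by: $\pi^\sharp(\alpha)=-X$ if and only if $X\in\mathcal C$ and $\mathbf i_X\omega|_{\mathcal C}=\alpha|_{\mathcal C}$, with $\omega=\Omega_{\mathcal M}$ and $\omega=\Omega_{\mathcal M}+B$ respectively. Put $X_{nh}=-\pi_{nh}^\sharp(d\mathcal H_{\mathcal M})$ and $\{f,h\}_B=\pi_B(df,dh)$. The group $G=S^1\times E(2)$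 (with $E(2)$ the rotations and translations of the plane) acts on $Q$ by $(g,\boldsymbol a)\mapsto(h_\varphi g h_\theta^{-1},\,h_\varphi\boldsymbol a+(x,y,0))$, where $h_\varphi$ is the rotation by $\varphi$ about $e_3$, and on $\mathcal M$ by the cotangent lift. Let $\rho:\mathcal M\to\mathcal M/G$ be the orbit projection and $C^\infty(\mathcal M/G)$ the set of functions $F$ with $F\circ\rho$ smooth. The reduced bracket is defined by $\{F,K\}^B_{red}\circ\rho=\{F\circ\rho,K\circ\rho\}_B$. For $\eta\in\mathfrak g$ write $\eta_Q,\eta_{\mathcal M}$ for the infinitesimal generators, and let $\mathfrak g_S\to Q$ be the bundle of those $(\eta,q)\in\mathfrak g\times Q$ for which $\eta_Q(q)\in D_q$. For a smooth section $\chi$ of $\mathfrak g_S$ put $\chi_{\mathcal M}(x)=(\chi(\tau(x)))_{\mathcal M}(x)$. A function $J\in C^\infty(\mathcal M)$ is a *horizontal gauge momentum* with *horizontal gauge symmetry* $\chi$ if $J=\Theta(\chi_{\mathcal M})$ and $X_{nh}(J)=0$. With $\mathfrak g=\mathbb R\times\mathbb R\times\mathbb R^2$, let $\xi_1=(1;0,(\varrho\beta_3,-\varrho\alpha_3))$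 and $\xi_2=(0;1,(a_2+\langle s,\boldsymbol\beta\rangle,-a_1-\langle s,\boldsymbol\alpha\rangle))$, which are sections of $\mathfrak g_S$. **Theorem.** $\Omega_{\mathcal M}|_{\mathcal C}$ and $(\Omega_{\mathcal M}+B)|_{\mathcal C}$ are nondegenerate, and $\{\cdot,\cdot\}^B_{red}$ is well defined. There are two $G$-invariant horizontal gauge momenta $J_1,J_2$ with horizontal gauge symmetries $\chi_i=f_i(\gamma_3)\xi_1+g_i(\gamma_3)\xi_2$, where $f_i,g_i$ are smooth on $[-1,1]$ and $f_1g_2-f_2g_1$ vanishes nowhere on $[-1,1]$. For these, and more generally for every $G$-invariant horizontal gauge momentum $J$ with horizontal gauge symmetry $\chi$, $$\pi_B^\sharp(dJ)=-\chi_{\mathcal M},$$ and $J=\bar J\circ\rho$ for a function $\bar J\in C^\infty(\mathcal M/G)$ that is a Casimir function of the reduced bracket: $\{F,\bar J\}^B_{red}=0$ for all $F\in C^\infty(\mathcal M/G)$. -/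

import Mathlib

open scoped Matrix ContDiff

attribute [local instance] Matrix.normedAddCommGroup Matrix.normedSpace

noncomputable section

namespace Rolling

/-! ## Ambient spaces and embedded submanifolds -/

/-- Vectors of `ℝ³` in coordinates. -/
abbrev V3 := Fin 3 → ℝ

/-- Ambient vector space of the configuration space: pairs `(g, a)` of an attitude matrix `g` and
the position `a` of the centre of mass. -/
abbrev Conf := Matrix (Fin 3) (Fin 3) ℝ × V3

/-- Ambient vector space of the phase space: pairs `(q, u)` of a configuration and a velocity. -/
abbrev Phase := Conf × Conf

/-- The tangent space at `x` of an embedded submanifold `S` of a vector space: the velocities of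
smooth curves in `S` through `x`. -/
def tangentSet {E : Type*} [NormedAddCommGroup E] [NormedSpace ℝ E] (S : Set E) (x : E) : Set E :=
  {v | ∃ c : ℝ → E, ContDiff ℝ ∞ c ∧ c 0 = x ∧ (∀ t, c t ∈ S) ∧ deriv c 0 = v}

/-- Exterior derivative of a one-form `θ` on a vector space (`θ x v` is the value at `x` on `v`):
`dθ_x(v, w) = D_v(θ(w)) - D_w(θ(v))` for constant fields `v`, `w`. -/
def extD {E : Type*} [NormedAddCommGroup E] [NormedSpace ℝ E] (θ : E → E → ℝ) (x v w : E) : ℝ :=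
  fderiv ℝ (fun y => θ y w) x v - fderiv ℝ (fun y => θ y v) x w

/-- The vector `s = (ϱ(γ₃) γ₁, ϱ(γ₃) γ₂, ζ(γ₃))`. -/
def profileVec (ϱ ζ : ℝ → ℝ) (γ : V3) : V3 := ![ϱ (γ 2) * γ 0, ϱ (γ 2) * γ 1, ζ (γ 2)]

/-- Rotation by the angle `θ` about the third axis. -/
def rotZ (θ : Real.Angle) : Matrix (Fin 3) (Fin 3) ℝ :=
  !![θ.cos, -θ.sin, 0; θ.sin, θ.cos, 0; 0, 0, 1]

/-! ## The body -/

/-- A strongly convex body of revolution, with the data of its rolling motion. Body coordinates are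
centred at the centre of mass and the third axis is the axis of symmetry. -/
structure BodyOfRevolution where
  /-- the mass -/
  m : ℝ
  m_pos : 0 < m
  /-- the principal moment of inertia `𝕀₁ = 𝕀₂` -/
  I₁ : ℝ
  I₁_pos : 0 < I₁
  /-- the principal moment of inertia about the axis of symmetry -/
  I₃ : ℝ
  I₃_pos : 0 < I₃
  /-- the strength of the gravitational force -/
  grav : ℝ
  /-- the solid -/
  solid : Set V3
  solid_compact : IsCompact solid
  solid_convex : Convex ℝ solid
  solid_rot : ∀ (θ : Real.Angle), ∀ x ∈ solid, rotZ θ *ᵥ x ∈ solid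
  /-- the profile functions; only their values on `[-1, 1]` matter -/
  ϱ : ℝ → ℝ
  ζ : ℝ → ℝ
  ϱ_smooth : ContDiffOn ℝ ∞ ϱ (Set.Icc (-1) 1)
  ζ_smooth : ContDiffOn ℝ ∞ ζ (Set.Icc (-1) 1)
  /-- `γ ↦ s(γ)` inverts the Gauss map of the surface: `s(γ)` is the point of the solid at which
  the unit vector `γ` is the inward normal. -/
  gauss : ∀ γ : V3, γ ⬝ᵥ γ = 1 → profileVec ϱ ζ γ ∈ solid ∧
    ∀ x ∈ solid, x ≠ profileVec ϱ ζ γ → 0 < γ ⬝ᵥ (x - profileVec ϱ ζ γ)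
  /-- strong convexity: the principal radii of curvature `-ϱ` and `-ζ'` are positive. -/
  strongly_convex : ∀ t ∈ Set.Icc (-1 : ℝ) 1, ϱ t < 0 ∧ derivWithin ζ (Set.Icc (-1) 1) t < 0

/-! ## Velocities -/

/-- The rows `α`, `β`, `γ` of the attitude matrix. -/
def rowα (q : Conf) : V3 := q.1 0
/-- The second row of the attitude matrix. -/
def rowβ (q : Conf) : V3 := q.1 1
/-- The third row of the attitude matrix: the vertical unit vector in body coordinates. -/
def rowγ (q : Conf) : V3 := q.1 2

/-- The Maurer-Cartan forms `λ = (λ₁, λ₂, λ₃)`, dual to the left invariant fields: on a velocity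
`u = (ġ, ȧ)` at `(g, a)`, the vector `Ω` such that `gᵀ ġ x = Ω × x`. -/
def mc (q u : Conf) : V3 :=
  ![(q.1ᵀ * u.1) 2 1, (q.1ᵀ * u.1) 0 2, (q.1ᵀ * u.1) 1 0]

namespace BodyOfRevolution

/-- The vector from the centre of mass to the point of contact, in body coordinates. -/
def s (b : BodyOfRevolution) (q : Conf) : V3 := profileVec b.ϱ b.ζ (rowγ q)

/-- The configuration space `Q ⊂ SO(3) × ℝ³`: the body touches the plane `x₃ = 0`. -/
def Q (b : BodyOfRevolution) : Set Conf :=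
  {q | q.1 ∈ Matrix.specialOrthogonalGroup (Fin 3) ℝ ∧ q.2 2 = -(rowγ q ⬝ᵥ b.s q)}

/-- The constraint distribution `D`: velocities with `Ω × s + gᵀ ȧ = 0` (rolling without
slipping). -/
def D (b : BodyOfRevolution) (q : Conf) : Set Conf :=
  {u | u ∈ tangentSet b.Q q ∧ mc q u ⨯₃ b.s q + q.1ᵀ *ᵥ u.2 = 0}

/-- The kinetic energy metric. -/
def κ (b : BodyOfRevolution) (q u v : Conf) : ℝ :=
  mc q u ⬝ᵥ (Matrix.diagonal ![b.I₁, b.I₁, b.I₃] *ᵥ mc q v) + b.m * (u.2 ⬝ᵥ v.2)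

/-! ## The phase space

The constraint manifold is `κ♭(D) ⊂ T*Q`. The bundle isomorphism `κ♭ : TQ → T*Q` maps `D` onto it,
and all objects on it are written after this identification: the point `(q, u)` stands for the
covector `κ_q(u, ·)`. -/

/-- The constraint manifold `ℳ = κ♭(D)`, with `(q, u)` standing for `κ_q(u, ·) ∈ T*_q Q`. -/
def M (b : BodyOfRevolution) : Set Phase := {x | x.1 ∈ b.Q ∧ x.2 ∈ b.D x.1}

/-- The distribution `𝒞` on `ℳ`: tangent vectors that project into `D`. -/
def C (b : BodyOfRevolution) (x : Phase) : Set Phase := {v | v ∈ tangentSet b.M x ∧ v.1 ∈ b.D x.1}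

/-- The canonical one-form: the covector at the base point evaluated on the projection of `v`
to `Q`. -/
def Θ (b : BodyOfRevolution) (x v : Phase) : ℝ := b.κ x.1 x.2 v.1

/-- The canonical two-form `Ω = -dΘ`, to be evaluated on vectors tangent to `ℳ`. -/
def ΩM (b : BodyOfRevolution) (x v w : Phase) : ℝ := -extD b.Θ x v w

/-- The hamiltonian: kinetic plus gravitational energy. -/
def H (b : BodyOfRevolution) (x : Phase) : ℝ :=
  b.κ x.1 x.2 x.2 / 2 + b.m * b.grav * x.1.2 2

/-- The two-form `B = m ϱ ⟨γ, s⟩ ⟨Ω, dλ⟩` of the gauge transformation, where `Ω` is the angular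
velocity in body coordinates. -/
def B (b : BodyOfRevolution) (x v w : Phase) : ℝ :=
  b.m * b.ϱ (rowγ x.1 2) * (rowγ x.1 ⬝ᵥ b.s x.1) *
    ∑ i, mc x.1 x.2 i * extD (fun (y z : Phase) => mc y.1 z.1 i) x v w

/-- The two-form `Ω + B`. -/
def ΩB (b : BodyOfRevolution) (x v w : Phase) : ℝ := b.ΩM x v w + b.B x v w

/-! ## Functions, bivectors and brackets on `ℳ` -/

/-- Smooth functions on the embedded submanifold `ℳ`. -/
def Smooth (b : BodyOfRevolution) (f : b.M → ℝ) : Prop :=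
  ContDiffOn ℝ ∞ (Function.extend Subtype.val f 0) b.M

/-- The differential of a function on `ℳ`; its values on the tangent vectors of `ℳ` do not depend
on the extension of `f`. -/
def dM (b : BodyOfRevolution) (f : b.M → ℝ) (x : b.M) : Phase →L[ℝ] ℝ :=
  fderivWithin ℝ (Function.extend Subtype.val f 0) b.M x

/-- `X ∈ 𝒞` and `i_X σ |_𝒞 = α |_𝒞` at the point `x`. -/
def IsHamAt (b : BodyOfRevolution) (σ : Phase → Phase → Phase → ℝ) (x : Phase)
    (α : Phase →L[ℝ] ℝ) (X : Phase) : Prop :=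
  X ∈ b.C x ∧ ∀ w ∈ b.C x, σ x X w = α w

/-- The restriction of `σ` to `𝒞` is nondegenerate: every covector is represented by exactly one
vector of `𝒞`. -/
def NondegOnC (b : BodyOfRevolution) (σ : Phase → Phase → Phase → ℝ) : Prop :=
  ∀ x ∈ b.M, ∀ α : Phase →L[ℝ] ℝ, ∃! X, b.IsHamAt σ x α X

open Classical in
/-- The map `π♯` of the bivector given by `σ|_𝒞`: `π♯(α) = -X` if and only if
`i_X σ |_𝒞 = α |_𝒞`. -/
def sharp (b : BodyOfRevolution) (σ : Phase → Phase → Phase → ℝ) (x : Phase)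
    (α : Phase →L[ℝ] ℝ) : Phase :=
  if h : ∃! X, b.IsHamAt σ x α X then -h.choose else 0

/-- The nonholonomic vector field `X_nh = -π_nh♯(dH)`. -/
def Xnh (b : BodyOfRevolution) (x : b.M) : Phase :=
  -b.sharp b.ΩM x (b.dM (fun y => b.H y) x)

/-- The gauge transformed bracket `{f, g}_B = π_B(df, dg) = dg(π_B♯(df))`. -/
def bracketB (b : BodyOfRevolution) (f g : b.M → ℝ) (x : b.M) : ℝ :=
  b.dM g x (b.sharp b.ΩB x (b.dM f x))

end BodyOfRevolution

/-! ## The symmetry group -/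

/-- The group `G = S¹ × E(2)`: a spin about the axis of the body, and a rotation and a translation
of the plane. -/
@[ext]
structure SymGroup where
  spin : Real.Angle
  rot : Real.Angle
  trans : Fin 2 → ℝ

/-- Rotation of the plane. -/
def rot2 (θ : Real.Angle) (v : Fin 2 → ℝ) : Fin 2 → ℝ :=
  ![θ.cos * v 0 - θ.sin * v 1, θ.sin * v 0 + θ.cos * v 1]

instance : Mul SymGroup := ⟨fun h k => ⟨h.spin + k.spin, h.rot + k.rot, h.trans + rot2 h.rot k.trans⟩⟩
instance : One SymGroup := ⟨⟨0, 0, 0⟩⟩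
instance : Inv SymGroup := ⟨fun h => ⟨-h.spin, -h.rot, -rot2 (-h.rot) h.trans⟩⟩

theorem SymGroup.mul_def (h k : SymGroup) :
    h * k = ⟨h.spin + k.spin, h.rot + k.rot, h.trans + rot2 h.rot k.trans⟩ := rfl
theorem SymGroup.one_def : (1 : SymGroup) = ⟨0, 0, 0⟩ := rfl
theorem SymGroup.inv_def (h : SymGroup) :
    h⁻¹ = ⟨-h.spin, -h.rot, -rot2 (-h.rot) h.trans⟩ := rfl

instance : Group SymGroup where
  mul_assoc a b c := by
    simp only [SymGroup.mul_def, SymGroup.mk.injEq]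
    refine ⟨add_assoc _ _ _, add_assoc _ _ _, ?_⟩
    ext i
    fin_cases i
    · change a.trans 0 + _ + _ = a.trans 0 + _
      simp [rot2, Real.Angle.cos_add, Real.Angle.sin_add]
      ring
    · change a.trans 1 + _ + _ = a.trans 1 + _
      simp [rot2, Real.Angle.cos_add, Real.Angle.sin_add]
      ring
  one_mul a := by
    ext i <;> simp [SymGroup.mul_def, SymGroup.one_def]
    fin_cases i <;> simp [rot2]
  mul_one a := by
    ext i <;> simp [SymGroup.mul_def, SymGroup.one_def]
    fin_cases i <;> simp [rot2]
  inv_mul_cancel a := by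
    ext i <;> simp [SymGroup.mul_def, SymGroup.one_def, SymGroup.inv_def]

/-- The action on configurations, `(g, a) ↦ (h_φ g h_θ⁻¹, h_φ a + (x, y, 0))`. -/
def actQ (h : SymGroup) (q : Conf) : Conf :=
  (rotZ h.rot * q.1 * (rotZ h.spin)ᵀ, rotZ h.rot *ᵥ q.2 + ![h.trans 0, h.trans 1, 0])

/-- The lifted action on `(q, u)`; as `G` acts by isometries of the kinetic energy metric, the
tangent lift corresponds under `κ♭` to the cotangent lift. -/
def actM (h : SymGroup) (x : Phase) : Phase :=
  (actQ h x.1, (rotZ h.rot * x.2.1 * (rotZ h.spin)ᵀ, rotZ h.rot *ᵥ x.2.2))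

theorem rotZ_zero : rotZ 0 = 1 := by
  ext i j
  fin_cases i <;> fin_cases j <;> simp [rotZ]

theorem rotZ_add (θ φ : Real.Angle) : rotZ (θ + φ) = rotZ θ * rotZ φ := by
  ext i j
  fin_cases i <;> fin_cases j <;>
    simp [rotZ, Matrix.mul_apply, Fin.sum_univ_three, Real.Angle.cos_add, Real.Angle.sin_add] <;>
    ring

theorem rotZ_mulVec_plane (θ : Real.Angle) (v : Fin 2 → ℝ) :
    rotZ θ *ᵥ ![v 0, v 1, 0] = ![rot2 θ v 0, rot2 θ v 1, 0] := by
  ext i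
  fin_cases i <;>
    simp [rotZ, rot2, Matrix.mulVec, dotProduct, Fin.sum_univ_three]
  ring

theorem actM_one (x : Phase) : actM 1 x = x := by
  have h0 : (![0, 0, 0] : V3) = 0 := by ext i; fin_cases i <;> rfl
  simp [actM, actQ, SymGroup.one_def, rotZ_zero, h0]

theorem actM_mul (h k : SymGroup) (x : Phase) : actM (h * k) x = actM h (actM k x) := by
  have e : (![(h * k).trans 0, (h * k).trans 1, 0] : V3)
      = rotZ h.rot *ᵥ ![k.trans 0, k.trans 1, 0] + ![h.trans 0, h.trans 1, 0] := by
    rw [rotZ_mulVec_plane]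
    ext i
    fin_cases i <;> simp [SymGroup.mul_def, add_comm]
  simp only [actM, actQ, e]
  simp only [SymGroup.mul_def, rotZ_add, Matrix.mul_assoc, Matrix.mulVec_add, add_assoc,
    Matrix.transpose_mul, Matrix.mulVec_mulVec]

/-- The Lie algebra `𝔤 ≃ ℝ × ℝ × ℝ²`. -/
abbrev LieG := ℝ × ℝ × (Fin 2 → ℝ)

/-- A curve in `G` through the identity with velocity `η`. -/
def curveG (η : LieG) (t : ℝ) : SymGroup :=
  ⟨((t * η.1 : ℝ) : Real.Angle), ((t * η.2.1 : ℝ) : Real.Angle), t • η.2.2⟩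

/-- The infinitesimal generator `η_Q(q)`. -/
def genQ (η : LieG) (q : Conf) : Conf := deriv (fun t : ℝ => actQ (curveG η t) q) 0

/-- The infinitesimal generator `η_ℳ(x)`. -/
def genM (η : LieG) (x : Phase) : Phase := deriv (fun t : ℝ => actM (curveG η t) x) 0

namespace BodyOfRevolution

/-! ## Horizontal gauge momenta -/

/-- `S = D ∩ V`, where `V` is tangent to the `G`-orbits. -/
def S (b : BodyOfRevolution) (q : Conf) : Set Conf := b.D q ∩ Set.range (fun η => genQ η q)

/-- `χ` is a smooth section of the bundle `𝔤_S = {(η, q) : η_Q(q) ∈ S_q}` over `Q`. -/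
def IsSectionGS (b : BodyOfRevolution) (χ : Conf → LieG) : Prop :=
  ContDiffOn ℝ ∞ χ b.Q ∧ ∀ q ∈ b.Q, genQ (χ q) q ∈ b.S q

/-- The vector field `χ_ℳ(x) = (χ(τ(x)))_ℳ(x)` of a section `χ`. -/
def secM (_b : BodyOfRevolution) (χ : Conf → LieG) (x : Phase) : Phase := genM (χ x.1) x

/-- The component `⟨J^nh, χ⟩ = i_{χ_ℳ} Θ` of the nonholonomic momentum map. -/
def nhMomentum (b : BodyOfRevolution) (χ : Conf → LieG) (x : b.M) : ℝ := b.Θ x (b.secM χ x)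

/-- `J` is a horizontal gauge momentum of `X_nh` with horizontal gauge symmetry `χ`. -/
def IsHorizontalGaugeMomentum (b : BodyOfRevolution) (J : b.M → ℝ) (χ : Conf → LieG) : Prop :=
  b.Smooth J ∧ b.IsSectionGS χ ∧ J = b.nhMomentum χ ∧ ∀ x : b.M, b.dM J x (b.Xnh x) = 0

/-- `G`-invariance of a function on `ℳ`. -/
def GInvariant (b : BodyOfRevolution) (f : b.M → ℝ) : Prop :=
  ∀ (h : SymGroup) (x y : b.M), actM h x = y → f x = f y

/-- The section `ξ₁`, the projection of `(1; 0, 0)` to `𝔤_S` along the translations. -/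
def ξ₁ (b : BodyOfRevolution) (q : Conf) : LieG :=
  (1, 0, ![b.ϱ (rowγ q 2) * rowβ q 2, -(b.ϱ (rowγ q 2) * rowα q 2)])

/-- The section `ξ₂`, the projection of `(0; 1, 0)` to `𝔤_S` along the translations. -/
def ξ₂ (b : BodyOfRevolution) (q : Conf) : LieG :=
  (0, 1, ![q.2 1 + b.s q ⬝ᵥ rowβ q, -q.2 0 - b.s q ⬝ᵥ rowα q])

/-- The section `f(γ₃) ξ₁ + g(γ₃) ξ₂`. -/
def combSection (b : BodyOfRevolution) (f g : ℝ → ℝ) (q : Conf) : LieG :=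
  f (rowγ q 2) • b.ξ₁ q + g (rowγ q 2) • b.ξ₂ q

/-! ## Reduction -/

/-- Two points of `ℳ` are equivalent if they lie on the same `G`-orbit. -/
def orbitSetoid (b : BodyOfRevolution) : Setoid b.M where
  r x y := ∃ h : SymGroup, actM h x = y
  iseqv :=
    { refl := fun x => ⟨1, actM_one x⟩
      symm := by
        rintro x y ⟨h, hh⟩
        exact ⟨h⁻¹, by rw [← hh, ← actM_mul, inv_mul_cancel, actM_one]⟩
      trans := by
        rintro x y z ⟨h, hh⟩ ⟨k, hk⟩
        exact ⟨k * h, by rw [actM_mul, hh, hk]⟩ }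

/-- The reduced space `ℳ/G`. -/
def Mred (b : BodyOfRevolution) : Type := Quotient b.orbitSetoid

/-- The orbit projection. -/
def ρ (b : BodyOfRevolution) (x : b.M) : b.Mred := Quotient.mk b.orbitSetoid x

/-- Smooth functions on the differential space `ℳ/G`: those whose pull back to `ℳ` is smooth. -/
def SmoothRed (b : BodyOfRevolution) (F : b.Mred → ℝ) : Prop := b.Smooth (F ∘ b.ρ)

/-- The reduced bracket `{F, K}_red`, evaluated through a representative of the orbit. -/
def redBracket (b : BodyOfRevolution) (F K : b.Mred → ℝ) (y : b.Mred) : ℝ :=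
  b.bracketB (F ∘ b.ρ) (K ∘ b.ρ) (Quotient.out y)

/-- The reduced bracket does not depend on representatives:
`{F, K}_red ∘ ρ = {F ∘ ρ, K ∘ ρ}_B`. -/
def RedBracketWellDefined (b : BodyOfRevolution) : Prop :=
  ∀ F K : b.Mred → ℝ, b.SmoothRed F → b.SmoothRed K →
    ∀ x : b.M, b.redBracket F K (b.ρ x) = b.bracketB (F ∘ b.ρ) (K ∘ b.ρ) x

/-- Casimir functions of the reduced bracket. -/
def IsCasimirRed (b : BodyOfRevolution) (K : b.Mred → ℝ) : Prop :=
  b.SmoothRed K ∧ ∀ F : b.Mred → ℝ, b.SmoothRed F → ∀ y, b.redBracket F K y = 0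

end BodyOfRevolution

end Rolling

end

noncomputable section

namespace Rolling

/-! A velocity in `D` is determined by its angular velocity, so `D` at a configuration is a copy of
ℝ³ (`Dvec`), and 𝒞 at a phase is a copy of ℝ³ × ℝ³ (`Cvec`): the angular velocity w of the base
motion and the rate w' of the angular velocity Ω. In these coordinates both two-forms read ⟨Kw, z'⟩
- ⟨Kw', z⟩ + A(w, z), where K = `kin` is the positive definite kinetic tensor v ↦ 𝕀v + m s × (v ×
s); the form B changes only A. Nondegeneracy follows by solving a triangular system
(`existsUnique_hamilton`). All terms are equivariant under rotations about e₃, so brackets of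
invariant functions are invariant.

The heart is an identity on 𝒞 for the momentum J of an arbitrary section χ (`dM_nhMomentum`): dJ =
i_{χ_ℳ}(Ω_ℳ + B) + `residual`. The residual is linear in Ω and depends on the direction z only
through the derivative of χ along z and through γ̇₃ = (γ × z)₃. Pairing with X_nh removes the
two-form: Ω_ℳ(χ_ℳ, X_nh) = -dH(χ_ℳ) = 0 by invariance of the energy, and B(χ_ℳ, X_nh) contains ⟨Ω, W
× Ω⟩ = 0, because X_nh has base angular velocity Ω. Thus X_nh(J) is the residual in the single
direction z = Ω.

If J is invariant and γ ≠ ±e₃, the spin and rotation coefficients of χ are constant along orbits, so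
their derivatives are multiples of (γ × z)₃ and the residual is (γ × z)₃ T(Ω), with T linear and
independent of z. Conservation says (γ × Ω)₃ T(Ω) = 0 for all Ω. The first linear factor is not
zero, hence T = 0 and the residual vanishes in every direction (`residual_eq_zero`). At γ = ±e₃ a
half-turn symmetry gives the same conclusion. So dJ = i_{χ_ℳ}(Ω_ℳ + B) on 𝒞, which is the formula
for π_B♯(dJ), and the bracket with an invariant F is a multiple of dF(χ_ℳ) = 0.

For existence, take χ = fξ₁ + gξ₂. Then T = 0 is implied by a planar linear system for (f, g) in the
variable γ₃, whose leading matrix has the determinant `frameDet`, positive on all of [-1, 1],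
including the ends where γ and e₃ are parallel. It therefore has a smooth fundamental system with
nowhere vanishing Wronskian (`exists_fundamental_system`). -/

/-! ## Skew matrices and rotations -/

/-- The skew matrix of the map `x ↦ w × x`. -/
def hat (w : V3) : Matrix (Fin 3) (Fin 3) ℝ :=
  !![0, -w 2, w 1; w 2, 0, -w 0; -w 1, w 0, 0]

/-- The linear left inverse of `hat`. -/
def axial (A : Matrix (Fin 3) (Fin 3) ℝ) : V3 := ![A 2 1, A 0 2, A 1 0]

/-- The symmetry axis of the body. -/
def e₃ : V3 := ![0, 0, 1]

theorem mc_eq_axial (q u : Conf) : mc q u = axial (q.1ᵀ * u.1) := rfl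

theorem axial_hat (w : V3) : axial (hat w) = w := by
  ext i; fin_cases i <;> simp [axial, hat]

theorem axial_add (A B : Matrix (Fin 3) (Fin 3) ℝ) : axial (A + B) = axial A + axial B := by
  ext i; fin_cases i <;> simp [axial]

theorem axial_smul (c : ℝ) (A : Matrix (Fin 3) (Fin 3) ℝ) : axial (c • A) = c • axial A := by
  ext i; fin_cases i <;> simp [axial]

theorem hat_axial {A : Matrix (Fin 3) (Fin 3) ℝ} (hA : A + Aᵀ = 0) : hat (axial A) = A := by
  have h : ∀ i j, A i j + A j i = 0 := fun i j => by simpa using congrFun (congrFun hA i) j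
  ext i j
  fin_cases i <;> fin_cases j <;> simp [axial, hat]
  · linarith [h 0 0]
  · linarith [h 0 1]
  · linarith [h 1 1]
  · linarith [h 1 2]
  · linarith [h 2 0]
  · linarith [h 2 2]

theorem hat_add (v w : V3) : hat (v + w) = hat v + hat w := by
  ext i j; fin_cases i <;> fin_cases j <;> simp [hat] <;> ring

theorem hat_smul (c : ℝ) (v : V3) : hat (c • v) = c • hat v := by
  ext i j; fin_cases i <;> fin_cases j <;> simp [hat]

theorem hat_transpose (v : V3) : (hat v)ᵀ = -hat v := by
  ext i j; fin_cases i <;> fin_cases j <;> simp [hat]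

theorem hat_mulVec (v w : V3) : hat v *ᵥ w = v ⨯₃ w := by
  ext i; fin_cases i <;> simp [hat, cross_apply, Matrix.mulVec, dotProduct, Fin.sum_univ_three] <;> ring

theorem vecMul_hat (v w : V3) : v ᵥ* hat w = v ⨯₃ w := by
  ext i; fin_cases i <;> simp [hat, cross_apply, Matrix.vecMul, dotProduct, Fin.sum_univ_three] <;> ring

theorem axial_hat_mul_hat_sub (v w : V3) :
    axial (hat v * hat w) - axial (hat w * hat v) = v ⨯₃ w := by
  ext i
  fin_cases i <;> simp [axial, hat, cross_apply, Matrix.mul_apply, Fin.sum_univ_three] <;> ring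

/-! ### Identities for rotation matrices. -/

section Rotation

variable {g : Matrix (Fin 3) (Fin 3) ℝ} (hg : g ∈ Matrix.specialOrthogonalGroup (Fin 3) ℝ)
include hg

theorem transpose_mul_self_of_mem_SO : gᵀ * g = 1 :=
  Matrix.mem_orthogonalGroup_iff' (Fin 3) ℝ |>.1 (Matrix.mem_specialOrthogonalGroup_iff.1 hg).1

theorem mul_transpose_self_of_mem_SO : g * gᵀ = 1 :=
  Matrix.mem_orthogonalGroup_iff (Fin 3) ℝ |>.1 (Matrix.mem_specialOrthogonalGroup_iff.1 hg).1

/-- The inverse of a matrix of determinant one is its adjugate. Each entry of g thus equals a signed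
2 × 2 minor, from which the cross product identities are read off. -/
theorem transpose_eq_adjugate : gᵀ = g.adjugate := by
  have h : g.det = 1 := (Matrix.mem_specialOrthogonalGroup_iff.1 hg).2
  calc gᵀ = gᵀ * (g * g.adjugate) := by rw [Matrix.mul_adjugate, h, one_smul, mul_one]
    _ = g.adjugate := by rw [← mul_assoc, transpose_mul_self_of_mem_SO hg, one_mul]

theorem mulVec_cross (v w : V3) : g *ᵥ (v ⨯₃ w) = (g *ᵥ v) ⨯₃ (g *ᵥ w) := by
  have h := transpose_eq_adjugate hg
  rw [Matrix.adjugate_fin_three] at h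
  have e : ∀ i j, g j i = _ := fun i j => congrFun (congrFun h i) j
  have e00 := e 0 0; have e01 := e 0 1; have e02 := e 0 2
  have e10 := e 1 0; have e11 := e 1 1; have e12 := e 1 2
  have e20 := e 2 0; have e21 := e 2 1; have e22 := e 2 2
  simp at e00 e01 e02 e10 e11 e12 e20 e21 e22
  ext i
  fin_cases i <;> simp [cross_apply, Matrix.mulVec, dotProduct, Fin.sum_univ_three]
  · linear_combination (v 1 * w 2 - v 2 * w 1) * e00 + (v 2 * w 0 - v 0 * w 2) * e10 +
      (v 0 * w 1 - v 1 * w 0) * e20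
  · linear_combination (v 1 * w 2 - v 2 * w 1) * e01 + (v 2 * w 0 - v 0 * w 2) * e11 +
      (v 0 * w 1 - v 1 * w 0) * e21
  · linear_combination (v 1 * w 2 - v 2 * w 1) * e02 + (v 2 * w 0 - v 0 * w 2) * e12 +
      (v 0 * w 1 - v 1 * w 0) * e22

theorem dotProduct_mulVec_mulVec (v w : V3) : (g *ᵥ v) ⬝ᵥ (g *ᵥ w) = v ⬝ᵥ w := by
  rw [Matrix.dotProduct_mulVec, Matrix.vecMul_mulVec, transpose_mul_self_of_mem_SO hg,
    Matrix.vecMul_one]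

theorem transpose_mulVec_mulVec (v : V3) : gᵀ *ᵥ (g *ᵥ v) = v := by
  rw [Matrix.mulVec_mulVec, transpose_mul_self_of_mem_SO hg, Matrix.one_mulVec]

theorem mulVec_transpose_mulVec (v : V3) : g *ᵥ (gᵀ *ᵥ v) = v := by
  rw [Matrix.mulVec_mulVec, mul_transpose_self_of_mem_SO hg, Matrix.one_mulVec]

theorem transpose_mem_SO : gᵀ ∈ Matrix.specialOrthogonalGroup (Fin 3) ℝ := by
  rw [Matrix.mem_specialOrthogonalGroup_iff, Matrix.mem_orthogonalGroup_iff, Matrix.det_transpose]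
  refine ⟨?_, (Matrix.mem_specialOrthogonalGroup_iff.1 hg).2⟩
  rw [Matrix.transpose_transpose]
  exact transpose_mul_self_of_mem_SO hg

theorem hat_mulVec_rotation (v : V3) : hat (g *ᵥ v) = g * hat v * gᵀ := by
  apply Matrix.ext_of_mulVec_single
  intro i
  rw [hat_mulVec, ← Matrix.mulVec_mulVec, ← Matrix.mulVec_mulVec, hat_mulVec, mulVec_cross hg,
    mulVec_transpose_mulVec hg]

theorem row_dot_row (i j : Fin 3) : g i ⬝ᵥ g j = if i = j then 1 else 0 := by
  have := congrFun (congrFun (mul_transpose_self_of_mem_SO hg) i) j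
  rwa [Matrix.mul_apply, Matrix.one_apply] at this

theorem row_cross_row : g 0 ⨯₃ g 1 = g 2 ∧ g 1 ⨯₃ g 2 = g 0 ∧ g 2 ⨯₃ g 0 = g 1 := by
  have h := transpose_eq_adjugate hg
  rw [Matrix.adjugate_fin_three] at h
  have e : ∀ i j, g j i = _ := fun i j => congrFun (congrFun h i) j
  have e00 := e 0 0; have e01 := e 0 1; have e02 := e 0 2
  have e10 := e 1 0; have e11 := e 1 1; have e12 := e 1 2
  have e20 := e 2 0; have e21 := e 2 1; have e22 := e 2 2
  simp at e00 e01 e02 e10 e11 e12 e20 e21 e22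
  refine ⟨?_, ?_, ?_⟩ <;> ext i <;> fin_cases i <;> simp [cross_apply] <;> linarith

end Rotation

theorem transpose_mulVec_vertical (g : Matrix (Fin 3) (Fin 3) ℝ) : gᵀ *ᵥ e₃ = g 2 := by
  ext i; simp [Matrix.mulVec, dotProduct, Fin.sum_univ_three, e₃]

theorem rotZ_mem (θ : Real.Angle) : rotZ θ ∈ Matrix.specialOrthogonalGroup (Fin 3) ℝ := by
  have h := Real.Angle.cos_sq_add_sin_sq θ
  rw [Matrix.mem_specialOrthogonalGroup_iff, Matrix.mem_orthogonalGroup_iff]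
  constructor
  · ext i j
    fin_cases i <;> fin_cases j <;> simp [rotZ, Matrix.mul_apply, Fin.sum_univ_three] <;>
      linarith
  · simp [rotZ, Matrix.det_fin_three]
    linear_combination h

/-! ## Calculus with matrix entries -/

theorem hasDerivAt_matrix {c : ℝ → Matrix (Fin 3) (Fin 3) ℝ} {c' : Matrix (Fin 3) (Fin 3) ℝ}
    {t : ℝ} : HasDerivAt c c' t ↔ ∀ i j, HasDerivAt (fun τ => c τ i j) (c' i j) t :=
  (hasDerivAt_pi (φ := c) (φ' := c')).trans (forall_congr' fun _ => hasDerivAt_pi)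

/-- The entry of a matrix as a continuous linear map. -/
def entryCLM (i j : Fin 3) : Matrix (Fin 3) (Fin 3) ℝ →L[ℝ] ℝ :=
  LinearMap.toContinuousLinearMap (Matrix.entryLinearMap ℝ ℝ i j)

theorem contDiff_entry {n : WithTop ℕ∞} (i j : Fin 3) :
    ContDiff ℝ n (fun A : Matrix (Fin 3) (Fin 3) ℝ => A i j) := (entryCLM i j).contDiff

section
variable {E : Type*} [NormedAddCommGroup E] [NormedSpace ℝ E] {n : WithTop ℕ∞} {s : Set E}

theorem contDiffOn_matrix {f : E → Matrix (Fin 3) (Fin 3) ℝ} :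
    ContDiffOn ℝ n f s ↔ ∀ i j, ContDiffOn ℝ n (fun x => f x i j) s :=
  (contDiffOn_pi (Φ := f)).trans (forall_congr' fun _ => contDiffOn_pi)

theorem contDiff_matrix {f : E → Matrix (Fin 3) (Fin 3) ℝ} :
    ContDiff ℝ n f ↔ ∀ i j, ContDiff ℝ n (fun x => f x i j) :=
  (contDiff_pi (Φ := f)).trans (forall_congr' fun _ => contDiff_pi)

theorem contDiffOn_entry {f : E → Matrix (Fin 3) (Fin 3) ℝ} (hf : ContDiffOn ℝ n f s) (i j : Fin 3) :
    ContDiffOn ℝ n (fun x => f x i j) s := contDiffOn_matrix.1 hf i j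

theorem contDiffOn_matrix_mul {f h : E → Matrix (Fin 3) (Fin 3) ℝ} (hf : ContDiffOn ℝ n f s)
    (hh : ContDiffOn ℝ n h s) : ContDiffOn ℝ n (fun x => f x * h x) s := by
  refine contDiffOn_matrix.2 fun i j => ?_
  simp only [Matrix.mul_apply]
  exact ContDiffOn.sum fun k _ => (contDiffOn_entry hf i k).mul (contDiffOn_entry hh k j)

theorem contDiffOn_matrix_mulVec {f : E → Matrix (Fin 3) (Fin 3) ℝ} {v : E → V3}
    (hf : ContDiffOn ℝ n f s) (hv : ContDiffOn ℝ n v s) : ContDiffOn ℝ n (fun x => f x *ᵥ v x) s := by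
  refine contDiffOn_pi.2 fun i => ?_
  simp only [Matrix.mulVec, dotProduct]
  exact ContDiffOn.sum fun k _ => (contDiffOn_entry hf i k).mul (contDiffOn_pi.1 hv k)

theorem contDiffOn_dotProduct {v w : E → V3} (hv : ContDiffOn ℝ n v s) (hw : ContDiffOn ℝ n w s) :
    ContDiffOn ℝ n (fun x => v x ⬝ᵥ w x) s := by
  simp only [dotProduct]
  exact ContDiffOn.sum fun k _ => (contDiffOn_pi.1 hv k).mul (contDiffOn_pi.1 hw k)

theorem contDiffOn_cross {v w : E → V3} (hv : ContDiffOn ℝ n v s) (hw : ContDiffOn ℝ n w s) :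
    ContDiffOn ℝ n (fun x => v x ⨯₃ w x) s := by
  have hv := contDiffOn_pi.1 hv
  have hw := contDiffOn_pi.1 hw
  refine contDiffOn_pi.2 fun i => ?_
  fin_cases i
  · simpa [cross_apply] using ((hv 1).mul (hw 2)).sub ((hv 2).mul (hw 1))
  · simpa [cross_apply] using ((hv 2).mul (hw 0)).sub ((hv 0).mul (hw 2))
  · simpa [cross_apply] using ((hv 0).mul (hw 1)).sub ((hv 1).mul (hw 0))

theorem contDiffOn_hat {v : E → V3} (hv : ContDiffOn ℝ n v s) :
    ContDiffOn ℝ n (fun x => hat (v x)) s := by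
  have hv := contDiffOn_pi.1 hv
  refine contDiffOn_matrix.2 fun i j => ?_
  fin_cases i <;> fin_cases j <;> simp [hat, contDiffOn_const, hv, (hv _).neg]

theorem contDiffOn_axial {f : E → Matrix (Fin 3) (Fin 3) ℝ} (hf : ContDiffOn ℝ n f s) :
    ContDiffOn ℝ n (fun x => axial (f x)) s := by
  refine contDiffOn_pi.2 fun i => ?_
  fin_cases i <;> simp [axial, contDiffOn_entry hf]

end

/-! ### Product rules along curves of matrices and vectors. -/

section
variable {t : ℝ}

theorem hasDerivAt_matrix_mul {f h : ℝ → Matrix (Fin 3) (Fin 3) ℝ} {f' h' : Matrix (Fin 3) (Fin 3) ℝ}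
    (hf : HasDerivAt f f' t) (hh : HasDerivAt h h' t) :
    HasDerivAt (fun τ => f τ * h τ) (f' * h t + f t * h') t := by
  rw [hasDerivAt_matrix] at *
  intro i j
  simp only [Matrix.mul_apply, Matrix.add_apply, ← Finset.sum_add_distrib]
  exact HasDerivAt.fun_sum fun k _ => (hf i k).mul (hh k j)

theorem hasDerivAt_matrix_transpose {f : ℝ → Matrix (Fin 3) (Fin 3) ℝ} {f' : Matrix (Fin 3) (Fin 3) ℝ}
    (hf : HasDerivAt f f' t) : HasDerivAt (fun τ => (f τ)ᵀ) f'ᵀ t := by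
  rw [hasDerivAt_matrix] at *
  exact fun i j => hf j i

theorem hasDerivAt_matrix_mulVec {f : ℝ → Matrix (Fin 3) (Fin 3) ℝ} {f' : Matrix (Fin 3) (Fin 3) ℝ}
    {v : ℝ → V3} {v' : V3} (hf : HasDerivAt f f' t) (hv : HasDerivAt v v' t) :
    HasDerivAt (fun τ => f τ *ᵥ v τ) (f' *ᵥ v t + f t *ᵥ v') t := by
  rw [hasDerivAt_matrix] at hf
  rw [hasDerivAt_pi] at *
  intro i
  simp only [Matrix.mulVec, dotProduct, Pi.add_apply, ← Finset.sum_add_distrib]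
  exact HasDerivAt.fun_sum fun k _ => (hf i k).mul (hv k)

theorem hasDerivAt_dotProduct {v w : ℝ → V3} {v' w' : V3} (hv : HasDerivAt v v' t)
    (hw : HasDerivAt w w' t) : HasDerivAt (fun τ => v τ ⬝ᵥ w τ) (v' ⬝ᵥ w t + v t ⬝ᵥ w') t := by
  rw [hasDerivAt_pi] at *
  simp only [dotProduct, ← Finset.sum_add_distrib]
  exact HasDerivAt.fun_sum fun k _ => (hv k).mul (hw k)

theorem hasDerivAt_hat {v : ℝ → V3} {v' : V3} (hv : HasDerivAt v v' t) :
    HasDerivAt (fun τ => hat (v τ)) (hat v') t := by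
  rw [hasDerivAt_pi] at hv
  rw [hasDerivAt_matrix]
  intro i j
  fin_cases i <;> fin_cases j <;> simp [hat, hasDerivAt_const, hv, (hv _).fun_neg]

theorem hasDerivAt_axial {f : ℝ → Matrix (Fin 3) (Fin 3) ℝ} {f' : Matrix (Fin 3) (Fin 3) ℝ}
    (hf : HasDerivAt f f' t) : HasDerivAt (fun τ => axial (f τ)) (axial f') t := by
  rw [hasDerivAt_matrix] at hf
  rw [hasDerivAt_pi]
  intro i
  fin_cases i <;> simp [axial, hf]

theorem hasDerivAt_cross {v w : ℝ → V3} {v' w' : V3} (hv : HasDerivAt v v' t)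
    (hw : HasDerivAt w w' t) : HasDerivAt (fun τ => v τ ⨯₃ w τ) (v' ⨯₃ w t + v t ⨯₃ w') t := by
  simpa only [hat_mulVec] using hasDerivAt_matrix_mulVec (hasDerivAt_hat hv) hw

end

/-! ## Rotations about the coordinate axes -/

/-- A smooth curve of rotations through the identity with velocity `hat w`. -/
def rotCurve (w : V3) (t : ℝ) : Matrix (Fin 3) (Fin 3) ℝ :=
  !![1, 0, 0; 0, Real.cos (t * w 0), -Real.sin (t * w 0); 0, Real.sin (t * w 0), Real.cos (t * w 0)] *
  !![Real.cos (t * w 1), 0, Real.sin (t * w 1); 0, 1, 0; -Real.sin (t * w 1), 0, Real.cos (t * w 1)] *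
  !![Real.cos (t * w 2), -Real.sin (t * w 2), 0; Real.sin (t * w 2), Real.cos (t * w 2), 0; 0, 0, 1]

theorem rotCurve_mem (w : V3) (t : ℝ) :
    rotCurve w t ∈ Matrix.specialOrthogonalGroup (Fin 3) ℝ := by
  have h := fun i => Real.cos_sq_add_sin_sq (t * w i)
  refine mul_mem (mul_mem ?_ ?_) ?_ <;>
    rw [Matrix.mem_specialOrthogonalGroup_iff, Matrix.mem_orthogonalGroup_iff] <;> constructor <;>
    first
    | (ext i j
       fin_cases i <;> fin_cases j <;> simp [Matrix.mul_apply, Fin.sum_univ_three] <;>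
         linarith [h 0, h 1, h 2])
    | (simp [Matrix.det_fin_three]; linarith [h 0, h 1, h 2])

theorem rotCurve_zero (w : V3) : rotCurve w 0 = 1 := by
  ext i j
  fin_cases i <;> fin_cases j <;> simp [rotCurve, Matrix.mul_apply, Fin.sum_univ_three]

theorem contDiff_rotCurve (w : V3) : ContDiff ℝ ∞ (rotCurve w) := by
  have hc : ∀ i, ContDiff ℝ ∞ fun t : ℝ => Real.cos (t * w i) := fun i => by fun_prop
  have hs : ∀ i, ContDiff ℝ ∞ fun t : ℝ => Real.sin (t * w i) := fun i => by fun_prop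
  refine contDiffOn_univ.1 (contDiffOn_matrix_mul (contDiffOn_matrix_mul ?_ ?_) ?_) <;>
    refine contDiffOn_univ.2 (contDiff_matrix.2 fun i j => ?_) <;>
    fin_cases i <;> fin_cases j <;> simp [contDiff_const, hc, hs, (hs _).neg]

theorem hasDerivAt_rotCurve (w : V3) : HasDerivAt (rotCurve w) (hat w) 0 := by
  have hc : ∀ i, HasDerivAt (fun t : ℝ => Real.cos (t * w i)) 0 0 := fun i => by
    simpa using ((hasDerivAt_id (0 : ℝ)).mul_const (w i)).cos
  have hs : ∀ i, HasDerivAt (fun t : ℝ => Real.sin (t * w i)) (w i) 0 := fun i => by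
    simpa using ((hasDerivAt_id (0 : ℝ)).mul_const (w i)).sin
  have h0 : HasDerivAt (fun t : ℝ => (!![1, 0, 0; 0, Real.cos (t * w 0), -Real.sin (t * w 0); 0,
      Real.sin (t * w 0), Real.cos (t * w 0)] : Matrix (Fin 3) (Fin 3) ℝ))
      !![0, 0, 0; 0, 0, -w 0; 0, w 0, 0] 0 := by
    refine hasDerivAt_matrix.2 fun i j => ?_
    fin_cases i <;> fin_cases j <;> simp [hasDerivAt_const, hc, hs, (hs _).fun_neg]
  have h1 : HasDerivAt (fun t : ℝ => (!![Real.cos (t * w 1), 0, Real.sin (t * w 1); 0, 1, 0;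
      -Real.sin (t * w 1), 0, Real.cos (t * w 1)] : Matrix (Fin 3) (Fin 3) ℝ))
      !![0, 0, w 1; 0, 0, 0; -w 1, 0, 0] 0 := by
    refine hasDerivAt_matrix.2 fun i j => ?_
    fin_cases i <;> fin_cases j <;> simp [hasDerivAt_const, hc, hs, (hs _).fun_neg]
  have h2 : HasDerivAt (fun t : ℝ => (!![Real.cos (t * w 2), -Real.sin (t * w 2), 0;
      Real.sin (t * w 2), Real.cos (t * w 2), 0; 0, 0, 1] : Matrix (Fin 3) (Fin 3) ℝ))
      !![0, -w 2, 0; w 2, 0, 0; 0, 0, 0] 0 := by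
    refine hasDerivAt_matrix.2 fun i j => ?_
    fin_cases i <;> fin_cases j <;> simp [hasDerivAt_const, hc, hs, (hs _).fun_neg]
  refine (hasDerivAt_matrix_mul (hasDerivAt_matrix_mul h0 h1) h2).congr_deriv ?_
  ext i j
  fin_cases i <;> fin_cases j <;> simp [hat]

theorem mem_Icc_of_unit {v : V3} (hv : v ⬝ᵥ v = 1) : v 2 ∈ Set.Icc (-1 : ℝ) 1 := by
  simp only [dotProduct, Fin.sum_univ_three] at hv
  constructor <;> nlinarith [sq_nonneg (v 0), sq_nonneg (v 1), sq_nonneg (v 2)]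

theorem hasDerivAt_mc {c u : ℝ → Conf} {c' u' : Conf} {t : ℝ} (hc : HasDerivAt c c' t)
    (hu : HasDerivAt u u' t) :
    HasDerivAt (fun τ => mc (c τ) (u τ)) (mc c' (u t) + mc (c t) u') t := by
  simp only [mc_eq_axial, ← axial_add]
  exact hasDerivAt_axial (hasDerivAt_matrix_mul (hasDerivAt_matrix_transpose hc.fst) hu.fst)

namespace BodyOfRevolution

variable (b : BodyOfRevolution)

/-! ## The point of contact -/

/-- The derivative of the profile function `ϱ`. -/
def dϱ (t : ℝ) : ℝ := derivWithin b.ϱ (Set.Icc (-1) 1) t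

/-- The derivative of the profile function `ζ`. -/
def dζ (t : ℝ) : ℝ := derivWithin b.ζ (Set.Icc (-1) 1) t

/-- The derivative of `s` along a velocity `γ'` of the Poisson vector. -/
def sdot (γ γ' : V3) : V3 :=
  ![b.dϱ (γ 2) * γ' 2 * γ 0 + b.ϱ (γ 2) * γ' 0, b.dϱ (γ 2) * γ' 2 * γ 1 + b.ϱ (γ 2) * γ' 1,
    b.dζ (γ 2) * γ' 2]

/-- The profile functions are smooth only within [-1, 1], with one-sided derivatives at the ends. As
the inner curve never leaves the interval, the composition still has a two-sided derivative. -/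
theorem hasDerivAt_comp_profile {f : ℝ → ℝ} (hf : ContDiffOn ℝ ∞ f (Set.Icc (-1) 1)) {γ : ℝ → ℝ}
    {γ' t : ℝ} (hγ : ∀ τ, γ τ ∈ Set.Icc (-1 : ℝ) 1) (h : HasDerivAt γ γ' t) :
    HasDerivAt (fun τ => f (γ τ)) (derivWithin f (Set.Icc (-1) 1) (γ t) * γ') t := by
  have h1 := ((hf.differentiableOn (by simp)) (γ t) (hγ t)).hasDerivWithinAt
  have h2 := HasDerivWithinAt.comp t h1 (h.hasDerivWithinAt (s := Set.univ)) (fun τ _ => hγ τ)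
  exact hasDerivWithinAt_univ.1 h2

theorem hasDerivAt_profileVec {γ : ℝ → V3} {γ' : V3} {t : ℝ} (hγ : ∀ τ, γ τ ⬝ᵥ γ τ = 1)
    (h : HasDerivAt γ γ' t) :
    HasDerivAt (fun τ => profileVec b.ϱ b.ζ (γ τ)) (b.sdot (γ t) γ') t := by
  have hi := hasDerivAt_pi.1 h
  have h1 := hasDerivAt_comp_profile b.ϱ_smooth (fun τ => mem_Icc_of_unit (hγ τ)) (hi 2)
  have h2 := hasDerivAt_comp_profile b.ζ_smooth (fun τ => mem_Icc_of_unit (hγ τ)) (hi 2)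
  refine hasDerivAt_pi.2 fun i => ?_
  fin_cases i
  · exact h1.mul (hi 0)
  · exact h1.mul (hi 1)
  · exact h2

/-- The surface is tangent to the plane at the point of contact. -/
theorem dot_sdot {γ : ℝ → V3} {γ' : V3} {t : ℝ} (hγ : ∀ τ, γ τ ⬝ᵥ γ τ = 1)
    (h : HasDerivAt γ γ' t) : γ t ⬝ᵥ b.sdot (γ t) γ' = 0 := by
  have h1 := hasDerivAt_dotProduct (hasDerivAt_const t (γ t)) (b.hasDerivAt_profileVec hγ h)
  -- The vector γ(t) is the inward normal at s(γ(t)), so among the points of the solid this one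
  -- minimises ⟨γ(t), ·⟩.
  have hmin : IsLocalMin (fun τ => γ t ⬝ᵥ profileVec b.ϱ b.ζ (γ τ)) t := by
    refine Filter.Eventually.of_forall fun τ => ?_
    obtain ⟨-, hm⟩ := b.gauss (γ t) (hγ t)
    by_cases e : profileVec b.ϱ b.ζ (γ τ) = profileVec b.ϱ b.ζ (γ t)
    · simp [e]
    · have := hm _ (b.gauss (γ τ) (hγ τ)).1 e
      rw [dotProduct_sub] at this
      exact (sub_pos.1 this).le
  simpa using hmin.hasDerivAt_eq_zero h1

/-! ## The configuration space and the constraint distribution -/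

variable {b}

theorem rowγ_unit {q : Conf} (hq : q ∈ b.Q) : rowγ q ⬝ᵥ rowγ q = 1 :=
  (row_dot_row hq.1 2 2).trans (if_pos rfl)

theorem rowγ_mem_Icc {q : Conf} (hq : q ∈ b.Q) : rowγ q 2 ∈ Set.Icc (-1 : ℝ) 1 :=
  mem_Icc_of_unit (rowγ_unit hq)

variable (b)

/-- The velocity in `D` with angular velocity `w`. -/
def Dvec (q : Conf) (w : V3) : Conf := (q.1 * hat w, -(q.1 *ᵥ (w ⨯₃ b.s q)))

variable {b}

theorem mc_mul_hat {q : Conf} (hq : q ∈ b.Q) (A : Matrix (Fin 3) (Fin 3) ℝ) (a : V3) :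
    mc q (q.1 * A, a) = axial A := by
  rw [mc_eq_axial, ← mul_assoc, transpose_mul_self_of_mem_SO hq.1, one_mul]

theorem mc_Dvec {q : Conf} (hq : q ∈ b.Q) (w : V3) : mc q (b.Dvec q w) = w := by
  rw [Dvec, mc_mul_hat hq, axial_hat]

/-- Differentiating gᵀg = 1 shows that gᵀġ is skew, hence recovered from its axial vector. -/
theorem fst_eq_mul_hat {c : ℝ → Conf} {c' : Conf} {t : ℝ} (hQ : ∀ τ, c τ ∈ b.Q)
    (h : HasDerivAt c c' t) : c'.1 = (c t).1 * hat (mc (c t) c') := by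
  have h1 := hasDerivAt_matrix_mul (hasDerivAt_matrix_transpose h.fst) h.fst
  have h2 : HasDerivAt (fun τ => (c τ).1ᵀ * (c τ).1) 0 t := by
    simp only [fun τ => transpose_mul_self_of_mem_SO (hQ τ).1]
    exact hasDerivAt_const t _
  have h3 := h1.unique h2
  rw [mc_eq_axial, hat_axial, ← mul_assoc, mul_transpose_self_of_mem_SO (hQ t).1, one_mul]
  rw [Matrix.transpose_mul, Matrix.transpose_transpose, add_comm]
  exact h3

theorem hasDerivAt_rowγ {c : ℝ → Conf} {w a : V3} {t : ℝ}
    (h : HasDerivAt c ((c t).1 * hat w, a) t) :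
    HasDerivAt (fun τ => rowγ (c τ)) (rowγ (c t) ⨯₃ w) t := by
  have h1 := hasDerivAt_pi.1 h.fst 2
  rw [← vecMul_hat]
  exact h1

theorem hasDerivAt_s {c : ℝ → Conf} {w a : V3} {t : ℝ} (hQ : ∀ τ, c τ ∈ b.Q)
    (h : HasDerivAt c ((c t).1 * hat w, a) t) :
    HasDerivAt (fun τ => b.s (c τ)) (b.sdot (rowγ (c t)) (rowγ (c t) ⨯₃ w)) t :=
  b.hasDerivAt_profileVec (fun τ => rowγ_unit (hQ τ)) (hasDerivAt_rowγ h)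

theorem contDiffOn_s : ContDiffOn ℝ ∞ b.s b.Q := by
  have hγ : ∀ i, ContDiffOn ℝ ∞ (fun q : Conf => rowγ q i) b.Q := fun i =>
    ((contDiff_entry 2 i).comp contDiff_fst).contDiffOn
  have h1 : ContDiffOn ℝ ∞ (fun q : Conf => b.ϱ (rowγ q 2)) b.Q :=
    b.ϱ_smooth.comp (hγ 2) fun q hq => rowγ_mem_Icc hq
  have h2 : ContDiffOn ℝ ∞ (fun q : Conf => b.ζ (rowγ q 2)) b.Q :=
    b.ζ_smooth.comp (hγ 2) fun q hq => rowγ_mem_Icc hq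
  refine contDiffOn_pi.2 fun i => ?_
  fin_cases i
  · exact h1.mul (hγ 0)
  · exact h1.mul (hγ 1)
  · exact h2

variable (b)

/-- A curve in `Q` through `q` with velocity `Dvec q w`. -/
def Qcurve (q : Conf) (w : V3) (t : ℝ) : Conf :=
  (q.1 * rotCurve w t,
    ![q.2 0 + t * (b.Dvec q w).2 0, q.2 1 + t * (b.Dvec q w).2 1,
      -((q.1 * rotCurve w t) 2 ⬝ᵥ profileVec b.ϱ b.ζ ((q.1 * rotCurve w t) 2))])

variable {b}
variable {q : Conf} (hq : q ∈ b.Q)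
include hq

theorem Qcurve_mem (w : V3) (t : ℝ) : b.Qcurve q w t ∈ b.Q :=
  ⟨mul_mem hq.1 (rotCurve_mem w t), rfl⟩

theorem Qcurve_zero (w : V3) : b.Qcurve q w 0 = q := by
  refine Prod.ext (by simp [Qcurve, rotCurve_zero]) ?_
  ext i
  fin_cases i
  · simp [Qcurve]
  · simp [Qcurve]
  · change -((q.1 * rotCurve w 0) 2 ⬝ᵥ profileVec b.ϱ b.ζ ((q.1 * rotCurve w 0) 2)) = q.2 2
    rw [rotCurve_zero, mul_one]
    exact hq.2.symm

theorem contDiff_Qcurve (w : V3) : ContDiff ℝ ∞ (b.Qcurve q w) := by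
  have h1 : ContDiff ℝ ∞ fun t => q.1 * rotCurve w t :=
    contDiffOn_univ.1 (contDiffOn_matrix_mul contDiffOn_const (contDiff_rotCurve w).contDiffOn)
  have h2 : ContDiff ℝ ∞ fun t => (q.1 * rotCurve w t) 2 := contDiff_pi.1 h1 2
  have hu : ∀ t, (q.1 * rotCurve w t) 2 ⬝ᵥ (q.1 * rotCurve w t) 2 = 1 := fun t => by
    simpa using row_dot_row (mul_mem hq.1 (rotCurve_mem w t)) 2 2
  have h3 : ContDiff ℝ ∞ fun t => profileVec b.ϱ b.ζ ((q.1 * rotCurve w t) 2) := by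
    have hi := contDiff_pi.1 h2
    have hr := b.ϱ_smooth.comp_contDiff (hi 2) fun t => mem_Icc_of_unit (hu t)
    have hz := b.ζ_smooth.comp_contDiff (hi 2) fun t => mem_Icc_of_unit (hu t)
    refine contDiff_pi.2 fun i => ?_
    fin_cases i
    · exact hr.mul (hi 0)
    · exact hr.mul (hi 1)
    · exact hz
  refine h1.prodMk (contDiff_pi.2 fun i => ?_)
  fin_cases i
  · exact contDiff_const.add (contDiff_id.mul contDiff_const)
  · exact contDiff_const.add (contDiff_id.mul contDiff_const)
  · exact (contDiffOn_univ.1 (contDiffOn_dotProduct h2.contDiffOn h3.contDiffOn)).neg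

theorem hasDerivAt_Qcurve (w : V3) : HasDerivAt (b.Qcurve q w) (b.Dvec q w) 0 := by
  have h1 : HasDerivAt (fun t => q.1 * rotCurve w t) (q.1 * hat w) 0 := by
    simpa using hasDerivAt_matrix_mul (hasDerivAt_const (0 : ℝ) q.1) (hasDerivAt_rotCurve w)
  have e0 : q.1 * rotCurve w 0 = q.1 := by rw [rotCurve_zero, mul_one]
  have h2 : HasDerivAt (fun t => (q.1 * rotCurve w t) 2) (rowγ q ⨯₃ w) 0 := by
    rw [← vecMul_hat]
    exact hasDerivAt_pi.1 h1 2
  have hu : ∀ t, (q.1 * rotCurve w t) 2 ⬝ᵥ (q.1 * rotCurve w t) 2 = 1 := fun t => by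
    simpa using row_dot_row (mul_mem hq.1 (rotCurve_mem w t)) 2 2
  have h3 := hasDerivAt_dotProduct h2 (b.hasDerivAt_profileVec hu h2)
  -- By tangency the derivative of -⟨γ, s⟩ loses its term ⟨γ, ṡ⟩. The remaining term is the vertical
  -- component of -g(w × s), so rolling without slipping preserves contact.
  have h4 := b.dot_sdot hu h2
  refine h1.prodMk (hasDerivAt_pi.2 fun i => ?_)
  fin_cases i
  · exact (((hasDerivAt_id (0 : ℝ)).mul_const ((b.Dvec q w).2 0)).const_add (q.2 0)).congr_deriv
      (one_mul _)
  · exact (((hasDerivAt_id (0 : ℝ)).mul_const ((b.Dvec q w).2 1)).const_add (q.2 1)).congr_deriv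
      (one_mul _)
  · refine h3.fun_neg.congr_deriv ?_
    rw [h4, add_zero, e0]
    change -((rowγ q ⨯₃ w) ⬝ᵥ b.s q) = -(rowγ q ⬝ᵥ (w ⨯₃ b.s q))
    rw [dotProduct_comm, triple_product_permutation]

theorem Dvec_mem (w : V3) : b.Dvec q w ∈ b.D q := by
  refine ⟨⟨b.Qcurve q w, contDiff_Qcurve hq w, Qcurve_zero hq w, Qcurve_mem hq w,
    (hasDerivAt_Qcurve hq w).deriv⟩, ?_⟩
  rw [mc_Dvec hq, Dvec, Matrix.mulVec_neg, transpose_mulVec_mulVec hq.1, add_neg_cancel]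

/-- Skewness of gᵀġ fixes the rotational component and the rolling constraint fixes the
translational one, so the angular velocity is a global coordinate on each fibre of `D`. -/
theorem eq_Dvec_of_mem {u : Conf} (hu : u ∈ b.D q) : u = b.Dvec q (mc q u) := by
  obtain ⟨⟨c, hc, h0, hQ, hd⟩, he⟩ := hu
  have h := (hc.differentiable (by simp) 0).hasDerivAt
  rw [hd] at h
  refine Prod.ext ?_ ?_
  · have := fst_eq_mul_hat hQ h
    rwa [h0] at this
  · rw [add_comm, add_eq_zero_iff_eq_neg] at he
    rw [← mulVec_transpose_mulVec hq.1 u.2, he, Matrix.mulVec_neg]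
    rfl

end BodyOfRevolution

namespace BodyOfRevolution

variable (b : BodyOfRevolution)

/-! ## The constraint manifold and the distribution `𝒞` -/

/-- The angular velocity of a phase. -/
def angVel (x : Phase) : V3 := mc x.1 x.2

/-- The vector of `𝒞` with angular velocity component `w` and angular acceleration component `w'`. -/
def Cvec (x : Phase) (w w' : V3) : Phase :=
  (b.Dvec x.1 w, (x.1.1 * (hat w * hat (angVel x) + hat w'),
    -(x.1.1 *ᵥ (w ⨯₃ (angVel x ⨯₃ b.s x.1) + w' ⨯₃ b.s x.1 +
      angVel x ⨯₃ b.sdot (rowγ x.1) (rowγ x.1 ⨯₃ w)))))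

variable {b}

theorem mk_Dvec_mem_M {q : Conf} (hq : q ∈ b.Q) (w : V3) : (q, b.Dvec q w) ∈ b.M :=
  ⟨hq, Dvec_mem hq w⟩

theorem angVel_mk_Dvec {q : Conf} (hq : q ∈ b.Q) (w : V3) : angVel (q, b.Dvec q w) = w :=
  mc_Dvec hq w

theorem snd_eq_Dvec {x : Phase} (hx : x ∈ b.M) : x.2 = b.Dvec x.1 (angVel x) :=
  eq_Dvec_of_mem hx.1 hx.2

theorem mk_Dvec_angVel {x : Phase} (hx : x ∈ b.M) : (x.1, b.Dvec x.1 (angVel x)) = x :=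
  Prod.ext rfl (snd_eq_Dvec hx).symm

/-- Every curve in ℳ has the form treated here (`mk_Dvec_angVel`), so this application of the
product rule is the source of the formula for `Cvec` and shows that nothing else lies in 𝒞. -/
theorem hasDerivAt_mk_Dvec {c : ℝ → Conf} {W : ℝ → V3} {w w' : V3} {t : ℝ} (hQ : ∀ τ, c τ ∈ b.Q)
    (hc : HasDerivAt c (b.Dvec (c t) w) t) (hW : HasDerivAt W w' t) :
    HasDerivAt (fun τ => (c τ, b.Dvec (c τ) (W τ)))
      (b.Cvec (c t, b.Dvec (c t) (W t)) w w') t := by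
  have h1 := hasDerivAt_matrix_mul hc.fst (hasDerivAt_hat hW)
  have h2 := (hasDerivAt_matrix_mulVec hc.fst
    (hasDerivAt_cross hW (hasDerivAt_s hQ hc))).fun_neg
  refine hc.prodMk ((h1.prodMk h2).congr_deriv (Prod.ext ?_ ?_))
  · simp only [angVel_mk_Dvec (hQ t)]
    simp only [Dvec, mul_add, mul_assoc]
  · simp only [angVel_mk_Dvec (hQ t)]
    simp only [Dvec, ← Matrix.mulVec_mulVec, hat_mulVec,
      ← Matrix.mulVec_add, add_assoc]

theorem contDiff_mk_Dvec {c : ℝ → Conf} {W : ℝ → V3} (hQ : ∀ τ, c τ ∈ b.Q) (hc : ContDiff ℝ ∞ c)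
    (hW : ContDiff ℝ ∞ W) : ContDiff ℝ ∞ (fun τ => (c τ, b.Dvec (c τ) (W τ))) := by
  have hs : ContDiff ℝ ∞ fun τ => b.s (c τ) := contDiffOn_s.comp_contDiff hc hQ
  have hg : ContDiff ℝ ∞ fun τ => (c τ).1 := contDiff_fst.comp hc
  rw [← contDiffOn_univ] at *
  exact hc.prodMk ((contDiffOn_matrix_mul hg (contDiffOn_hat hW)).prodMk
    (contDiffOn_matrix_mulVec hg (contDiffOn_cross hW hs)).neg)

variable (b)

/-- A curve in `ℳ` through `x` with velocity `Cvec x w w'`. -/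
def Mcurve (x : Phase) (w w' : V3) (t : ℝ) : Phase :=
  (b.Qcurve x.1 w t, b.Dvec (b.Qcurve x.1 w t) (angVel x + t • w'))

variable {b}

section
variable {x : Phase} (hx : x ∈ b.M) (w w' : V3)
include hx

theorem Mcurve_mem (t : ℝ) : b.Mcurve x w w' t ∈ b.M := mk_Dvec_mem_M (Qcurve_mem hx.1 w t) _

theorem Mcurve_zero : b.Mcurve x w w' 0 = x := by
  rw [Mcurve, Qcurve_zero hx.1, zero_smul, add_zero, mk_Dvec_angVel hx]

theorem contDiff_Mcurve : ContDiff ℝ ∞ (b.Mcurve x w w') :=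
  contDiff_mk_Dvec (Qcurve_mem hx.1 w) (contDiff_Qcurve hx.1 w)
    (contDiff_const.add (contDiff_id.smul contDiff_const))

theorem hasDerivAt_Mcurve : HasDerivAt (b.Mcurve x w w') (b.Cvec x w w') 0 := by
  have h1 := hasDerivAt_Qcurve hx.1 w
  have h2 : HasDerivAt (fun t : ℝ => angVel x + t • w') w' 0 := by
    simpa using ((hasDerivAt_id (0 : ℝ)).smul_const w').const_add (angVel x)
  rw [← Qcurve_zero hx.1 w] at h1
  have h := hasDerivAt_mk_Dvec (Qcurve_mem hx.1 w) (by rwa [Qcurve_zero hx.1 w] at h1 ⊢) h2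
  rw [Qcurve_zero hx.1, zero_smul, add_zero, mk_Dvec_angVel hx] at h
  exact h

theorem Cvec_mem : b.Cvec x w w' ∈ b.C x :=
  ⟨⟨b.Mcurve x w w', contDiff_Mcurve hx w w', Mcurve_zero hx w w', Mcurve_mem hx w w',
    (hasDerivAt_Mcurve hx w w').deriv⟩, Dvec_mem hx.1 w⟩

omit w w' in
/-- A velocity of a curve in `ℳ` that projects into `D`, with its angular components. -/
theorem deriv_eq_Cvec {c : ℝ → Phase} {v : Phase} (hM : ∀ t, c t ∈ b.M) (h0 : c 0 = x)
    (h : HasDerivAt c v 0) (hv : v.1 ∈ b.D x.1) {w' : V3}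
    (hw' : HasDerivAt (fun t => angVel (c t)) w' 0) : v = b.Cvec x (mc x.1 v.1) w' := by
  have e := eq_Dvec_of_mem hx.1 hv
  have h1 : HasDerivAt (fun t => (c t).1) v.1 0 := h.fst
  rw [e] at h1
  have h2 := hasDerivAt_mk_Dvec (c := fun t => (c t).1) (w := mc x.1 v.1) (fun t => (hM t).1)
    (by rw [h0]; exact h1) hw'
  simp only [fun t => mk_Dvec_angVel (hM t), h0, mk_Dvec_angVel hx] at h2
  exact h.unique h2

omit w w' in
theorem exists_eq_Cvec {v : Phase} (hv : v ∈ b.C x) : ∃ w w', v = b.Cvec x w w' := by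
  obtain ⟨⟨c, hc, h0, hM, hd⟩, hD⟩ := hv
  have h := (hc.differentiable (by simp) 0).hasDerivAt
  rw [hd] at h
  exact ⟨_, _, deriv_eq_Cvec hx hM h0 h hD (hasDerivAt_mc h.fst h.snd)⟩

end

variable (b)

theorem Dvec_add (q : Conf) (w z : V3) : b.Dvec q (w + z) = b.Dvec q w + b.Dvec q z := by
  simp [Dvec, hat_add, mul_add, Matrix.mulVec_add, add_comm]

theorem Dvec_smul (q : Conf) (c : ℝ) (w : V3) : b.Dvec q (c • w) = c • b.Dvec q w := by
  simp [Dvec, hat_smul, Matrix.mulVec_smul]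

theorem sdot_add (γ v w : V3) : b.sdot γ (v + w) = b.sdot γ v + b.sdot γ w := by
  ext i; fin_cases i <;> simp [sdot] <;> ring

theorem sdot_smul (γ : V3) (c : ℝ) (v : V3) : b.sdot γ (c • v) = c • b.sdot γ v := by
  ext i; fin_cases i <;> simp [sdot] <;> ring

theorem Cvec_add (x : Phase) (w w' z z' : V3) :
    b.Cvec x (w + z) (w' + z') = b.Cvec x w w' + b.Cvec x z z' := by
  refine Prod.ext (b.Dvec_add _ _ _) (Prod.ext ?_ ?_)
  · simp only [Cvec, hat_add, add_mul, mul_add, Prod.snd_add, Prod.fst_add]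
    abel
  · simp only [Cvec, map_add, LinearMap.add_apply, sdot_add, Matrix.mulVec_add, Prod.snd_add]
    abel

theorem Cvec_smul (x : Phase) (c : ℝ) (w w' : V3) :
    b.Cvec x (c • w) (c • w') = c • b.Cvec x w w' := by
  refine Prod.ext (b.Dvec_smul _ _ _) (Prod.ext ?_ ?_)
  · simp only [Cvec, hat_smul, Matrix.smul_mul, Prod.smul_snd, Prod.smul_fst, ← Matrix.mul_smul,
      smul_add]
  · simp only [Cvec, map_smul, LinearMap.smul_apply, sdot_smul, Prod.smul_snd, ← smul_add,
      Matrix.mulVec_smul, smul_neg]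

/-! ## The two-forms on `𝒞` -/

/-- The inertia tensor. -/
def inertia : Matrix (Fin 3) (Fin 3) ℝ := Matrix.diagonal ![b.I₁, b.I₁, b.I₃]

/-- The canonical two-form on `𝒞` in angular components. -/
def canonicalForm (x : Phase) (w w' z z' : V3) : ℝ :=
  -(w' ⬝ᵥ (b.inertia *ᵥ z) - z' ⬝ᵥ (b.inertia *ᵥ w) - angVel x ⬝ᵥ (b.inertia *ᵥ (w ⨯₃ z)) +
    b.m * ((w ⨯₃ (angVel x ⨯₃ b.s x.1) + w' ⨯₃ b.s x.1 +
      angVel x ⨯₃ b.sdot (rowγ x.1) (rowγ x.1 ⨯₃ w)) ⬝ᵥ (z ⨯₃ b.s x.1)) -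
    b.m * ((z ⨯₃ (angVel x ⨯₃ b.s x.1) + z' ⨯₃ b.s x.1 +
      angVel x ⨯₃ b.sdot (rowγ x.1) (rowγ x.1 ⨯₃ z)) ⬝ᵥ (w ⨯₃ b.s x.1)))

/-- The two-form `B` on `𝒞` in angular components. -/
def gaugeForm (x : Phase) (w z : V3) : ℝ :=
  -(b.m * b.ϱ (rowγ x.1 2) * (rowγ x.1 ⬝ᵥ b.s x.1) * (angVel x ⬝ᵥ (w ⨯₃ z)))

theorem hasDerivAt_line {E : Type*} [NormedAddCommGroup E] [NormedSpace ℝ E] (x v : E) :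
    HasDerivAt (fun t : ℝ => x + t • v) v 0 := by
  simpa using ((hasDerivAt_id (0 : ℝ)).smul_const v).const_add x

theorem fderiv_eq_of_hasDerivAt_line {E : Type*} [NormedAddCommGroup E] [NormedSpace ℝ E]
    {F : E → ℝ} {x v : E} {d : ℝ} (hF : DifferentiableAt ℝ F x)
    (h : HasDerivAt (fun t : ℝ => F (x + t • v)) d 0) : fderiv ℝ F x v = d := by
  have h1 := hasDerivAt_line x v
  have h2 : HasFDerivAt F (fderiv ℝ F x) (x + (0 : ℝ) • v) := by
    simpa using hF.hasFDerivAt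
  exact (h2.comp_hasDerivAt (0 : ℝ) h1).unique h

theorem contDiff_mc {E : Type*} [NormedAddCommGroup E] [NormedSpace ℝ E] {f h : E → Conf}
    {n : WithTop ℕ∞} {S : Set E} (hf : ContDiffOn ℝ n f S) (hh : ContDiffOn ℝ n h S) :
    ContDiffOn ℝ n (fun y => mc (f y) (h y)) S := by
  simp only [mc_eq_axial]
  refine contDiffOn_axial (contDiffOn_matrix_mul ?_ ?_)
  · have hf1 : ContDiffOn ℝ n (fun y => (f y).1) S := contDiff_fst.comp_contDiffOn hf
    exact contDiffOn_matrix.2 fun i j => contDiffOn_entry hf1 j i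
  · exact contDiff_fst.comp_contDiffOn hh

theorem contDiffOn_κ {E : Type*} [NormedAddCommGroup E] [NormedSpace ℝ E] {f h k : E → Conf}
    {n : WithTop ℕ∞} {S : Set E} (hf : ContDiffOn ℝ n f S) (hh : ContDiffOn ℝ n h S)
    (hk : ContDiffOn ℝ n k S) : ContDiffOn ℝ n (fun y => b.κ (f y) (h y) (k y)) S :=
  (contDiffOn_dotProduct (contDiff_mc hf hh)
    (contDiffOn_matrix_mulVec contDiffOn_const (contDiff_mc hf hk))).add
    (contDiffOn_const.mul (contDiffOn_dotProduct (contDiff_snd.comp_contDiffOn hh)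
      (contDiff_snd.comp_contDiffOn hk)))

theorem fderiv_Θ (x v u : Phase) :
    fderiv ℝ (fun y => b.Θ y u) x v =
      (mc v.1 x.2 + mc x.1 v.2) ⬝ᵥ (b.inertia *ᵥ mc x.1 u.1) +
        angVel x ⬝ᵥ (b.inertia *ᵥ mc v.1 u.1) + b.m * (v.2.2 ⬝ᵥ u.1.2) := by
  refine fderiv_eq_of_hasDerivAt_line ?_ ?_
  · have h := b.contDiffOn_κ (n := 1) (S := Set.univ) contDiff_fst.contDiffOn
      contDiff_snd.contDiffOn (contDiffOn_const (c := u.1) : ContDiffOn ℝ 1 (fun _ : Phase => u.1) _)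
    exact (contDiffOn_univ.1 h).differentiable (by simp) x
  · have hy := hasDerivAt_line x v
    have h1 := hasDerivAt_mc hy.fst hy.snd
    have h2 := hasDerivAt_mc hy.fst (hasDerivAt_const (0 : ℝ) u.1)
    have h3 := hasDerivAt_dotProduct h1
      (hasDerivAt_matrix_mulVec (hasDerivAt_const (0 : ℝ) b.inertia) h2)
    have h4 := (hasDerivAt_dotProduct hy.snd.snd (hasDerivAt_const (0 : ℝ) u.1.2)).const_mul b.m
    refine (h3.add h4).congr_deriv ?_
    have h0 : mc x.1 0 = 0 := by
      ext i; fin_cases i <;> simp [mc]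
    simp [h0, angVel]

theorem fderiv_mc (x v u : Phase) (i : Fin 3) :
    fderiv ℝ (fun y : Phase => mc y.1 u.1 i) x v = mc v.1 u.1 i := by
  refine fderiv_eq_of_hasDerivAt_line ?_ ?_
  · have h := contDiff_mc (n := 1) (S := Set.univ) contDiff_fst.contDiffOn
      (contDiffOn_const (c := u.1) : ContDiffOn ℝ 1 (fun _ : Phase => u.1) _)
    exact (contDiff_pi.1 (contDiffOn_univ.1 h) i).differentiable (by simp) x
  · have h2 := hasDerivAt_mc (hasDerivAt_line x v).fst (hasDerivAt_const (0 : ℝ) u.1)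
    refine (hasDerivAt_pi.1 h2 i).congr_deriv ?_
    have h0 : mc x.1 0 = 0 := by
      ext i; fin_cases i <;> simp [mc]
    simp [h0]

theorem extD_phase (θ : Phase → Phase → ℝ) (x v u : Phase) :
    extD θ x v u = fderiv ℝ (fun y => θ y u) x v - fderiv ℝ (fun y => θ y v) x u := rfl

variable {b}

section
variable {x : Phase} (hx : x ∈ b.M) (w w' z z' : V3)
include hx

/-- Since `mc` is linear in both arguments, inserting a velocity in place of the base point gives
the derivative of the Maurer-Cartan forms along that velocity. Antisymmetrising in w and z yields
the structure equation dλ(w, z) = -w × z, used for both two-forms. -/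
theorem mc_Dvec_Dvec : mc (b.Dvec x.1 w) (b.Dvec x.1 z) = -axial (hat w * hat z) := by
  have e : (x.1.1 * hat w)ᵀ * (x.1.1 * hat z) = (-1 : ℝ) • (hat w * hat z) := by
    rw [Matrix.transpose_mul, hat_transpose, mul_assoc, ← mul_assoc x.1.1ᵀ,
      transpose_mul_self_of_mem_SO hx.1.1, one_mul, neg_mul, neg_one_smul]
  rw [mc_eq_axial, Dvec, Dvec, e, axial_smul, neg_one_smul]

theorem fderiv_Θ_Cvec :
    fderiv ℝ (fun y => b.Θ y (b.Cvec x z z')) x (b.Cvec x w w') =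
      w' ⬝ᵥ (b.inertia *ᵥ z) - angVel x ⬝ᵥ (b.inertia *ᵥ axial (hat w * hat z)) +
      b.m * ((w ⨯₃ (angVel x ⨯₃ b.s x.1) + w' ⨯₃ b.s x.1 +
      angVel x ⨯₃ b.sdot (rowγ x.1) (rowγ x.1 ⨯₃ w)) ⬝ᵥ (z ⨯₃ b.s x.1)) := by
  rw [fderiv_Θ]
  -- The contribution of the moving frame gᵀ cancels the term `hat w * hat (angVel x)` of the
  -- acceleration, so the angular velocity itself changes at the rate w'.
  have e1 : mc (b.Cvec x w w').1 x.2 + mc x.1 (b.Cvec x w w').2 = w' := by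
    have h1 : mc (b.Cvec x w w').1 x.2 = -axial (hat w * hat (angVel x)) := by
      rw [snd_eq_Dvec hx]
      exact mc_Dvec_Dvec hx w _
    rw [h1, Cvec, mc_mul_hat hx.1, axial_add, axial_hat, neg_add_cancel_left]
  have e2 : mc x.1 (b.Cvec x z z').1 = z := mc_Dvec hx.1 z
  have e3 : mc (b.Cvec x w w').1 (b.Cvec x z z').1 = -axial (hat w * hat z) := mc_Dvec_Dvec hx w z
  rw [e1, e2, e3, Matrix.mulVec_neg, dotProduct_neg, ← sub_eq_add_neg]
  simp only [Cvec, Dvec, neg_dotProduct_neg, dotProduct_mulVec_mulVec hx.1.1]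

theorem ΩM_Cvec : b.ΩM x (b.Cvec x w w') (b.Cvec x z z') = b.canonicalForm x w w' z z' := by
  rw [ΩM, extD_phase, fderiv_Θ_Cvec hx, fderiv_Θ_Cvec hx, canonicalForm, ← axial_hat_mul_hat_sub w z,
    Matrix.mulVec_sub, dotProduct_sub]
  ring

theorem B_Cvec : b.B x (b.Cvec x w w') (b.Cvec x z z') = b.gaugeForm x w z := by
  have e : ∀ i, extD (fun y u : Phase => mc y.1 u.1 i) x (b.Cvec x w w') (b.Cvec x z z') =
      -((w ⨯₃ z) i) := by
    intro i
    rw [extD_phase, fderiv_mc, fderiv_mc]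
    have h1 : mc (b.Cvec x w w').1 (b.Cvec x z z').1 = _ := mc_Dvec_Dvec hx w z
    have h2 : mc (b.Cvec x z z').1 (b.Cvec x w w').1 = _ := mc_Dvec_Dvec hx z w
    rw [h1, h2, ← axial_hat_mul_hat_sub, Pi.neg_apply, Pi.neg_apply, Pi.sub_apply]
    ring
  simp only [B, e, mul_neg, Finset.sum_neg_distrib, gaugeForm]
  rfl

theorem ΩB_Cvec : b.ΩB x (b.Cvec x w w') (b.Cvec x z z') =
    b.canonicalForm x w w' z z' + b.gaugeForm x w z := by
  rw [ΩB, ΩM_Cvec hx, B_Cvec hx]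

end

theorem ΩB_antisymm (x v w : Phase) : b.ΩB x v w = -b.ΩB x w v := by
  have h : ∀ (θ : Phase → Phase → ℝ), extD θ x v w = -extD θ x w v := fun θ => by
    rw [extD, extD]; ring
  rw [ΩB, ΩB, ΩM, ΩM, B, B, h b.Θ]
  simp only [h (fun y z => mc y.1 z.1 _), mul_neg, Finset.sum_neg_distrib]
  ring

end BodyOfRevolution

/-! ## Solving the Hamilton equations on `𝒞` -/

theorem linearMap_eq_dotProduct (l : V3 →ₗ[ℝ] ℝ) : ∃ a : V3, ∀ z, l z = a ⬝ᵥ z := by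
  refine ⟨fun i => l (Pi.single i 1), fun z => ?_⟩
  conv_lhs => rw [LinearMap.pi_apply_eq_sum_univ l z]
  simp only [dotProduct, smul_eq_mul]
  refine Finset.sum_congr rfl fun i _ => ?_
  rw [mul_comm]
  congr 2
  ext j
  simp [Pi.single_apply, eq_comm]

theorem eq_of_forall_dotProduct {a a' : V3} (h : ∀ z, a ⬝ᵥ z = a' ⬝ᵥ z) : a = a' := by
  ext i
  simpa using h (Pi.single i 1)

/-- The system is triangular: z = 0 leaves an equation for K w alone, and with w known the terms in
z determine K w'. Definiteness makes K bijective, so the block A may be arbitrary as long as it is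
linear in z. -/
theorem existsUnique_hamilton (K : V3 →ₗ[ℝ] V3) (hK : ∀ v, K v ⬝ᵥ v = 0 → v = 0)
    {A : V3 → V3 → ℝ} (hA : ∀ w, IsLinearMap ℝ (A w)) {a : V3 → V3 → ℝ}
    {a₁ a₂ : V3 →ₗ[ℝ] ℝ} (ha : ∀ z z', a z z' = a₁ z + a₂ z') :
    ∃! p : V3 × V3, ∀ z z', K p.1 ⬝ᵥ z' - K p.2 ⬝ᵥ z + A p.1 z = a z z' := by
  have inj : Function.Injective K := by
    refine (injective_iff_map_eq_zero K).2 fun v hv => hK v ?_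
    rw [hv, zero_dotProduct]
  have surj : Function.Surjective K := LinearMap.injective_iff_surjective.1 inj
  obtain ⟨v₂, hv₂⟩ := linearMap_eq_dotProduct a₂
  obtain ⟨w, hw⟩ := surj v₂
  obtain ⟨v₁, hv₁⟩ := linearMap_eq_dotProduct ((hA w).mk' - a₁)
  obtain ⟨w', hw'⟩ := surj v₁
  have hv₁' : ∀ z, A w z - a₁ z = v₁ ⬝ᵥ z := hv₁
  refine ⟨(w, w'), fun z z' => ?_, ?_⟩
  · rw [hw, hw', ha, ← hv₁', ← hv₂]
    ring
  · rintro ⟨u, u'⟩ hu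
    have e : u = w := inj (eq_of_forall_dotProduct fun z' => by
      have := hu 0 z'
      rw [ha, (hA u).map_zero, map_zero, dotProduct_zero] at this
      rw [hw, ← hv₂]
      linarith)
    subst e
    have e' : u' = w' := inj (eq_of_forall_dotProduct fun z => by
      have := hu z 0
      rw [ha, map_zero, dotProduct_zero] at this
      rw [hw', ← hv₁']
      linarith)
    rw [e']

namespace BodyOfRevolution

variable (b : BodyOfRevolution)

/-- The kinetic energy tensor of the constrained body. -/
def kin (q : Conf) : V3 →ₗ[ℝ] V3 :=
  b.inertia.mulVecLin + b.m • (crossProduct (b.s q) ∘ₗ (-crossProduct (b.s q)))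

theorem kin_apply (q : Conf) (v : V3) :
    b.kin q v = b.inertia *ᵥ v + b.m • (b.s q ⨯₃ (v ⨯₃ b.s q)) := by
  rw [← cross_anticomm (b.s q) v, map_neg, smul_neg]
  simp [kin, -cross_anticomm]

theorem kin_dot (q : Conf) (v w : V3) :
    b.kin q v ⬝ᵥ w = v ⬝ᵥ (b.inertia *ᵥ w) + b.m * ((v ⨯₃ b.s q) ⬝ᵥ (w ⨯₃ b.s q)) := by
  rw [kin_apply, add_dotProduct, smul_dotProduct, smul_eq_mul]
  simp [inertia, Matrix.mulVec_diagonal, dotProduct, Fin.sum_univ_three, cross_apply]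
  ring

theorem kin_dot_comm (q : Conf) (v w : V3) : b.kin q v ⬝ᵥ w = b.kin q w ⬝ᵥ v := by
  rw [kin_dot, kin_dot]
  simp [inertia, Matrix.mulVec_diagonal, dotProduct, Fin.sum_univ_three]
  ring

theorem eq_zero_of_kin_dot (q : Conf) {v : V3} (h : b.kin q v ⬝ᵥ v = 0) : v = 0 := by
  rw [kin_dot] at h
  have h1 : 0 ≤ b.m * ((v ⨯₃ b.s q) ⬝ᵥ (v ⨯₃ b.s q)) := by
    refine mul_nonneg b.m_pos.le ?_
    rw [dotProduct]
    exact Finset.sum_nonneg fun i _ => mul_self_nonneg _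
  have h2 : v ⬝ᵥ (b.inertia *ᵥ v) = b.I₁ * v 0 ^ 2 + b.I₁ * v 1 ^ 2 + b.I₃ * v 2 ^ 2 := by
    simp [inertia, Matrix.mulVec_diagonal, dotProduct, Fin.sum_univ_three]
    ring
  have p := b.I₁_pos
  have p₃ := b.I₃_pos
  have q0 : 0 ≤ b.I₁ * v 0 ^ 2 := by positivity
  have q1 : 0 ≤ b.I₁ * v 1 ^ 2 := by positivity
  have q2 : 0 ≤ b.I₃ * v 2 ^ 2 := by positivity
  have z0 : b.I₁ * v 0 ^ 2 = 0 := by linarith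
  have z1 : b.I₁ * v 1 ^ 2 = 0 := by linarith
  have z2 : b.I₃ * v 2 ^ 2 = 0 := by linarith
  ext i
  fin_cases i
  · simpa [p.ne'] using z0
  · simpa [p.ne'] using z1
  · simpa [p₃.ne'] using z2

/-- The terms containing w' or z' assemble into the kinetic tensor. The rest involves only w and z
and plays no role in nondegeneracy. -/
theorem canonicalForm_eq (x : Phase) (w w' z z' : V3) :
    b.canonicalForm x w w' z z' =
      b.kin x.1 w ⬝ᵥ z' - b.kin x.1 w' ⬝ᵥ z + b.canonicalForm x w 0 z 0 := by
  rw [kin_dot_comm, kin_dot, kin_dot]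
  simp only [canonicalForm, add_dotProduct, map_zero, LinearMap.zero_apply, zero_dotProduct]
  ring

theorem isLinearMap_canonicalForm (x : Phase) (w : V3) :
    IsLinearMap ℝ fun z => b.canonicalForm x w 0 z 0 := by
  constructor
  · intro z₁ z₂
    simp only [canonicalForm, map_add, LinearMap.add_apply, sdot_add, Matrix.mulVec_add,
      add_dotProduct, dotProduct_add, zero_dotProduct, map_zero, LinearMap.zero_apply]
    ring
  · intro c z
    simp only [canonicalForm, map_smul, LinearMap.smul_apply, sdot_smul, Matrix.mulVec_smul,
      add_dotProduct, smul_dotProduct, dotProduct_smul, zero_dotProduct, smul_eq_mul, map_zero,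
      LinearMap.zero_apply]
    ring

theorem isLinearMap_gaugeForm (x : Phase) (w : V3) : IsLinearMap ℝ (b.gaugeForm x w) := by
  constructor
  · intro z₁ z₂
    simp only [gaugeForm, map_add, dotProduct_add]
    ring
  · intro c z
    simp only [gaugeForm, map_smul, dotProduct_smul, smul_eq_mul]
    ring

/-- Stated for a general block A so that one argument serves both forms: B depends only on the base
angular velocities and leaves the blocks containing K untouched. -/
theorem nondegOnC_of_form {σ : Phase → Phase → Phase → ℝ} {A : Phase → V3 → V3 → ℝ}
    (hA : ∀ x w, IsLinearMap ℝ (A x w))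
    (hσ : ∀ x ∈ b.M, ∀ w w' z z', σ x (b.Cvec x w w') (b.Cvec x z z') =
      b.kin x.1 w ⬝ᵥ z' - b.kin x.1 w' ⬝ᵥ z + A x w z) : b.NondegOnC σ := by
  intro x hx α
  let a₁ : V3 →ₗ[ℝ] ℝ :=
    { toFun := fun z => α (b.Cvec x z 0)
      map_add' := fun z z' => by rw [← map_add, ← Cvec_add, add_zero]
      map_smul' := fun c z => by
        rw [RingHom.id_apply, ← map_smul, ← Cvec_smul, smul_zero] }
  let a₂ : V3 →ₗ[ℝ] ℝ :=
    { toFun := fun z => α (b.Cvec x 0 z)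
      map_add' := fun z z' => by rw [← map_add, ← Cvec_add, add_zero]
      map_smul' := fun c z => by
        rw [RingHom.id_apply, ← map_smul, ← Cvec_smul, smul_zero] }
  have ha : ∀ z z', α (b.Cvec x z z') = a₁ z + a₂ z' := fun z z' => by
    change _ = α (b.Cvec x z 0) + α (b.Cvec x 0 z')
    rw [← map_add, ← Cvec_add, add_zero, zero_add]
  obtain ⟨⟨w, w'⟩, hp, hu⟩ := existsUnique_hamilton (b.kin x.1)
    (fun v hv => b.eq_zero_of_kin_dot x.1 hv) (hA x) ha
  refine ⟨b.Cvec x w w', ⟨Cvec_mem hx w w', fun v hv => ?_⟩, ?_⟩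
  · obtain ⟨z, z', rfl⟩ := exists_eq_Cvec hx hv
    rw [hσ x hx, hp]
  · rintro Y ⟨hY, hY'⟩
    obtain ⟨u, u', rfl⟩ := exists_eq_Cvec hx hY
    have := hu (u, u') fun z z' => by
      rw [← hσ x hx u u' z z', hY' _ (Cvec_mem hx z z')]
    rw [Prod.mk.injEq] at this
    rw [this.1, this.2]

theorem nondegOnC_ΩM : b.NondegOnC b.ΩM :=
  b.nondegOnC_of_form b.isLinearMap_canonicalForm fun x hx w w' z z' => by
    rw [ΩM_Cvec hx, canonicalForm_eq]

theorem nondegOnC_ΩB : b.NondegOnC b.ΩB :=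
  b.nondegOnC_of_form (A := fun x w z => b.canonicalForm x w 0 z 0 + b.gaugeForm x w z)
    (fun x w => ((b.isLinearMap_canonicalForm x w).mk' + (b.isLinearMap_gaugeForm x w).mk').isLinear)
    fun x hx w w' z z' => by
      rw [ΩB_Cvec hx, canonicalForm_eq, add_assoc]

variable {b}

theorem sharp_eq_neg {σ : Phase → Phase → Phase → ℝ} (hσ : b.NondegOnC σ) {x : Phase}
    (hx : x ∈ b.M) {α : Phase →L[ℝ] ℝ} {X : Phase} (hX : b.IsHamAt σ x α X) :
    b.sharp σ x α = -X := by
  have h := hσ x hx α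
  rw [sharp, dif_pos h, h.unique h.choose_spec.1 hX]

theorem isHamAt_neg_sharp {σ : Phase → Phase → Phase → ℝ} (hσ : b.NondegOnC σ) {x : Phase}
    (hx : x ∈ b.M) (α : Phase →L[ℝ] ℝ) : b.IsHamAt σ x α (-b.sharp σ x α) := by
  obtain ⟨X, hX, -⟩ := hσ x hx α
  rw [sharp_eq_neg hσ hx hX, neg_neg]
  exact hX

/-! ## Differentials along curves -/

/-- `dM` is a derivative within ℳ of an extension by zero, and on such a thin set this derivative
need not be unique. The chain rule along curves inside ℳ holds for any choice, so the values on
their velocities are the intrinsic ones. -/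
theorem hasDerivAt_dM {f : b.M → ℝ} (hf : b.Smooth f) {x : b.M} {c : ℝ → Phase} {v : Phase}
    (hM : ∀ t, c t ∈ b.M) (h0 : c 0 = x) (h : HasDerivAt c v 0) :
    HasDerivAt (fun t => f ⟨c t, hM t⟩) (b.dM f x v) 0 := by
  have h1 := (hf.differentiableOn (by simp) x x.2).hasFDerivWithinAt
  rw [← h0] at h1
  have h2 := h1.comp_hasDerivWithinAt 0 (h.hasDerivWithinAt (s := Set.univ)) fun t _ => hM t
  rw [h0, hasDerivWithinAt_univ] at h2
  refine h2.congr_of_eventuallyEq (Filter.Eventually.of_forall fun t => ?_)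
  exact (Subtype.val_injective.extend_apply f 0 ⟨c t, hM t⟩).symm

theorem dM_Cvec_eq {f : b.M → ℝ} (hf : b.Smooth f) {x : b.M} {w w' : V3} {d : ℝ}
    (h : HasDerivAt (fun t => f ⟨b.Mcurve x w w' t, Mcurve_mem x.2 w w' t⟩) d 0) :
    b.dM f x (b.Cvec x w w') = d :=
  (hasDerivAt_dM hf (Mcurve_mem x.2 w w') (Mcurve_zero x.2 w w')
    (hasDerivAt_Mcurve x.2 w w')).unique h

end BodyOfRevolution

/-! ## The action of the symmetry group -/

theorem rotZ_mulVec_two (θ : Real.Angle) (v : V3) : (rotZ θ *ᵥ v) 2 = v 2 := by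
  simp [rotZ, Matrix.mulVec, dotProduct, Fin.sum_univ_three]

theorem rotZ_mul_two (θ : Real.Angle) (A : Matrix (Fin 3) (Fin 3) ℝ) : (rotZ θ * A) 2 = A 2 := by
  ext i
  simp [rotZ, Matrix.mul_apply, Fin.sum_univ_three]

theorem rotZ_mulVec_e₃ (θ : Real.Angle) : rotZ θ *ᵥ e₃ = e₃ := by
  ext i
  fin_cases i <;> simp [rotZ, e₃, Matrix.mulVec, dotProduct, Fin.sum_univ_three]

theorem rowγ_actQ (h : SymGroup) (q : Conf) : rowγ (actQ h q) = rotZ h.spin *ᵥ rowγ q := by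
  change (rotZ h.rot * q.1 * (rotZ h.spin)ᵀ) 2 = _
  rw [mul_assoc, rotZ_mul_two, Matrix.mul_apply_eq_vecMul, Matrix.vecMul_transpose]
  rfl

theorem profileVec_rotZ (ϱ ζ : ℝ → ℝ) (θ : Real.Angle) (γ : V3) :
    profileVec ϱ ζ (rotZ θ *ᵥ γ) = rotZ θ *ᵥ profileVec ϱ ζ γ := by
  have h := rotZ_mulVec_two θ γ
  ext i
  fin_cases i <;>
    simp [profileVec, h] <;> simp [rotZ, Matrix.mulVec, dotProduct, Fin.sum_univ_three] <;> ring

/-- The lift of a symmetry to velocities of phases. -/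
def actLin (h : SymGroup) (v : Phase) : Phase :=
  ((rotZ h.rot * v.1.1 * (rotZ h.spin)ᵀ, rotZ h.rot *ᵥ v.1.2),
    (rotZ h.rot * v.2.1 * (rotZ h.spin)ᵀ, rotZ h.rot *ᵥ v.2.2))

theorem hasDerivAt_actM (h : SymGroup) {c : ℝ → Phase} {v : Phase} {t : ℝ}
    (hc : HasDerivAt c v t) : HasDerivAt (fun τ => actM h (c τ)) (actLin h v) t := by
  have key : ∀ {A : ℝ → Matrix (Fin 3) (Fin 3) ℝ} {A' : Matrix (Fin 3) (Fin 3) ℝ},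
      HasDerivAt A A' t → HasDerivAt (fun τ => rotZ h.rot * A τ * (rotZ h.spin)ᵀ)
        (rotZ h.rot * A' * (rotZ h.spin)ᵀ) t := fun hA => by
    simpa using hasDerivAt_matrix_mul (hasDerivAt_matrix_mul (hasDerivAt_const t (rotZ h.rot)) hA)
      (hasDerivAt_const t (rotZ h.spin)ᵀ)
  have key' : ∀ {a : ℝ → V3} {a' : V3}, HasDerivAt a a' t →
      HasDerivAt (fun τ => rotZ h.rot *ᵥ a τ) (rotZ h.rot *ᵥ a') t := fun ha => by
    simpa using hasDerivAt_matrix_mulVec (hasDerivAt_const t (rotZ h.rot)) ha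
  exact ((key hc.fst.fst).prodMk ((key' hc.fst.snd).add_const _)).prodMk
    ((key hc.snd.fst).prodMk (key' hc.snd.snd))

namespace BodyOfRevolution

variable (b : BodyOfRevolution)

theorem sdot_rotZ (θ : Real.Angle) (γ γ' : V3) :
    b.sdot (rotZ θ *ᵥ γ) (rotZ θ *ᵥ γ') = rotZ θ *ᵥ b.sdot γ γ' := by
  have h := rotZ_mulVec_two θ γ
  have h' := rotZ_mulVec_two θ γ'
  ext i
  fin_cases i <;>
    simp [sdot, h, h'] <;> simp [rotZ, Matrix.mulVec, dotProduct, Fin.sum_univ_three] <;> ring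

theorem inertia_rotZ (θ : Real.Angle) (v : V3) :
    b.inertia *ᵥ (rotZ θ *ᵥ v) = rotZ θ *ᵥ (b.inertia *ᵥ v) := by
  ext i
  fin_cases i <;> simp [inertia, Matrix.mulVec_diagonal] <;>
    simp [rotZ, Matrix.mulVec, dotProduct, Fin.sum_univ_three] <;> ring

theorem s_actQ (h : SymGroup) (q : Conf) : b.s (actQ h q) = rotZ h.spin *ᵥ b.s q := by
  rw [s, rowγ_actQ, profileVec_rotZ, s]

variable {b}

theorem actQ_mem (h : SymGroup) {q : Conf} (hq : q ∈ b.Q) : actQ h q ∈ b.Q := by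
  refine ⟨mul_mem (mul_mem (rotZ_mem _) hq.1) (transpose_mem_SO (rotZ_mem _)), ?_⟩
  rw [s_actQ, rowγ_actQ, dotProduct_mulVec_mulVec (rotZ_mem _), ← hq.2]
  change (rotZ h.rot *ᵥ q.2) 2 + 0 = q.2 2
  rw [rotZ_mulVec_two, add_zero]

theorem mul_hat_conj (P g R A : Matrix (Fin 3) (Fin 3) ℝ) (hR : Rᵀ * R = 1) :
    P * (g * A) * Rᵀ = P * g * Rᵀ * (R * A * Rᵀ) := by
  simp only [mul_assoc]
  rw [← mul_assoc Rᵀ R, hR, one_mul]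

theorem mulVec_conj (P g R : Matrix (Fin 3) (Fin 3) ℝ) (v : V3) (hR : Rᵀ * R = 1) :
    P *ᵥ (g *ᵥ v) = (P * g * Rᵀ) *ᵥ (R *ᵥ v) := by
  rw [Matrix.mulVec_mulVec, Matrix.mulVec_mulVec, mul_assoc _ Rᵀ, hR, mul_one]

variable (b)

theorem Dvec_actQ (h : SymGroup) (q : Conf) (w : V3) :
    b.Dvec (actQ h q) (rotZ h.spin *ᵥ w) =
      (rotZ h.rot * (b.Dvec q w).1 * (rotZ h.spin)ᵀ, rotZ h.rot *ᵥ (b.Dvec q w).2) := by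
  have hR := transpose_mul_self_of_mem_SO (rotZ_mem h.spin)
  refine Prod.ext ?_ ?_
  · rw [Dvec, Dvec, mul_hat_conj _ _ _ _ hR, ← hat_mulVec_rotation (rotZ_mem _)]
    rfl
  · rw [Dvec, Dvec, s_actQ, ← mulVec_cross (rotZ_mem _), Matrix.mulVec_neg,
      mulVec_conj (rotZ h.rot) q.1 _ _ hR]
    rfl

variable {b}

theorem actM_mk_Dvec (h : SymGroup) (q : Conf) (w : V3) :
    actM h (q, b.Dvec q w) = (actQ h q, b.Dvec (actQ h q) (rotZ h.spin *ᵥ w)) := by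
  rw [Dvec_actQ]
  rfl

theorem actM_mem (h : SymGroup) {x : Phase} (hx : x ∈ b.M) : actM h x ∈ b.M := by
  rw [← mk_Dvec_angVel hx, actM_mk_Dvec]
  exact mk_Dvec_mem_M (actQ_mem h hx.1) _

theorem angVel_actM (h : SymGroup) {x : Phase} (hx : x ∈ b.M) :
    angVel (actM h x) = rotZ h.spin *ᵥ angVel x := by
  conv_lhs => rw [← mk_Dvec_angVel hx, actM_mk_Dvec]
  exact angVel_mk_Dvec (actQ_mem h hx.1) _

theorem Cvec_actM (h : SymGroup) {x : Phase} (hx : x ∈ b.M) (w w' : V3) :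
    b.Cvec (actM h x) (rotZ h.spin *ᵥ w) (rotZ h.spin *ᵥ w') = actLin h (b.Cvec x w w') := by
  have hR := transpose_mul_self_of_mem_SO (rotZ_mem h.spin)
  have hS := rotZ_mem h.spin
  refine Prod.ext (b.Dvec_actQ h x.1 w) (Prod.ext ?_ ?_)
  · simp only [Cvec, actLin, angVel_actM h hx]
    rw [mul_hat_conj _ _ _ _ hR, mul_add (rotZ h.spin), add_mul, hat_mulVec_rotation hS,
      hat_mulVec_rotation hS, hat_mulVec_rotation hS]
    congr 2
    simp only [mul_assoc]
    rw [← mul_assoc _ᵀ (rotZ h.spin), hR, one_mul]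
  · have e : (actM h x).1 = actQ h x.1 := rfl
    simp only [Cvec, actLin, angVel_actM h hx, e, s_actQ, rowγ_actQ, ← mulVec_cross hS, sdot_rotZ,
      ← Matrix.mulVec_add, Matrix.mulVec_neg]
    rw [mulVec_conj (rotZ h.rot) x.1.1 _ _ hR]
    rfl

theorem dM_actM {f : b.M → ℝ} (hf : b.Smooth f) (hG : b.GInvariant f) (h : SymGroup) {x y : b.M}
    (hy : actM h x = y) (w w' : V3) :
    b.dM f y (b.Cvec y (rotZ h.spin *ᵥ w) (rotZ h.spin *ᵥ w')) = b.dM f x (b.Cvec x w w') := by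
  have h1 := hasDerivAt_dM hf (Mcurve_mem x.2 w w') (Mcurve_zero x.2 w w')
    (hasDerivAt_Mcurve x.2 w w')
  have h2 := hasDerivAt_dM (x := y) hf (fun t => actM_mem h (Mcurve_mem x.2 w w' t))
    (by rw [Mcurve_zero x.2, hy]) (hasDerivAt_actM h (hasDerivAt_Mcurve x.2 w w'))
  rw [← Cvec_actM h x.2, hy] at h2
  refine h2.unique (h1.congr_of_eventuallyEq (Filter.Eventually.of_forall fun t => ?_))
  exact (hG h ⟨_, Mcurve_mem x.2 w w' t⟩ ⟨_, _⟩ rfl).symm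

/-- In body coordinates rotations and translations of the plane are invisible. A spin rotates all
vectors about e₃, and the inertia tensor, s and its derivative commute with that rotation. -/
theorem ΩB_actM (h : SymGroup) {x : Phase} (hx : x ∈ b.M) (w w' z z' : V3) :
    b.ΩB (actM h x) (b.Cvec (actM h x) (rotZ h.spin *ᵥ w) (rotZ h.spin *ᵥ w'))
      (b.Cvec (actM h x) (rotZ h.spin *ᵥ z) (rotZ h.spin *ᵥ z')) =
    b.ΩB x (b.Cvec x w w') (b.Cvec x z z') := by
  have hS := rotZ_mem h.spin
  have e : (actM h x).1 = actQ h x.1 := rfl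
  rw [ΩB_Cvec hx, ΩB_Cvec (actM_mem h hx)]
  simp only [canonicalForm, gaugeForm, angVel_actM h hx, e, s_actQ, rowγ_actQ,
    ← mulVec_cross hS, sdot_rotZ, ← Matrix.mulVec_add, inertia_rotZ, dotProduct_mulVec_mulVec hS,
    rotZ_mulVec_two]

theorem bracketB_actM {f k : b.M → ℝ} (hf : b.Smooth f) (hfG : b.GInvariant f) (hk : b.Smooth k)
    (hkG : b.GInvariant k) (h : SymGroup) {x y : b.M} (hy : actM h x = y) :
    b.bracketB f k y = b.bracketB f k x := by
  obtain ⟨X, ⟨hX, hX'⟩, -⟩ := b.nondegOnC_ΩB x x.2 (b.dM f x)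
  obtain ⟨w, w', rfl⟩ := exists_eq_Cvec x.2 hX
  have hY : b.IsHamAt b.ΩB y (b.dM f y)
      (b.Cvec y (rotZ h.spin *ᵥ w) (rotZ h.spin *ᵥ w')) := by
    refine ⟨Cvec_mem y.2 _ _, fun v hv => ?_⟩
    obtain ⟨z, z', rfl⟩ := exists_eq_Cvec y.2 hv
    rw [← mulVec_transpose_mulVec (rotZ_mem h.spin) z, ← mulVec_transpose_mulVec (rotZ_mem h.spin) z',
      dM_actM hf hfG h hy, ← hX' _ (Cvec_mem x.2 _ _), ← hy]
    exact ΩB_actM h x.2 _ _ _ _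
  rw [bracketB, bracketB, sharp_eq_neg b.nondegOnC_ΩB x.2 ⟨hX, hX'⟩,
    sharp_eq_neg b.nondegOnC_ΩB y.2 hY, map_neg, map_neg, dM_actM hk hkG h hy]

theorem gInvariant_comp_ρ (F : b.Mred → ℝ) : b.GInvariant (F ∘ b.ρ) := fun h _ _ hy =>
  congrArg F (Quotient.sound (s := b.orbitSetoid) ⟨h, hy⟩)

variable (b)

theorem redBracketWellDefined : b.RedBracketWellDefined := by
  intro F K hF hK x
  obtain ⟨h, hh⟩ : ∃ h : SymGroup, actM h x = (Quotient.out (b.ρ x) : b.M) :=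
    b.orbitSetoid.symm (Quotient.exact (s := b.orbitSetoid) (Quotient.out_eq (b.ρ x)))
  exact bracketB_actM hF (gInvariant_comp_ρ F) hK (gInvariant_comp_ρ K) h hh

end BodyOfRevolution

/-! ## Infinitesimal generators -/

theorem hasDerivAt_rotZ (c : ℝ) :
    HasDerivAt (fun t : ℝ => rotZ ((t * c : ℝ) : Real.Angle)) (c • hat e₃) 0 := by
  have hc : HasDerivAt (fun t : ℝ => Real.cos (t * c)) 0 0 := by
    simpa using ((hasDerivAt_id (0 : ℝ)).mul_const c).cos
  have hs : HasDerivAt (fun t : ℝ => Real.sin (t * c)) c 0 := by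
    simpa using ((hasDerivAt_id (0 : ℝ)).mul_const c).sin
  refine hasDerivAt_matrix.2 fun i j => ?_
  fin_cases i <;> fin_cases j <;> simp [rotZ, hat, e₃, hasDerivAt_const, hc, hs, hs.fun_neg]

theorem curveG_zero (η : LieG) : curveG η 0 = 1 := by
  simp [curveG, SymGroup.one_def]

theorem hasDerivAt_conj_curveG (η : LieG) (A : Matrix (Fin 3) (Fin 3) ℝ) :
    HasDerivAt (fun t : ℝ => rotZ (curveG η t).rot * A * (rotZ (curveG η t).spin)ᵀ)
      (η.2.1 • (hat e₃ * A) - η.1 • (A * hat e₃)) 0 := by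
  refine (hasDerivAt_matrix_mul (hasDerivAt_matrix_mul (hasDerivAt_rotZ η.2.1)
    (hasDerivAt_const (0 : ℝ) A)) (hasDerivAt_matrix_transpose (hasDerivAt_rotZ η.1))).congr_deriv ?_
  simp [rotZ_zero, hat_transpose, sub_eq_add_neg]

theorem hasDerivAt_rot_curveG (η : LieG) (a : V3) :
    HasDerivAt (fun t : ℝ => rotZ (curveG η t).rot *ᵥ a) (η.2.1 • (e₃ ⨯₃ a)) 0 := by
  refine (hasDerivAt_matrix_mulVec (hasDerivAt_rotZ η.2.1)
    (hasDerivAt_const (0 : ℝ) a)).congr_deriv ?_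
  simp [Matrix.smul_mulVec, hat_mulVec]

theorem hasDerivAt_actQ_curveG (η : LieG) (q : Conf) :
    HasDerivAt (fun t : ℝ => actQ (curveG η t) q)
      (η.2.1 • (hat e₃ * q.1) - η.1 • (q.1 * hat e₃),
        η.2.1 • (e₃ ⨯₃ q.2) + ![η.2.2 0, η.2.2 1, 0]) 0 := by
  refine (hasDerivAt_conj_curveG η q.1).prodMk ((hasDerivAt_rot_curveG η q.2).add ?_)
  refine hasDerivAt_pi.2 fun i => ?_
  have h : ∀ j, HasDerivAt (fun t : ℝ => t * η.2.2 j) (η.2.2 j) 0 := fun j => by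
    simpa using (hasDerivAt_id (0 : ℝ)).mul_const (η.2.2 j)
  fin_cases i
  · exact h 0
  · exact h 1
  · exact hasDerivAt_const _ _

theorem hasDerivAt_actM_curveG (η : LieG) (x : Phase) :
    HasDerivAt (fun t : ℝ => actM (curveG η t) x) (genM η x) 0 := by
  have h : HasDerivAt (fun t : ℝ => actM (curveG η t) x) _ 0 :=
    (hasDerivAt_actQ_curveG η x.1).prodMk
      ((hasDerivAt_conj_curveG η x.2.1).prodMk (hasDerivAt_rot_curveG η x.2.2))
  exact h.differentiableAt.hasDerivAt

theorem genQ_eq (η : LieG) (q : Conf) : genQ η q =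
    (η.2.1 • (hat e₃ * q.1) - η.1 • (q.1 * hat e₃),
        η.2.1 • (e₃ ⨯₃ q.2) + ![η.2.2 0, η.2.2 1, 0]) :=
  (hasDerivAt_actQ_curveG η q).deriv

theorem hasDerivAt_actQ_genQ (η : LieG) (q : Conf) :
    HasDerivAt (fun t : ℝ => actQ (curveG η t) q) (genQ η q) 0 :=
  (genQ_eq η q).symm ▸ hasDerivAt_actQ_curveG η q

theorem genM_fst (η : LieG) (x : Phase) : (genM η x).1 = genQ η x.1 :=
  (show HasDerivAt (fun t : ℝ => actQ (curveG η t) x.1) _ 0 from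
    (hasDerivAt_actM_curveG η x).fst).unique (hasDerivAt_actQ_genQ η x.1)

/-- The angular velocity of an infinitesimal generator. -/
def genAngVel (η : LieG) (q : Conf) : V3 := η.2.1 • rowγ q - η.1 • e₃

namespace BodyOfRevolution

variable {b : BodyOfRevolution}

/-- A rotation about the vertical has body angular velocity gᵀe₃ = γ. The spin acts through the
inverse on the right, whence the sign of e₃ in `genAngVel`. -/
theorem mc_genQ {q : Conf} (hq : q ∈ b.Q) (η : LieG) : mc q (genQ η q) = genAngVel η q := by
  have e : hat e₃ * q.1 = q.1 * hat (rowγ q) := by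
    have h := hat_mulVec_rotation (transpose_mem_SO hq.1) e₃
    rw [transpose_mulVec_vertical, Matrix.transpose_transpose] at h
    change _ = q.1 * hat (q.1 2)
    rw [h, ← mul_assoc, ← mul_assoc, mul_transpose_self_of_mem_SO hq.1, one_mul]
  have e' : η.2.1 • (hat e₃ * q.1) - η.1 • (q.1 * hat e₃) = q.1 * hat (genAngVel η q) := by
    rw [e, genAngVel, sub_eq_add_neg, sub_eq_add_neg, ← neg_smul, ← neg_smul, hat_add, hat_smul,
      hat_smul, mul_add, Matrix.mul_smul, Matrix.mul_smul]
  rw [genQ_eq, e', mc_mul_hat hq, axial_hat]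

/-- Only the spin moves the body components of Ω, so along the orbit Ω changes at the rate η₁ e₃ ×
Ω; the base motion has the angular velocity of the generator. -/
theorem genM_eq_Cvec {x : Phase} (hx : x ∈ b.M) {η : LieG} (h : genQ η x.1 ∈ b.D x.1) :
    genM η x = b.Cvec x (genAngVel η x.1) (η.1 • (e₃ ⨯₃ angVel x)) := by
  have h1 := hasDerivAt_actM_curveG η x
  have h2 : HasDerivAt (fun t => angVel (actM (curveG η t) x)) (η.1 • (e₃ ⨯₃ angVel x)) 0 := by
    simp only [angVel_actM _ hx]
    refine (hasDerivAt_matrix_mulVec (hasDerivAt_rotZ η.1)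
      (hasDerivAt_const (0 : ℝ) (angVel x))).congr_deriv ?_
    simp [Matrix.smul_mulVec, hat_mulVec]
  rw [← mc_genQ hx.1, ← genM_fst]
  refine deriv_eq_Cvec hx (fun t => actM_mem (curveG η t) hx) ?_ h1 ?_ h2
  · rw [curveG_zero, actM_one]
  · rwa [genM_fst]

theorem dM_genM_eq_zero {f : b.M → ℝ} (hf : b.Smooth f) (hG : b.GInvariant f) (x : b.M) (η : LieG) :
    b.dM f x (genM η x) = 0 := by
  have h := hasDerivAt_dM hf (fun t => actM_mem (curveG η t) x.2)
    (by rw [curveG_zero, actM_one]) (hasDerivAt_actM_curveG η x)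
  have e : ∀ t, f ⟨actM (curveG η t) x, actM_mem (curveG η t) x.2⟩ = f x := fun t =>
    (hG (curveG η t) x ⟨_, _⟩ rfl).symm
  simp only [e] at h
  exact h.unique (hasDerivAt_const _ _)

/-- The generators of the sections `a ξ₁ + c ξ₂`. -/
theorem genQ_ξ {q : Conf} (hq : q ∈ b.Q) (a c : ℝ) :
    genQ (a • b.ξ₁ q + c • b.ξ₂ q) q = b.Dvec q (c • rowγ q - a • e₃) := by
  have hW : genAngVel (a • b.ξ₁ q + c • b.ξ₂ q) q = c • rowγ q - a • e₃ := by
    simp [genAngVel, ξ₁, ξ₂]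
  have hm := mc_genQ hq (a • b.ξ₁ q + c • b.ξ₂ q)
  rw [hW] at hm
  refine Prod.ext ?_ ?_
  · have hc := fst_eq_mul_hat (b := b) (fun t => actQ_mem (curveG (a • b.ξ₁ q + c • b.ξ₂ q) t) hq)
      (hasDerivAt_actQ_genQ _ q)
    have h0 : actQ (curveG (a • b.ξ₁ q + c • b.ξ₂ q) 0) q = q := by
      rw [curveG_zero]
      exact congrArg Prod.fst (actM_one (q, 0))
    rw [h0, hm] at hc
    exact hc
  -- The horizontal components of -g(w × s) are triple products of α or β with w and s. The
  -- relations α = β × γ and β = γ × α turn them into the translation parts of ξ₁ and ξ₂.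
  · obtain ⟨h1, h2, h3⟩ := row_cross_row hq.1
    rw [genQ_eq, Dvec]
    have hα := congrFun h2; have hβ := congrFun h3
    have hα0 := hα 0; have hα1 := hα 1; have hα2 := hα 2
    have hβ0 := hβ 0; have hβ1 := hβ 1; have hβ2 := hβ 2
    simp [cross_apply] at hα0 hα1 hα2 hβ0 hβ1 hβ2
    ext i
    fin_cases i <;>
      simp [ξ₁, ξ₂, e₃, cross_apply, s, profileVec, rowα, rowβ, rowγ, Matrix.mulVec, dotProduct,
        Fin.sum_univ_three, Matrix.vecHead, Matrix.vecTail]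
    · linear_combination -(c * b.ϱ (q.1 2 2) * q.1 2 0) * hβ0 - (c * b.ϱ (q.1 2 2) * q.1 2 1) * hβ1 -
        (c * b.ζ (q.1 2 2) + a * b.ϱ (q.1 2 2)) * hβ2
    · linear_combination (c * b.ϱ (q.1 2 2) * q.1 2 0) * hα0 + (c * b.ϱ (q.1 2 2) * q.1 2 1) * hα1 +
        (c * b.ζ (q.1 2 2) + a * b.ϱ (q.1 2 2)) * hα2
    · ring

/-! ## The nonholonomic momentum -/

theorem Θ_eq_kin {x : Phase} (hx : x ∈ b.M) (w w' : V3) :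
    b.Θ x (b.Cvec x w w') = b.kin x.1 (angVel x) ⬝ᵥ w := by
  have h : (b.Cvec x w w').1 = b.Dvec x.1 w := rfl
  rw [Θ, h, κ, mc_Dvec hx.1, snd_eq_Dvec hx, mc_Dvec hx.1, kin_dot]
  simp only [Dvec, neg_dotProduct_neg, dotProduct_mulVec_mulVec hx.1.1]
  rfl

theorem secM_eq {χ : Conf → LieG} (hχ : b.IsSectionGS χ) {x : Phase} (hx : x ∈ b.M) :
    b.secM χ x = b.Cvec x (genAngVel (χ x.1) x.1) ((χ x.1).1 • (e₃ ⨯₃ angVel x)) :=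
  genM_eq_Cvec hx (hχ.2 x.1 hx.1).1

theorem nhMomentum_eq {χ : Conf → LieG} (hχ : b.IsSectionGS χ) (x : b.M) :
    b.nhMomentum χ x = b.kin x.1.1 (angVel x) ⬝ᵥ genAngVel (χ x.1.1) x.1.1 := by
  rw [nhMomentum, secM_eq hχ x.2, Θ_eq_kin x.2]

variable (b)

/-- The part of the differential of the momentum of a section that is not produced by the gauge
transformed form; `χ'` is the derivative of the section. -/
def residual (x : Phase) (χ χ' : LieG) (z : V3) : ℝ :=
  b.kin x.1 (angVel x) ⬝ᵥ (χ'.2.1 • rowγ x.1 - χ'.1 • e₃) +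
    b.m * (rowγ x.1 ⨯₃ z) 2 *
      (b.ϱ (rowγ x.1 2) * (angVel x ⬝ᵥ rowγ x.1) *
          (χ.2.1 * (b.ζ (rowγ x.1 2) - rowγ x.1 2 * b.ϱ (rowγ x.1 2)) + χ.1 * b.ϱ (rowγ x.1 2)) +
        (χ.2.1 * (b.dζ (rowγ x.1 2) - b.ϱ (rowγ x.1 2) - rowγ x.1 2 * b.dϱ (rowγ x.1 2)) +
          χ.1 * b.dϱ (rowγ x.1 2)) * ((angVel x ⨯₃ b.s x.1) ⬝ᵥ (rowγ x.1 ⨯₃ e₃)))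

/-- Rotational half of `dM_nhMomentum`. Because 𝕀₁ = 𝕀₂, the only terms left over are derivatives of
the coefficients, and no gauge term arises. -/
theorem residual_inertia (f₁ f₂ f₁' f₂' : ℝ) (γ v z z' : V3) :
    z' ⬝ᵥ (b.inertia *ᵥ (f₂ • γ - f₁ • e₃)) +
        v ⬝ᵥ (b.inertia *ᵥ (f₂' • γ - f₁' • e₃ + f₂ • (γ ⨯₃ z))) =
      -((f₁ • (e₃ ⨯₃ v)) ⬝ᵥ (b.inertia *ᵥ z) - z' ⬝ᵥ (b.inertia *ᵥ (f₂ • γ - f₁ • e₃)) -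
        v ⬝ᵥ (b.inertia *ᵥ ((f₂ • γ - f₁ • e₃) ⨯₃ z))) +
      v ⬝ᵥ (b.inertia *ᵥ (f₂' • γ - f₁' • e₃)) := by
  simp [inertia, Matrix.mulVec_diagonal, dotProduct, Fin.sum_univ_three, cross_apply, e₃,
    Matrix.vecHead, Matrix.vecTail]
  ring

/-- Translational half of `dM_nhMomentum`, divided by m. The term -ϱ⟨γ, s⟩⟨v, W × z⟩ is not supplied
by the canonical form, and it is what B is made to provide. All other leftovers carry a derivative
of a coefficient or the factor γ̇₃. This is a polynomial identity that does not need |γ| = 1. -/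
theorem residual_translation (ρ ζ dρ dζ f₁ f₂ f₁' f₂' : ℝ) (γ v z z' s : V3)
    (hs : s = ![ρ * γ 0, ρ * γ 1, ζ])
    (W dW sz sW : V3) (hW : W = f₂ • γ - f₁ • e₃)
    (hdW : dW = f₂' • γ - f₁' • e₃ + f₂ • (γ ⨯₃ z))
    (hsz : sz = ![dρ * (γ ⨯₃ z) 2 * γ 0 + ρ * (γ ⨯₃ z) 0, dρ * (γ ⨯₃ z) 2 * γ 1 + ρ * (γ ⨯₃ z) 1,
      dζ * (γ ⨯₃ z) 2])
    (hsW : sW = ![dρ * (γ ⨯₃ W) 2 * γ 0 + ρ * (γ ⨯₃ W) 0, dρ * (γ ⨯₃ W) 2 * γ 1 + ρ * (γ ⨯₃ W) 1,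
      dζ * (γ ⨯₃ W) 2]) :
    (z' ⨯₃ s + v ⨯₃ sz) ⬝ᵥ (W ⨯₃ s) + (v ⨯₃ s) ⬝ᵥ (dW ⨯₃ s + W ⨯₃ sz) =
      -((W ⨯₃ (v ⨯₃ s) + (f₁ • (e₃ ⨯₃ v)) ⨯₃ s + v ⨯₃ sW) ⬝ᵥ (z ⨯₃ s)) +
      (z ⨯₃ (v ⨯₃ s) + z' ⨯₃ s + v ⨯₃ sz) ⬝ᵥ (W ⨯₃ s) -
      ρ * (γ ⬝ᵥ s) * (v ⬝ᵥ (W ⨯₃ z)) +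
      (v ⨯₃ s) ⬝ᵥ ((f₂' • γ - f₁' • e₃) ⨯₃ s) +
      (γ ⨯₃ z) 2 * (ρ * (v ⬝ᵥ γ) * (f₂ * (ζ - γ 2 * ρ) + f₁ * ρ) +
        (f₂ * (dζ - ρ - γ 2 * dρ) + f₁ * dρ) * ((v ⨯₃ s) ⬝ᵥ (γ ⨯₃ e₃))) := by
  subst hs hW hdW hsz hsW
  simp [dotProduct, Fin.sum_univ_three, cross_apply, e₃,
    Matrix.vecHead, Matrix.vecTail]
  ring

end BodyOfRevolution

namespace BodyOfRevolution

variable {b : BodyOfRevolution}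

/-! ## The differential of the nonholonomic momentum -/

theorem hasDerivAt_kin_dot {c : ℝ → Conf} {z a : V3} (hQ : ∀ t, c t ∈ b.Q) {t : ℝ}
    (hc : HasDerivAt c ((c t).1 * hat z, a) t) {V U : ℝ → V3} {V' U' : V3}
    (hV : HasDerivAt V V' t) (hU : HasDerivAt U U' t) :
    HasDerivAt (fun τ => b.kin (c τ) (V τ) ⬝ᵥ U τ)
      (V' ⬝ᵥ (b.inertia *ᵥ U t) + V t ⬝ᵥ (b.inertia *ᵥ U') +
        b.m * ((V' ⨯₃ b.s (c t) + V t ⨯₃ b.sdot (rowγ (c t)) (rowγ (c t) ⨯₃ z)) ⬝ᵥ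
            (U t ⨯₃ b.s (c t)) +
          (V t ⨯₃ b.s (c t)) ⬝ᵥ
            (U' ⨯₃ b.s (c t) + U t ⨯₃ b.sdot (rowγ (c t)) (rowγ (c t) ⨯₃ z)))) t := by
  have hs := hasDerivAt_s hQ hc
  have hI := hasDerivAt_matrix_mulVec (hasDerivAt_const t b.inertia) hU
  simp only [kin_dot]
  refine ((hasDerivAt_dotProduct hV hI).add ((hasDerivAt_dotProduct (hasDerivAt_cross hV hs)
    (hasDerivAt_cross hU hs)).const_mul b.m)).congr_deriv ?_
  simp

/-- Here J = ⟨KΩ, W⟩, with W the angular velocity of χ_ℳ. The product rule is compared with (Ω_ℳ +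
B)(χ_ℳ, ·) through `residual_inertia` and `residual_translation`. Neither conservation nor
invariance of J enters; the residual is the exact obstruction to χ_ℳ being the hamiltonian vector of
J. -/
theorem dM_nhMomentum {χ : Conf → LieG} (hχ : b.IsSectionGS χ) (hJ : b.Smooth (b.nhMomentum χ))
    (x : b.M) (z z' : V3) {χ' : LieG}
    (h : HasDerivAt (fun t => χ (b.Qcurve x.1.1 z t)) χ' 0) :
    b.dM (b.nhMomentum χ) x (b.Cvec x z z') =
      b.ΩB x (b.secM χ x) (b.Cvec x z z') + b.residual x (χ x.1.1) χ' z := by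
  have hq : x.1.1 ∈ b.Q := x.2.1
  refine dM_Cvec_eq hJ ?_
  have e : ∀ t, b.nhMomentum χ ⟨b.Mcurve x z z' t, Mcurve_mem x.2 z z' t⟩ =
      b.kin (b.Qcurve x.1.1 z t) (angVel x.1 + t • z') ⬝ᵥ
        genAngVel (χ (b.Qcurve x.1.1 z t)) (b.Qcurve x.1.1 z t) := fun t => by
    rw [nhMomentum_eq hχ]
    change b.kin _ (angVel (_, b.Dvec _ _)) ⬝ᵥ _ = _
    rw [angVel_mk_Dvec (Qcurve_mem hq z t)]
    rfl
  simp only [e]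
  have hc := hasDerivAt_Qcurve hq z
  have h0 := Qcurve_zero hq z
  have hV : HasDerivAt (fun t : ℝ => angVel x.1 + t • z') z' 0 := hasDerivAt_line _ _
  have hc' : HasDerivAt (b.Qcurve x.1.1 z)
      ((b.Qcurve x.1.1 z 0).1 * hat z, (b.Dvec x.1.1 z).2) 0 := by rw [h0]; exact hc
  have hγ := hasDerivAt_rowγ hc'
  rw [h0] at hγ
  have hU : HasDerivAt (fun t => genAngVel (χ (b.Qcurve x.1.1 z t)) (b.Qcurve x.1.1 z t))
      (χ'.2.1 • rowγ x.1.1 - χ'.1 • e₃ + (χ x.1.1).2.1 • (rowγ x.1.1 ⨯₃ z)) 0 := by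
    have h1 : HasDerivAt (fun t => (χ (b.Qcurve x.1.1 z t)).1) χ'.1 0 := h.fst
    have h2 : HasDerivAt (fun t => (χ (b.Qcurve x.1.1 z t)).2.1) χ'.2.1 0 := h.snd.fst
    refine ((h2.smul hγ).sub (h1.smul_const e₃)).congr_deriv ?_
    simp only [h0]
    abel
  refine (hasDerivAt_kin_dot (Qcurve_mem hq z) hc' hV hU).congr_deriv ?_
  simp only [h0, zero_smul, add_zero]
  rw [secM_eq hχ x.2, ΩB_Cvec x.2]
  have hA := b.residual_inertia (χ x.1.1).1 (χ x.1.1).2.1 χ'.1 χ'.2.1 (rowγ x.1.1) (angVel x) z z'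
  have hB := residual_translation (b.ϱ (rowγ x.1.1 2)) (b.ζ (rowγ x.1.1 2)) (b.dϱ (rowγ x.1.1 2))
    (b.dζ (rowγ x.1.1 2)) (χ x.1.1).1 (χ x.1.1).2.1 χ'.1 χ'.2.1 (rowγ x.1.1) (angVel x) z z'
    (b.s x.1.1) rfl _ _ _ _ rfl rfl rfl rfl
  rw [canonicalForm, gaugeForm, residual, kin_dot]
  simp only [genAngVel]
  rw [hA]
  have hB' := congrArg (b.m * ·) hB
  simp only [sdot] at hB' ⊢
  linear_combination hB'

/-! ## The nonholonomic vector field -/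

theorem H_eq {x : Phase} (hx : x ∈ b.M) :
    b.H x = b.kin x.1 (angVel x) ⬝ᵥ angVel x / 2 + b.m * b.grav * x.1.2 2 := by
  have h := Θ_eq_kin hx (angVel x) 0
  have e : (b.Cvec x (angVel x) 0).1 = x.2 := (snd_eq_Dvec hx).symm
  rw [Θ, e] at h
  rw [H, h]

theorem kin_actQ (h : SymGroup) (q : Conf) (v w : V3) :
    b.kin (actQ h q) (rotZ h.spin *ᵥ v) ⬝ᵥ (rotZ h.spin *ᵥ w) = b.kin q v ⬝ᵥ w := by
  have hS := rotZ_mem h.spin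
  simp only [kin_dot, s_actQ, ← mulVec_cross hS, inertia_rotZ, dotProduct_mulVec_mulVec hS]

theorem gInvariant_H : b.GInvariant fun y => b.H y := by
  intro h x y hy
  change b.H x = b.H y
  rw [← hy, H_eq x.2, H_eq (actM_mem h x.2), angVel_actM h x.2]
  change _ = b.kin (actQ h x.1.1) _ ⬝ᵥ _ / 2 + b.m * b.grav * ((rotZ h.rot *ᵥ x.1.1.2) 2 + 0)
  rw [kin_actQ, rotZ_mulVec_two, add_zero]

theorem smooth_of_contDiffOn {f : b.M → ℝ} {F : Phase → ℝ} (hF : ContDiffOn ℝ ∞ F b.M)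
    (h : ∀ x : b.M, f x = F x) : b.Smooth f :=
  hF.congr fun x hx => (Subtype.val_injective.extend_apply f 0 ⟨x, hx⟩).trans (h ⟨x, hx⟩)

theorem smooth_H : b.Smooth fun y => b.H y := by
  refine smooth_of_contDiffOn (F := b.H) ?_ fun _ => rfl
  have h2 : ContDiffOn ℝ ∞ (fun y : Phase => y.1.2 2) b.M :=
    (contDiff_pi.1 (contDiff_snd.comp contDiff_fst) 2).contDiffOn
  exact ((b.contDiffOn_κ contDiff_fst.contDiffOn contDiff_snd.contDiffOn
    contDiff_snd.contDiffOn).div_const 2).add (contDiffOn_const.mul h2)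

theorem dM_H_vertical (x : b.M) (z' : V3) :
    b.dM (fun y => b.H y) x (b.Cvec x 0 z') = b.kin x.1.1 (angVel x) ⬝ᵥ z' := by
  have hq : x.1.1 ∈ b.Q := x.2.1
  have h0 : b.Dvec x.1.1 0 = 0 := by
    simpa using b.Dvec_smul x.1.1 0 0
  have hV : HasDerivAt (fun t : ℝ => angVel x.1 + t • z') z' 0 := hasDerivAt_line _ _
  have hc : HasDerivAt (fun _ : ℝ => x.1.1) (b.Dvec x.1.1 0) 0 := by
    rw [h0]
    exact hasDerivAt_const _ _
  have h1 := hasDerivAt_mk_Dvec (fun _ => hq) hc hV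
  have e0 : (x.1.1, b.Dvec x.1.1 (angVel x.1 + (0 : ℝ) • z')) = x.1 := by
    rw [zero_smul, add_zero, mk_Dvec_angVel x.2]
  rw [e0] at h1
  have h2 := hasDerivAt_dM smooth_H (fun t => mk_Dvec_mem_M hq (angVel x.1 + t • z')) e0 h1
  have e : ∀ t : ℝ, b.H (x.1.1, b.Dvec x.1.1 (angVel x.1 + t • z')) =
      b.kin x.1.1 (angVel x.1 + t • z') ⬝ᵥ (angVel x.1 + t • z') / 2 +
        b.m * b.grav * x.1.1.2 2 := fun t => by
    rw [H_eq (mk_Dvec_mem_M hq _), angVel_mk_Dvec hq]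
  simp only [e] at h2
  have hK : HasDerivAt (fun t : ℝ => b.kin x.1.1 (angVel x.1 + t • z')) (b.kin x.1.1 z') 0 :=
    (LinearMap.toContinuousLinearMap (b.kin x.1.1)).hasFDerivAt.comp_hasDerivAt (0 : ℝ) hV
  have h3 := ((hasDerivAt_dotProduct hK hV).div_const 2).add_const (b.m * b.grav * x.1.1.2 2)
  rw [h2.unique h3, zero_smul, add_zero, b.kin_dot_comm _ z']
  ring

theorem Xnh_isHamAt (x : b.M) : b.IsHamAt b.ΩM x (b.dM (fun y => b.H y) x) (b.Xnh x) :=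
  isHamAt_neg_sharp b.nondegOnC_ΩM x.2 _

/-- The second-order condition: pairing the defining equation with vertical vectors of 𝒞 gives K w =
KΩ, and K is injective. -/
theorem Xnh_eq (x : b.M) : ∃ w', b.Xnh x = b.Cvec x (angVel x) w' := by
  obtain ⟨hX, hX'⟩ := Xnh_isHamAt x
  obtain ⟨w, w', e⟩ := exists_eq_Cvec x.2 hX
  rw [e] at hX'
  refine ⟨w', ?_⟩
  have hw : b.kin x.1.1 w = b.kin x.1.1 (angVel x) := eq_of_forall_dotProduct fun z' => by
    have h1 := hX' _ (Cvec_mem x.2 0 z')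
    rw [dM_H_vertical, ΩM_Cvec x.2, canonicalForm_eq] at h1
    simpa [(b.isLinearMap_canonicalForm x.1 w).map_zero] using h1
  have : w - angVel x = 0 := b.eq_zero_of_kin_dot x.1.1 (by rw [map_sub, hw, sub_self, zero_dotProduct])
  rw [e, sub_eq_zero.1 this]

/-- Both parts of (Ω_ℳ + B)(χ_ℳ, X_nh) vanish: the canonical part is -dH(χ_ℳ) and the energy is
invariant, while B contributes ⟨Ω, W × Ω⟩. So conservation controls the residual in the direction z
= Ω only. -/
theorem dM_nhMomentum_Xnh {χ : Conf → LieG} (hχ : b.IsSectionGS χ)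
    (hJ : b.Smooth (b.nhMomentum χ)) (x : b.M) {χ' : LieG}
    (h : HasDerivAt (fun t => χ (b.Qcurve x.1.1 (angVel x) t)) χ' 0) :
    b.dM (b.nhMomentum χ) x (b.Xnh x) = b.residual x (χ x.1.1) χ' (angVel x) := by
  obtain ⟨w', hw'⟩ := Xnh_eq x
  have hX := Xnh_isHamAt x
  have hs : b.secM χ x ∈ b.C x := by
    rw [secM_eq hχ x.2]
    exact Cvec_mem x.2 _ _
  have h1 := hX.2 _ hs
  rw [secM, dM_genM_eq_zero smooth_H gInvariant_H, ← secM] at h1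
  rw [hw'] at h1 ⊢
  rw [dM_nhMomentum hχ hJ x _ _ h, ΩB_antisymm, add_eq_right, neg_eq_zero, ΩB, h1, zero_add,
    secM_eq hχ x.2, B_Cvec x.2, gaugeForm, dot_self_cross, mul_zero, neg_zero]

end BodyOfRevolution

/-! ### Linear functionals that vanish in orbit directions. -/

/-- Off the axis γ and e₃ are independent, so the functionals killing both form a line, spanned by z
↦ (γ × z)₃ = ⟨z, e₃ × γ⟩. -/
theorem exists_eq_mul_cross_of_vanish {γ : V3} (hγ : γ 0 ^ 2 + γ 1 ^ 2 ≠ 0) {l : V3 →ₗ[ℝ] ℝ}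
    (h1 : l γ = 0) (h2 : l e₃ = 0) : ∃ c, ∀ z, l z = c * (γ ⨯₃ z) 2 := by
  obtain ⟨a, ha⟩ := linearMap_eq_dotProduct l
  rw [ha] at h1 h2
  simp [dotProduct, Fin.sum_univ_three, e₃] at h1 h2
  refine ⟨(a 1 * γ 0 - a 0 * γ 1) / (γ 0 ^ 2 + γ 1 ^ 2), fun z => ?_⟩
  rw [ha, div_mul_eq_mul_div, eq_div_iff hγ]
  simp [dotProduct, Fin.sum_univ_three, cross_apply]
  linear_combination (z 2 * (γ 0 ^ 2 + γ 1 ^ 2) - γ 2 * (z 0 * γ 0 + z 1 * γ 1)) * h2 +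
    (z 0 * γ 0 + z 1 * γ 1) * h1

theorem rotZ_pi_mulVec (v : V3) : rotZ (Real.pi : Real.Angle) *ᵥ v = ![-v 0, -v 1, v 2] := by
  ext i
  fin_cases i <;> simp [rotZ, Matrix.mulVec, dotProduct, Fin.sum_univ_three]

/-- The sum of z and its half turn about e₃ is vertical, so the invariant functional takes the value
0 on it, which is also twice its value at z. -/
theorem eq_zero_of_half_turn {l : V3 →ₗ[ℝ] ℝ} (h1 : ∀ z, l (rotZ (Real.pi : Real.Angle) *ᵥ z) = l z)
    (h2 : l e₃ = 0) (z : V3) : l z = 0 := by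
  have e : z + rotZ (Real.pi : Real.Angle) *ᵥ z = (2 * z 2) • e₃ := by
    rw [rotZ_pi_mulVec]
    ext i
    fin_cases i <;> simp [e₃]
    ring
  have h := congrArg l e
  rw [map_add, h1, map_smul, h2, smul_zero] at h
  linarith

namespace BodyOfRevolution

variable {b : BodyOfRevolution}

/-! ## Invariant horizontal gauge momenta -/

theorem hasDerivAt_section {χ : Conf → LieG} (hχ : ContDiffOn ℝ ∞ χ b.Q) {q : Conf} (hq : q ∈ b.Q)
    {c : ℝ → Conf} {v : Conf} (hQ : ∀ t, c t ∈ b.Q) (h0 : c 0 = q) (h : HasDerivAt c v 0) :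
    HasDerivAt (fun t => χ (c t)) (fderivWithin ℝ χ b.Q q v) 0 := by
  have h1 := (hχ.differentiableOn (by simp) q hq).hasFDerivWithinAt
  rw [← h0] at h1
  have h2 := h1.comp_hasDerivWithinAt 0 (h.hasDerivWithinAt (s := Set.univ)) fun t _ => hQ t
  rw [h0, hasDerivWithinAt_univ] at h2
  exact h2

/-- Invariance of J = ⟨KΩ, W⟩ holds for every Ω over a fixed configuration, and K is nondegenerate,
so W itself must be equivariant. -/
theorem genAngVel_actQ {χ : Conf → LieG} (hχ : b.IsSectionGS χ) (hG : b.GInvariant (b.nhMomentum χ))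
    (h : SymGroup) {q : Conf} (hq : q ∈ b.Q) :
    genAngVel (χ (actQ h q)) (actQ h q) = rotZ h.spin *ᵥ genAngVel (χ q) q := by
  have hS := rotZ_mem h.spin
  set W := genAngVel (χ (actQ h q)) (actQ h q) with hW
  have key : ∀ v, b.kin q v ⬝ᵥ ((rotZ h.spin)ᵀ *ᵥ W) = b.kin q v ⬝ᵥ genAngVel (χ q) q := by
    intro v
    have hx := mk_Dvec_mem_M hq v
    have h1 := hG h ⟨_, hx⟩ ⟨_, actM_mem h hx⟩ rfl
    rw [nhMomentum_eq hχ, nhMomentum_eq hχ] at h1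
    simp only [angVel_actM h hx, angVel_mk_Dvec hq] at h1
    rw [h1, ← kin_actQ h q v, mulVec_transpose_mulVec hS]
    rfl
  have h2 : (rotZ h.spin)ᵀ *ᵥ W - genAngVel (χ q) q = 0 :=
    b.eq_zero_of_kin_dot q (by rw [dotProduct_sub, key, sub_self])
  rw [← sub_eq_zero.1 h2, mulVec_transpose_mulVec hS]

/-- Off the axis W has unique coefficients in γ and e₃, so its equivariance makes them invariant.
For γ = ±e₃ only the combination W₃ is determined. -/
theorem section_actQ {χ : Conf → LieG} (hχ : b.IsSectionGS χ) (hG : b.GInvariant (b.nhMomentum χ))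
    (h : SymGroup) {q : Conf} (hq : q ∈ b.Q) (hp : rowγ q 0 ^ 2 + rowγ q 1 ^ 2 ≠ 0) :
    (χ (actQ h q)).1 = (χ q).1 ∧ (χ (actQ h q)).2.1 = (χ q).2.1 := by
  have h1 := congrArg ((rotZ h.spin)ᵀ *ᵥ ·) (genAngVel_actQ hχ hG h hq)
  simp only [transpose_mulVec_mulVec (rotZ_mem h.spin)] at h1
  have e : (rotZ h.spin)ᵀ *ᵥ e₃ = e₃ := by
    conv_lhs => rw [← rotZ_mulVec_e₃ h.spin, transpose_mulVec_mulVec (rotZ_mem h.spin)]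
  simp only [genAngVel, rowγ_actQ, Matrix.mulVec_sub, Matrix.mulVec_smul, e,
    transpose_mulVec_mulVec (rotZ_mem h.spin)] at h1
  have h0 := congrFun h1 0
  have h0' := congrFun h1 1
  have h2 := congrFun h1 2
  simp [e₃] at h0 h0' h2
  have hB : (χ (actQ h q)).2.1 = (χ q).2.1 := by
    rcases h0 with h0 | h0
    · exact h0
    · rcases h0' with h0' | h0'
      · exact h0'
      · exact absurd (by rw [h0, h0']; ring) hp
  refine ⟨?_, hB⟩
  rw [hB] at h2
  linarith

variable (b)

/-- `Dvec` as a linear map. -/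
def DvecLin (q : Conf) : V3 →ₗ[ℝ] Conf where
  toFun := b.Dvec q
  map_add' := b.Dvec_add q
  map_smul' := b.Dvec_smul q

/-- The derivative of a section of `𝔤_S` along `D`. -/
def secDeriv (χ : Conf → LieG) (q : Conf) : V3 →ₗ[ℝ] LieG :=
  (fderivWithin ℝ χ b.Q q).toLinearMap ∘ₗ b.DvecLin q

variable {b}

theorem hasDerivAt_section_Qcurve {χ : Conf → LieG} (hχ : b.IsSectionGS χ) {q : Conf} (hq : q ∈ b.Q)
    (z : V3) : HasDerivAt (fun t => χ (b.Qcurve q z t)) (b.secDeriv χ q z) 0 :=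
  hasDerivAt_section hχ.1 hq (Qcurve_mem hq z) (Qcurve_zero hq z) (hasDerivAt_Qcurve hq z)

theorem actQ_curveG_zero (η : LieG) (q : Conf) : actQ (curveG η 0) q = q := by
  rw [curveG_zero]
  exact congrArg Prod.fst (actM_one (q, 0))

theorem hasDerivAt_section_orbit {χ : Conf → LieG} (hχ : b.IsSectionGS χ) {q : Conf} (hq : q ∈ b.Q)
    (a c : ℝ) : HasDerivAt (fun t => χ (actQ (curveG (a • b.ξ₁ q + c • b.ξ₂ q) t) q))
      (b.secDeriv χ q (c • rowγ q - a • e₃)) 0 := by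
  have h := hasDerivAt_actQ_genQ (a • b.ξ₁ q + c • b.ξ₂ q) q
  rw [genQ_ξ hq] at h
  exact hasDerivAt_section hχ.1 hq (fun t => actQ_mem _ hq) (actQ_curveG_zero _ q) h

theorem secDeriv_orbit {χ : Conf → LieG} (hχ : b.IsSectionGS χ)
    (hG : b.GInvariant (b.nhMomentum χ)) {q : Conf} (hq : q ∈ b.Q)
    (hp : rowγ q 0 ^ 2 + rowγ q 1 ^ 2 ≠ 0) (a c : ℝ) :
    (b.secDeriv χ q (c • rowγ q - a • e₃)).1 = 0 ∧
      (b.secDeriv χ q (c • rowγ q - a • e₃)).2.1 = 0 := by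
  have h := hasDerivAt_section_orbit hχ hq a c
  have h1 : HasDerivAt (fun t => (χ (actQ (curveG (a • b.ξ₁ q + c • b.ξ₂ q) t) q)).1) _ 0 := h.fst
  have h2 : HasDerivAt (fun t => (χ (actQ (curveG (a • b.ξ₁ q + c • b.ξ₂ q) t) q)).2.1) _ 0 :=
    h.snd.fst
  simp only [fun t => (section_actQ hχ hG (curveG (a • b.ξ₁ q + c • b.ξ₂ q) t) hq hp).1] at h1
  simp only [fun t => (section_actQ hχ hG (curveG (a • b.ξ₁ q + c • b.ξ₂ q) t) hq hp).2] at h2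
  exact ⟨h1.unique (hasDerivAt_const _ _), h2.unique (hasDerivAt_const _ _)⟩

/-- A symmetry that fixes a configuration whose axis is vertical and turns it by a half turn. -/
theorem exists_half_turn {q : Conf} (hq : q ∈ b.Q) (h0 : rowγ q 0 = 0) (h1 : rowγ q 1 = 0) :
    ∃ h : SymGroup, h.spin = (Real.pi : Real.Angle) ∧ actQ h q = q := by
  refine ⟨⟨(Real.pi : Real.Angle), (Real.pi : Real.Angle), ![2 * q.2 0, 2 * q.2 1]⟩, rfl, ?_⟩
  have hu := rowγ_unit hq
  have hα : q.1 0 ⬝ᵥ q.1 2 = 0 := by simpa using row_dot_row hq.1 0 2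
  have hβ : q.1 1 ⬝ᵥ q.1 2 = 0 := by simpa using row_dot_row hq.1 1 2
  change q.1 2 ⬝ᵥ q.1 2 = 1 at hu
  change q.1 2 0 = 0 at h0
  change q.1 2 1 = 0 at h1
  simp only [dotProduct, Fin.sum_univ_three, h0, h1, mul_zero, zero_add, add_zero] at hu hα hβ
  have hne : q.1 2 2 ≠ 0 := fun h => by simp [h] at hu
  have a2 : q.1 0 2 = 0 := by simpa [hne] using hα
  have b2 : q.1 1 2 = 0 := by simpa [hne] using hβ
  refine Prod.ext ?_ ?_
  · ext i j
    simp only [actQ, Matrix.mul_apply, Fin.sum_univ_three, Matrix.transpose_apply]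
    -- With γ vertical the entries coupling the third index to the other two vanish, so g commutes
    -- with the half turn about e₃.
    fin_cases i <;> fin_cases j <;> simp [rotZ, h0, h1, a2, b2]
  · simp only [actQ, rotZ_pi_mulVec]
    ext i
    fin_cases i <;> simp <;> ring

/-- The expression is the derivative of W₃, since γ̇₃ = 0 where γ is vertical. It is unchanged when
z is replaced by its half turn, because a symmetry fixes q and acts on directions in this way, and
it vanishes on e₃, an orbit direction. Hence it is zero. -/
theorem secDeriv_pole {χ : Conf → LieG} (hχ : b.IsSectionGS χ)
    (hG : b.GInvariant (b.nhMomentum χ)) {q : Conf} (hq : q ∈ b.Q)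
    (h0 : rowγ q 0 = 0) (h1 : rowγ q 1 = 0) (z : V3) :
    (b.secDeriv χ q z).2.1 * rowγ q 2 - (b.secDeriv χ q z).1 = 0 := by
  let l : V3 →ₗ[ℝ] ℝ := rowγ q 2 • (LinearMap.fst ℝ ℝ _ ∘ₗ LinearMap.snd ℝ ℝ _ ∘ₗ b.secDeriv χ q) -
    LinearMap.fst ℝ ℝ _ ∘ₗ b.secDeriv χ q
  have hl : ∀ z, l z = (b.secDeriv χ q z).2.1 * rowγ q 2 - (b.secDeriv χ q z).1 := fun z => by
    simp [l, mul_comm]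
  rw [← hl]
  have hinv : ∀ h : SymGroup, ∀ p ∈ b.Q, genAngVel (χ (actQ h p)) (actQ h p) 2 =
      genAngVel (χ p) p 2 := fun h p hp => by
    rw [genAngVel_actQ hχ hG h hp, rotZ_mulVec_two]
  have hd : ∀ {c : ℝ → Conf} {w : V3}, (∀ t, c t ∈ b.Q) → c 0 = q → HasDerivAt c (b.Dvec q w) 0 →
      HasDerivAt (fun t => genAngVel (χ (c t)) (c t) 2) (l w) 0 := by
    intro c w hQ hc0 hc
    have h := hasDerivAt_section hχ.1 hq hQ hc0 hc
    have h1' : HasDerivAt (fun t => (χ (c t)).1) (b.secDeriv χ q w).1 0 := h.fst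
    have h2' : HasDerivAt (fun t => (χ (c t)).2.1) (b.secDeriv χ q w).2.1 0 := h.snd.fst
    have hc' : HasDerivAt c ((c 0).1 * hat w, (b.Dvec q w).2) 0 := by rw [hc0]; exact hc
    have h3 := hasDerivAt_pi.1 (hasDerivAt_rowγ hc') 2
    have h4 := (h2'.mul h3).sub h1'
    have e : ∀ t, genAngVel (χ (c t)) (c t) 2 = (χ (c t)).2.1 * rowγ (c t) 2 - (χ (c t)).1 :=
      fun t => by simp [genAngVel, e₃]
    simp only [e]
    refine h4.congr_deriv ?_
    simp [hl, hc0, cross_apply, h0, h1]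
  refine eq_zero_of_half_turn ?_ ?_ z
  · intro w
    obtain ⟨h, hs, hfix⟩ := exists_half_turn hq h0 h1
    have hD := (hasDerivAt_actM h ((hasDerivAt_Qcurve hq w).prodMk (hasDerivAt_const (0 : ℝ) q))).fst
    have hD' : HasDerivAt (fun t => actQ h (b.Qcurve q w t))
        (b.Dvec q (rotZ (Real.pi : Real.Angle) *ᵥ w)) 0 := by
      have e := b.Dvec_actQ h q w
      rw [hfix, hs] at e
      rw [e, ← hs]
      exact hD
    have h5 := hd (fun t => actQ_mem h (Qcurve_mem hq w t)) (by rw [Qcurve_zero hq, hfix]) hD'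
    simp only [fun t => hinv h _ (Qcurve_mem hq w t)] at h5
    exact h5.unique (hd (Qcurve_mem hq w) (Qcurve_zero hq w) (hasDerivAt_Qcurve hq w))
  · have hD := hasDerivAt_actQ_genQ ((-1 : ℝ) • b.ξ₁ q + (0 : ℝ) • b.ξ₂ q) q
    have e : (0 : ℝ) • rowγ q - (-1 : ℝ) • e₃ = e₃ := by simp
    rw [genQ_ξ hq, e] at hD
    have h5 := hd (fun t => actQ_mem _ hq) (actQ_curveG_zero _ q) hD
    simp only [fun t => hinv (curveG ((-1 : ℝ) • b.ξ₁ q + (0 : ℝ) • b.ξ₂ q) t) q hq] at h5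
    exact h5.unique (hasDerivAt_const _ _)

theorem residual_eq_zero {χ : Conf → LieG}
    (hJ : b.IsHorizontalGaugeMomentum (b.nhMomentum χ) χ)
    (hG : b.GInvariant (b.nhMomentum χ)) {x : Phase} (hx : x ∈ b.M) (z : V3) :
    b.residual x (χ x.1) (b.secDeriv χ x.1 z) z = 0 := by
  obtain ⟨hsm, hχ, -, hX⟩ := hJ
  have hq : x.1 ∈ b.Q := hx.1
  by_cases hp : rowγ x.1 0 ^ 2 + rowγ x.1 1 ^ 2 = 0
  · have h0 : rowγ x.1 0 = 0 := by nlinarith [sq_nonneg (rowγ x.1 0), sq_nonneg (rowγ x.1 1)]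
    have h1 : rowγ x.1 1 = 0 := by nlinarith [sq_nonneg (rowγ x.1 0), sq_nonneg (rowγ x.1 1)]
    have h2 := secDeriv_pole hχ hG hq h0 h1 z
    have e1 : (b.secDeriv χ x.1 z).2.1 • rowγ x.1 - (b.secDeriv χ x.1 z).1 • e₃ = 0 := by
      ext i
      fin_cases i <;> simp [e₃, h0, h1, h2]
    have e2 : (rowγ x.1 ⨯₃ z) 2 = 0 := by simp [cross_apply, h0, h1]
    rw [residual, e1, e2, dotProduct_zero]
    ring
  · let l₁ : V3 →ₗ[ℝ] ℝ := LinearMap.fst ℝ ℝ _ ∘ₗ b.secDeriv χ x.1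
    let l₂ : V3 →ₗ[ℝ] ℝ := LinearMap.fst ℝ ℝ _ ∘ₗ LinearMap.snd ℝ ℝ _ ∘ₗ b.secDeriv χ x.1
    have hγ := secDeriv_orbit hχ hG hq hp 0 1
    have he := secDeriv_orbit hχ hG hq hp (-1) 0
    rw [one_smul, zero_smul, sub_zero] at hγ
    rw [zero_smul, zero_sub, neg_one_smul, neg_neg] at he
    obtain ⟨c₁, hc₁⟩ := exists_eq_mul_cross_of_vanish hp (l := l₁) hγ.1 he.1
    obtain ⟨c₂, hc₂⟩ := exists_eq_mul_cross_of_vanish hp (l := l₂) hγ.2 he.2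
    have hc₁' : ∀ z, (b.secDeriv χ x.1 z).1 = c₁ * (rowγ x.1 ⨯₃ z) 2 := hc₁
    have hc₂' : ∀ z, (b.secDeriv χ x.1 z).2.1 = c₂ * (rowγ x.1 ⨯₃ z) 2 := hc₂
    -- The factor (γ × z)₃ common to both parts of the residual is removed; what is left is linear
    -- in the angular velocity and independent of z.
    let T : V3 → ℝ := fun v => b.kin x.1 v ⬝ᵥ (c₂ • rowγ x.1 - c₁ • e₃) +
      b.m * (b.ϱ (rowγ x.1 2) * (v ⬝ᵥ rowγ x.1) *
          ((χ x.1).2.1 * (b.ζ (rowγ x.1 2) - rowγ x.1 2 * b.ϱ (rowγ x.1 2)) +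
            (χ x.1).1 * b.ϱ (rowγ x.1 2)) +
        ((χ x.1).2.1 * (b.dζ (rowγ x.1 2) - b.ϱ (rowγ x.1 2) - rowγ x.1 2 * b.dϱ (rowγ x.1 2)) +
          (χ x.1).1 * b.dϱ (rowγ x.1 2)) * ((v ⨯₃ b.s x.1) ⬝ᵥ (rowγ x.1 ⨯₃ e₃)))
    have hT : ∀ v z, b.residual (x.1, b.Dvec x.1 v) (χ x.1) (b.secDeriv χ x.1 z) z =
        (rowγ x.1 ⨯₃ z) 2 * T v := by
      intro v z
      have e : (b.secDeriv χ x.1 z).2.1 • rowγ x.1 - (b.secDeriv χ x.1 z).1 • e₃ =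
          (rowγ x.1 ⨯₃ z) 2 • (c₂ • rowγ x.1 - c₁ • e₃) := by
        rw [hc₁', hc₂', smul_sub, smul_smul, smul_smul, mul_comm c₁, mul_comm c₂]
      simp only [residual, angVel_mk_Dvec hq, e, dotProduct_smul, smul_eq_mul, T]
      ring
    have hT0 : ∀ v, (rowγ x.1 ⨯₃ v) 2 * T v = 0 := by
      intro v
      have hv := mk_Dvec_mem_M hq v
      have h := dM_nhMomentum_Xnh hχ hsm ⟨_, hv⟩ (hasDerivAt_section_Qcurve hχ hq _)
      rw [hX, angVel_mk_Dvec hq] at h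
      rw [← hT v v]
      exact h.symm
    have hTadd : ∀ u v, T (u + v) = T u + T v := fun u v => by
      simp only [T, map_add, add_dotProduct, LinearMap.add_apply]
      ring
    have hTz : T (angVel x) = 0 := by
      -- When the first factor vanishes at Ω, it does not vanish at e₃ × γ, where its value is γ₁² +
      -- γ₂², nor at Ω + e₃ × γ. So T is zero at both, and by additivity at Ω.
      by_cases h : (rowγ x.1 ⨯₃ angVel x) 2 = 0
      · have hw : (rowγ x.1 ⨯₃ (e₃ ⨯₃ rowγ x.1)) 2 ≠ 0 := by
          have : (rowγ x.1 ⨯₃ (e₃ ⨯₃ rowγ x.1)) 2 = rowγ x.1 0 ^ 2 + rowγ x.1 1 ^ 2 := by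
            simp [cross_apply, e₃]
            ring
          rwa [this]
        have h1 := (mul_eq_zero.1 (hT0 (e₃ ⨯₃ rowγ x.1))).resolve_left hw
        have h2 := (mul_eq_zero.1 (hT0 (angVel x + e₃ ⨯₃ rowγ x.1))).resolve_left (by
          rw [map_add, Pi.add_apply, h, zero_add]
          exact hw)
        rwa [hTadd, h1, add_zero] at h2
      · exact (mul_eq_zero.1 (hT0 _)).resolve_left h
    have h := hT (angVel x) z
    rw [mk_Dvec_angVel hx, hTz, mul_zero] at h
    exact h

theorem isHamAt_secM {χ : Conf → LieG} (hJ : b.IsHorizontalGaugeMomentum (b.nhMomentum χ) χ)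
    (hG : b.GInvariant (b.nhMomentum χ)) (x : b.M) :
    b.IsHamAt b.ΩB x (b.dM (b.nhMomentum χ) x) (b.secM χ x) := by
  have hχ := hJ.2.1
  refine ⟨?_, fun v hv => ?_⟩
  · rw [secM_eq hχ x.2]
    exact Cvec_mem x.2 _ _
  · obtain ⟨z, z', rfl⟩ := exists_eq_Cvec x.2 hv
    rw [dM_nhMomentum hχ hJ.1 x z z' (hasDerivAt_section_Qcurve hχ x.2.1 z),
      residual_eq_zero hJ hG x.2, add_zero]

theorem sharp_dM_eq_neg_secM {J : b.M → ℝ} {χ : Conf → LieG} (hJ : b.IsHorizontalGaugeMomentum J χ)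
    (hG : b.GInvariant J) (x : b.M) : b.sharp b.ΩB x (b.dM J x) = -b.secM χ x := by
  obtain rfl := hJ.2.2.1
  exact sharp_eq_neg b.nondegOnC_ΩB x.2 (isHamAt_secM hJ hG x)

theorem exists_casimir {J : b.M → ℝ} {χ : Conf → LieG} (hJ : b.IsHorizontalGaugeMomentum J χ)
    (hG : b.GInvariant J) :
    ∃ Jred : b.Mred → ℝ, (∀ x, Jred (b.ρ x) = J x) ∧ b.IsCasimirRed Jred := by
  let Jred : b.Mred → ℝ := Quotient.lift J fun x y ⟨h, hh⟩ => hG h x y hh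
  have hJred : Jred ∘ b.ρ = J := rfl
  refine ⟨Jred, fun x => rfl, ?_, fun F hF y => ?_⟩
  · rw [SmoothRed, hJred]
    exact hJ.1
  · rw [redBracket, hJred]
    obtain rfl := hJ.2.2.1
    set x : b.M := Quotient.out y
    have hX := isHamAt_neg_sharp b.nondegOnC_ΩB x.2 (b.dM (F ∘ b.ρ) x)
    have hY := isHamAt_secM hJ hG x
    -- This reads (Ω_ℳ + B)(χ_ℳ, X_F) = dJ(X_F), where X_F is the hamiltonian vector of F. By
    -- antisymmetry the left side is -dF(χ_ℳ), which vanishes because F is invariant.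
    have h1 := hY.2 _ hX.1
    rw [ΩB_antisymm, hX.2 _ hY.1, secM, dM_genM_eq_zero hF (gInvariant_comp_ρ F), neg_zero, map_neg,
      zero_eq_neg] at h1
    exact h1

end BodyOfRevolution

/-! ## Linear differential equations on a compact interval -/

section LinearODE

open Set

/-- Coordinatewise truncation of the plane to a square. -/
def truncate (R : ℝ) (p : ℝ × ℝ) : ℝ × ℝ := (max (-R) (min R p.1), max (-R) (min R p.2))

theorem lipschitzWith_truncate (R : ℝ) : LipschitzWith 1 (truncate R) := by
  have h := ((LipschitzWith.prod_fst (α := ℝ) (β := ℝ)).const_min R).const_max (-R) |>.prodMk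
    (((LipschitzWith.prod_snd (α := ℝ) (β := ℝ)).const_min R).const_max (-R))
  rwa [max_self] at h

theorem truncate_eq_self {R : ℝ} {p : ℝ × ℝ} (h : ‖p‖ ≤ R) : truncate R p = p := by
  rw [Prod.norm_def, max_le_iff, Real.norm_eq_abs, Real.norm_eq_abs, abs_le, abs_le] at h
  obtain ⟨⟨h1, h2⟩, h3, h4⟩ := h
  rw [truncate, min_eq_right h2, min_eq_right h4, max_eq_right h1, max_eq_right h3]

theorem norm_truncate_le {R : ℝ} (hR : 0 ≤ R) (p : ℝ × ℝ) : ‖truncate R p‖ ≤ R := by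
  rw [Prod.norm_def, max_le_iff, Real.norm_eq_abs, Real.norm_eq_abs, abs_le, abs_le]
  exact ⟨⟨le_max_left _ _, max_le (by linarith) (min_le_left _ _)⟩,
    ⟨le_max_left _ _, max_le (by linarith) (min_le_left _ _)⟩⟩

theorem norm_truncate_le_norm {R : ℝ} (hR : 0 ≤ R) (p : ℝ × ℝ) : ‖truncate R p‖ ≤ ‖p‖ := by
  have h0 : truncate R 0 = 0 := truncate_eq_self (by simpa using hR)
  simpa [h0] using (lipschitzWith_truncate R).dist_le_mul p 0

/-- Truncating the argument makes the field bounded while keeping it Lipschitz, so Picard-Lindelöf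
applies on the whole interval at once. The truncation radius R is the Grönwall bound, hence the
solution never reaches the truncated region and solves the original equation. -/
theorem exists_hasDerivWithinAt_linear {A : ℝ → ℝ × ℝ →L[ℝ] ℝ × ℝ} {a b : ℝ} (hab : a ≤ b)
    (hA : ContinuousOn A (Icc a b)) (x₀ : ℝ × ℝ) :
    ∃ α : ℝ → ℝ × ℝ, α a = x₀ ∧ ∀ t ∈ Icc a b, HasDerivWithinAt α (A t (α t)) (Icc a b) t := by
  obtain ⟨C, hC⟩ := isCompact_Icc.exists_bound_of_continuousOn hA
  obtain ⟨M, hM⟩ : ∃ M : NNReal, ∀ t ∈ Icc a b, ‖A t‖ ≤ M :=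
    ⟨C.toNNReal, fun t ht => (hC t ht).trans (Real.le_coe_toNNReal C)⟩
  let R : NNReal := ⟨‖x₀‖ * Real.exp (M * (b - a)), by positivity⟩
  have hR : (0 : ℝ) ≤ R := R.2
  let T : NNReal := ⟨b - a, sub_nonneg.2 hab⟩
  -- The ball of radius M R T contains everything reachable in time T at speed at most M R.
  have hpl : IsPicardLindelof (fun t x => A t (truncate R x)) (⟨a, left_mem_Icc.2 hab⟩ : Icc a b) x₀
      (M * R * T) 0 (M * R) M := by
    refine ⟨fun t ht => ?_, fun x _ => hA.clm_apply continuousOn_const, fun t ht x _ => ?_, ?_⟩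
    · have h1 : LipschitzWith M (A t) := (A t).lipschitz.weaken (NNReal.coe_le_coe.1 (hM t ht))
      have h2 := h1.comp (lipschitzWith_truncate R)
      rw [mul_one] at h2
      exact h2.lipschitzOnWith
    · calc ‖A t (truncate R x)‖ ≤ ‖A t‖ * ‖truncate R x‖ := (A t).le_opNorm _
        _ ≤ M * R := mul_le_mul (hM t ht) (norm_truncate_le hR x) (norm_nonneg _) M.2
        _ = ((M * R : NNReal) : ℝ) := (NNReal.coe_mul M R).symm
    · have hT : (T : ℝ) = b - a := rfl
      simp only [sub_self, NNReal.coe_mul, NNReal.coe_zero, sub_zero, hT]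
      rw [max_eq_left (sub_nonneg.2 hab)]
  obtain ⟨α, h0, hα⟩ := hpl.exists_eq_forall_mem_Icc_hasDerivWithinAt₀
  have hbound : ∀ t ∈ Icc a b, ‖α t‖ ≤ R := by
    intro t ht
    have h := norm_le_gronwallBound_of_norm_deriv_right_le (f := α)
      (f' := fun t => A t (truncate R (α t))) (δ := ‖x₀‖) (K := M) (ε := 0) (a := a) (b := b)
      (fun t ht => (hα t ht).continuousWithinAt)
      (fun t ht => (hα t (Ico_subset_Icc_self ht)).mono_of_mem_nhdsWithin
        (Icc_mem_nhdsGE_of_mem ht)) (le_of_eq (congrArg norm h0)) (fun t ht => ?_) t ht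
    · rw [gronwallBound_ε0] at h
      refine h.trans ?_
      change _ ≤ ‖x₀‖ * Real.exp (M * (b - a))
      have := ht.2
      gcongr
    · rw [add_zero]
      calc ‖A t (truncate R (α t))‖ ≤ ‖A t‖ * ‖truncate R (α t)‖ := (A t).le_opNorm _
        _ ≤ M * ‖α t‖ := mul_le_mul (hM t (Ico_subset_Icc_self ht))
            (norm_truncate_le_norm hR _) (norm_nonneg _) M.2
  refine ⟨α, h0, fun t ht => ?_⟩
  have h := hα t ht
  simp only [truncate_eq_self (hbound t ht)] at h
  exact h

/-- A nontrivial solution of a scalar linear equation has no zeros. -/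
theorem ne_zero_of_hasDerivWithinAt_mul {w p : ℝ → ℝ} {a b : ℝ} (hab : a ≤ b)
    (hp : ContinuousOn p (Icc a b))
    (hw : ∀ t ∈ Icc a b, HasDerivWithinAt w (p t * w t) (Icc a b) t) (ha : w a ≠ 0) :
    ∀ t ∈ Icc a b, w t ≠ 0 := by
  -- The coefficient is extended continuously to the line so that its primitive is differentiable
  -- everywhere; exp(-E) is then the integrating factor.
  let P : ℝ → ℝ := IccExtend hab ((Icc a b).domRestrict p)
  have hP : Continuous P := (continuousOn_iff_continuous_domRestrict.1 hp).Icc_extend'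
  let E : ℝ → ℝ := fun t => ∫ τ in a..t, P τ
  have hE : ∀ t, HasDerivAt E (P t) t := fun t => (hP.integral_hasStrictDerivAt a t).hasDerivAt
  have hPp : ∀ t ∈ Icc a b, P t = p t := fun t ht => IccExtend_of_mem hab _ ht
  have hv : ∀ t ∈ Icc a b, HasDerivWithinAt (fun t => w t * Real.exp (-E t)) 0 (Icc a b) t := by
    intro t ht
    refine ((hw t ht).mul ((hE t).neg.exp.hasDerivWithinAt)).congr_deriv ?_
    rw [← hPp t ht, Pi.neg_apply]
    ring
  have hc := constant_of_has_deriv_right_zero (f := fun t => w t * Real.exp (-E t))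
    (fun t ht => (hv t ht).continuousWithinAt)
    (fun t ht => (hv t (Ico_subset_Icc_self ht)).mono_of_mem_nhdsWithin (Icc_mem_nhdsGE_of_mem ht))
  intro t ht h0
  have h := hc t ht
  simp only [h0, zero_mul] at h
  exact (mul_ne_zero ha (Real.exp_pos _).ne') h.symm

/-- A planar linear system with smooth coefficients on a compact interval has a smooth fundamental
system of solutions. -/
theorem exists_fundamental_system {n₁₁ n₁₂ n₂₁ n₂₂ : ℝ → ℝ} {a b : ℝ} (hab : a ≤ b)
    (h₁₁ : ContDiffOn ℝ ∞ n₁₁ (Icc a b)) (h₁₂ : ContDiffOn ℝ ∞ n₁₂ (Icc a b))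
    (h₂₁ : ContDiffOn ℝ ∞ n₂₁ (Icc a b)) (h₂₂ : ContDiffOn ℝ ∞ n₂₂ (Icc a b)) :
    ∃ f g : Fin 2 → ℝ → ℝ,
      (∀ i, ContDiffOn ℝ ∞ (f i) (Icc a b) ∧ ContDiffOn ℝ ∞ (g i) (Icc a b)) ∧
      (∀ t ∈ Icc a b, f 0 t * g 1 t - f 1 t * g 0 t ≠ 0) ∧
      ∀ i, ∀ t ∈ Icc a b,
        HasDerivWithinAt (f i) (n₁₁ t * f i t + n₁₂ t * g i t) (Icc a b) t ∧
        HasDerivWithinAt (g i) (n₂₁ t * f i t + n₂₂ t * g i t) (Icc a b) t := by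
  let p₁ := ContinuousLinearMap.fst ℝ ℝ ℝ
  let p₂ := ContinuousLinearMap.snd ℝ ℝ ℝ
  let j₁ := ContinuousLinearMap.inl ℝ ℝ ℝ
  let j₂ := ContinuousLinearMap.inr ℝ ℝ ℝ
  let A : ℝ → ℝ × ℝ →L[ℝ] ℝ × ℝ := fun t =>
    n₁₁ t • (j₁ ∘SL p₁) + n₁₂ t • (j₁ ∘SL p₂) + n₂₁ t • (j₂ ∘SL p₁) + n₂₂ t • (j₂ ∘SL p₂)
  have hA : ContDiffOn ℝ ∞ A (Icc a b) :=
    (((h₁₁.smul contDiffOn_const).add (h₁₂.smul contDiffOn_const)).add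
      (h₂₁.smul contDiffOn_const)).add (h₂₂.smul contDiffOn_const)
  have hAx : ∀ t x, A t x = (n₁₁ t * x.1 + n₁₂ t * x.2, n₂₁ t * x.1 + n₂₂ t * x.2) := fun t x => by
    simp [A, p₁, p₂, j₁, j₂]
  choose α h0 hα using exists_hasDerivWithinAt_linear hab hA.continuousOn
  have hsm : ∀ x, ContDiffOn ℝ ∞ (α x) (Icc a b) := fun x => by
    refine ODE.contDiffOn_enat_Icc_of_hasDerivWithinAt (f := fun t y => A t y) (u := univ) (n := ⊤)
      ?_ (hα x) (mapsTo_univ _ _)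
    exact (hA.comp contDiffOn_fst fun y hy => hy.1).clm_apply contDiffOn_snd
  let x : Fin 2 → ℝ × ℝ := ![(1, 0), (0, 1)]
  have hd : ∀ i, ∀ t ∈ Icc a b,
      HasDerivWithinAt (fun t => (α (x i) t).1)
        (n₁₁ t * (α (x i) t).1 + n₁₂ t * (α (x i) t).2) (Icc a b) t ∧
      HasDerivWithinAt (fun t => (α (x i) t).2)
        (n₂₁ t * (α (x i) t).1 + n₂₂ t * (α (x i) t).2) (Icc a b) t := fun i t ht => by
    have h := hα (x i) t ht
    rw [hAx] at h
    exact ⟨h.fst, h.snd⟩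
  refine ⟨fun i t => (α (x i) t).1, fun i t => (α (x i) t).2,
    fun i => ⟨contDiff_fst.comp_contDiffOn (hsm _), contDiff_snd.comp_contDiffOn (hsm _)⟩, ?_, hd⟩
  -- Liouville's formula: the Wronskian w satisfies w' = (n₁₁ + n₂₂) w and equals 1 at the left end.
  refine ne_zero_of_hasDerivWithinAt_mul (p := fun t => n₁₁ t + n₂₂ t) hab
    (h₁₁.continuousOn.add h₂₂.continuousOn) (fun t ht => ?_) (by simp [h0, x])
  refine (((hd 0 t ht).1.mul (hd 1 t ht).2).sub ((hd 1 t ht).1.mul (hd 0 t ht).2)).congr_deriv ?_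
  ring

end LinearODE

namespace BodyOfRevolution

variable (b : BodyOfRevolution)

/-! ## The system for the gauge symmetries -/

open Set

theorem contDiffOn_dϱ : ContDiffOn ℝ ∞ b.dϱ (Icc (-1) 1) :=
  ((contDiffOn_infty_iff_derivWithin (uniqueDiffOn_Icc (by norm_num))).1 b.ϱ_smooth).2

theorem contDiffOn_dζ : ContDiffOn ℝ ∞ b.dζ (Icc (-1) 1) :=
  ((contDiffOn_infty_iff_derivWithin (uniqueDiffOn_Icc (by norm_num))).1 b.ζ_smooth).2

/-- The component of `s` along the axis of the body, in the decomposition `s = ϱ γ + L e₃`. -/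
def axialPart (t : ℝ) : ℝ := b.ζ t - t * b.ϱ t

/-- The derivative of `axialPart`. -/
def dAxialPart (t : ℝ) : ℝ := b.dζ t - b.ϱ t - t * b.dϱ t

/-- The height `⟨γ, s⟩`. -/
def height (t : ℝ) : ℝ := b.ϱ t * (1 - t ^ 2) + b.ζ t * t

/-- The determinant of the kinetic tensor in the frame `γ, e₃`. -/
def frameDet (t : ℝ) : ℝ :=
  b.I₁ * b.I₃ + b.m * b.I₁ * b.ϱ t ^ 2 * (1 - t ^ 2) + b.m * b.I₃ * b.ζ t ^ 2

/-- The summand I₁ I₃ keeps the determinant positive even at t = ±1, where γ and e₃ are parallel.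
The system for the coefficients is therefore regular up to both ends. -/
theorem frameDet_pos {t : ℝ} (ht : t ∈ Icc (-1 : ℝ) 1) : 0 < b.frameDet t := by
  have h1 := b.I₁_pos
  have h3 := b.I₃_pos
  have hm := b.m_pos
  have ht' : 0 ≤ 1 - t ^ 2 := by nlinarith [ht.1, ht.2]
  rw [frameDet]
  positivity

/-- The matrix of the kinetic tensor in the frame `γ, e₃` is `(a₁₁, a₁₂; a₂₁, -a₂₂)`, up to the
sign of the second column. -/
def frame₁₁ (t : ℝ) : ℝ := b.I₁ + b.m * b.axialPart t * b.ζ t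
/-- The second entry of the first row. -/
def frame₁₂ (t : ℝ) : ℝ := b.m * b.ζ t * b.ϱ t
/-- The first entry of the second row. -/
def frame₂₁ (t : ℝ) : ℝ := (b.I₃ - b.I₁) * t - b.m * b.height t * b.axialPart t
/-- The negative of the second entry of the second row. -/
def frame₂₂ (t : ℝ) : ℝ := b.I₃ + b.m * b.ϱ t * b.height t

theorem frame_det (t : ℝ) :
    b.frame₁₁ t * b.frame₂₂ t + b.frame₁₂ t * b.frame₂₁ t = b.frameDet t := by
  simp only [frame₁₁, frame₁₂, frame₂₁, frame₂₂, frameDet, height, axialPart]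
  ring

/-- The coefficient of the derivative of `f` on a vector of right hand sides. -/
def solveF (t u v : ℝ) : ℝ := (b.frame₂₁ t * u - b.frame₁₁ t * v) / b.frameDet t
/-- The coefficient of the derivative of `g` on a vector of right hand sides. -/
def solveG (t u v : ℝ) : ℝ := (b.frame₂₂ t * u + b.frame₁₂ t * v) / b.frameDet t

/-- The part along `γ` of the right hand side for the coefficients `(f, g)`. -/
def rhsγ (t f g : ℝ) : ℝ :=
  -(b.m * b.ϱ t * (g * b.axialPart t + f * b.ϱ t) +
    b.m * b.ζ t * (g * b.dAxialPart t + f * b.dϱ t))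
/-- The part along `e₃` of the right hand side for the coefficients `(f, g)`. -/
def rhsE (t f g : ℝ) : ℝ := b.m * b.height t * (g * b.dAxialPart t + f * b.dϱ t)

theorem exists_gauge_coefficients : ∃ f g : Fin 2 → ℝ → ℝ,
    (∀ i, ContDiffOn ℝ ∞ (f i) (Icc (-1) 1) ∧ ContDiffOn ℝ ∞ (g i) (Icc (-1) 1)) ∧
    (∀ t ∈ Icc (-1 : ℝ) 1, f 0 t * g 1 t - f 1 t * g 0 t ≠ 0) ∧
    ∀ i, ∀ t ∈ Icc (-1 : ℝ) 1,
      derivWithin (f i) (Icc (-1) 1) t =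
        b.solveF t (b.rhsγ t (f i t) (g i t)) (b.rhsE t (f i t) (g i t)) ∧
      derivWithin (g i) (Icc (-1) 1) t =
        b.solveG t (b.rhsγ t (f i t) (g i t)) (b.rhsE t (f i t) (g i t)) := by
  have hϱ := b.ϱ_smooth
  have hζ := b.ζ_smooth
  have hdϱ := b.contDiffOn_dϱ
  have hdζ := b.contDiffOn_dζ
  have hne : ∀ t ∈ Icc (-1 : ℝ) 1, b.frameDet t ≠ 0 := fun t ht => (b.frameDet_pos ht).ne'
  have hL : ContDiffOn ℝ ∞ b.axialPart (Icc (-1) 1) := hζ.sub (contDiffOn_id.mul hϱ)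
  have hdL : ContDiffOn ℝ ∞ b.dAxialPart (Icc (-1) 1) := (hdζ.sub hϱ).sub (contDiffOn_id.mul hdϱ)
  have hh : ContDiffOn ℝ ∞ b.height (Icc (-1) 1) :=
    (hϱ.mul (contDiffOn_const.sub (contDiffOn_id.pow 2))).add (hζ.mul contDiffOn_id)
  have hF : ∀ c₁ c₂ : ℝ, ContDiffOn ℝ ∞ (fun t => b.solveF t (b.rhsγ t c₁ c₂) (b.rhsE t c₁ c₂))
      (Icc (-1) 1) ∧ ContDiffOn ℝ ∞ (fun t => b.solveG t (b.rhsγ t c₁ c₂) (b.rhsE t c₁ c₂))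
      (Icc (-1) 1) := by
    intro c₁ c₂
    have hdet : ContDiffOn ℝ ∞ b.frameDet (Icc (-1) 1) := by
      unfold frameDet
      fun_prop
    constructor
    · refine ContDiffOn.div ?_ hdet hne
      simp only [frame₂₁, frame₁₁, rhsγ, rhsE]
      fun_prop
    · refine ContDiffOn.div ?_ hdet hne
      simp only [frame₂₂, frame₁₂, rhsγ, rhsE]
      fun_prop
  -- The solved right hand sides are linear in the pair (f, g), so their values at (1, 0) and (0, 1)
  -- are the columns of the coefficient matrix.
  obtain ⟨f, g, hs, hw, hd⟩ := exists_fundamental_system (by norm_num) (hF 1 0).1 (hF 0 1).1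
    (hF 1 0).2 (hF 0 1).2
  refine ⟨f, g, hs, hw, fun i t ht => ?_⟩
  have hu : UniqueDiffWithinAt ℝ (Icc (-1 : ℝ) 1) t := uniqueDiffOn_Icc (by norm_num) t ht
  rw [(hd i t ht).1.derivWithin hu, (hd i t ht).2.derivWithin hu]
  simp only [solveF, solveG, rhsγ, rhsE]
  constructor <;> ring

theorem solve_spec {t : ℝ} (ht : t ∈ Icc (-1 : ℝ) 1) (u v : ℝ) :
    b.frame₁₁ t * b.solveG t u v + b.frame₁₂ t * b.solveF t u v = u ∧
      b.frame₂₁ t * b.solveG t u v - b.frame₂₂ t * b.solveF t u v = v := by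
  have h := (b.frameDet_pos ht).ne'
  have hd := b.frame_det t
  simp only [solveF, solveG]
  constructor <;> field_simp <;> rw [← hd] <;> ring

/-- Separates the dependence on v into ⟨v, γ⟩ and v₃. With X = g' and Y = f' the two brackets are
the left sides of the two scalar equations of the system; `cross_s_frame` does the same for the
remaining term of the residual. -/
theorem kin_frame {q : Conf} (hq : rowγ q ⬝ᵥ rowγ q = 1) (v : V3) (X Y : ℝ) :
    b.kin q v ⬝ᵥ (X • rowγ q - Y • e₃) =
      (v ⬝ᵥ rowγ q) * (b.frame₁₁ (rowγ q 2) * X + b.frame₁₂ (rowγ q 2) * Y) +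
        v 2 * (b.frame₂₁ (rowγ q 2) * X - b.frame₂₂ (rowγ q 2) * Y) := by
  have hs : b.s q = ![b.ϱ (rowγ q 2) * rowγ q 0, b.ϱ (rowγ q 2) * rowγ q 1, b.ζ (rowγ q 2)] := rfl
  have hh : b.height (rowγ q 2) = b.ϱ (rowγ q 2) * (rowγ q 0 ^ 2 + rowγ q 1 ^ 2) +
      b.ζ (rowγ q 2) * rowγ q 2 := by
    simp only [dotProduct, Fin.sum_univ_three] at hq
    rw [height]
    linear_combination (-b.ϱ (rowγ q 2)) * hq
  rw [kin_dot, hs]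
  simp only [frame₁₁, frame₁₂, frame₂₁, frame₂₂, hh, axialPart]
  simp [inertia, Matrix.mulVec_diagonal, dotProduct, Fin.sum_univ_three, cross_apply, e₃,
    Matrix.vecHead, Matrix.vecTail]
  ring

theorem cross_s_frame {q : Conf} (hq : rowγ q ⬝ᵥ rowγ q = 1) (v : V3) :
    (v ⨯₃ b.s q) ⬝ᵥ (rowγ q ⨯₃ e₃) =
      (v ⬝ᵥ rowγ q) * b.ζ (rowγ q 2) - v 2 * b.height (rowγ q 2) := by
  have hs : b.s q = ![b.ϱ (rowγ q 2) * rowγ q 0, b.ϱ (rowγ q 2) * rowγ q 1, b.ζ (rowγ q 2)] := rfl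
  have hh : b.height (rowγ q 2) = b.ϱ (rowγ q 2) * (rowγ q 0 ^ 2 + rowγ q 1 ^ 2) +
      b.ζ (rowγ q 2) * rowγ q 2 := by
    simp only [dotProduct, Fin.sum_univ_three] at hq
    rw [height]
    linear_combination (-b.ϱ (rowγ q 2)) * hq
  rw [hs, hh]
  simp [dotProduct, Fin.sum_univ_three, cross_apply, e₃]
  ring

variable {b}

/-- Coefficients that solve the system have vanishing residual. -/
theorem residual_eq_zero_of_solution {x : Phase} (hx : x ∈ b.M) {χ χ' : LieG} {z : V3}
    (h1 : χ'.1 = b.solveF (rowγ x.1 2) (b.rhsγ (rowγ x.1 2) χ.1 χ.2.1)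
      (b.rhsE (rowγ x.1 2) χ.1 χ.2.1) * (rowγ x.1 ⨯₃ z) 2)
    (h2 : χ'.2.1 = b.solveG (rowγ x.1 2) (b.rhsγ (rowγ x.1 2) χ.1 χ.2.1)
      (b.rhsE (rowγ x.1 2) χ.1 χ.2.1) * (rowγ x.1 ⨯₃ z) 2) :
    b.residual x χ χ' z = 0 := by
  have hu := rowγ_unit hx.1
  obtain ⟨e1, e2⟩ := b.solve_spec (rowγ_mem_Icc hx.1) (b.rhsγ (rowγ x.1 2) χ.1 χ.2.1)
    (b.rhsE (rowγ x.1 2) χ.1 χ.2.1)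
  rw [residual, kin_frame b hu, cross_s_frame b hu, h1, h2]
  simp only [rhsγ, rhsE, axialPart, dAxialPart] at e1 e2 ⊢
  linear_combination (rowγ x.1 ⨯₃ z) 2 * (angVel x ⬝ᵥ rowγ x.1) * e1 +
    (rowγ x.1 ⨯₃ z) 2 * angVel x 2 * e2

/-! ## The two horizontal gauge momenta -/

theorem contDiffOn_comp_rowγ {f : ℝ → ℝ} (hf : ContDiffOn ℝ ∞ f (Icc (-1) 1)) :
    ContDiffOn ℝ ∞ (fun q : Conf => f (rowγ q 2)) b.Q :=
  hf.comp ((contDiff_entry 2 2).comp contDiff_fst).contDiffOn fun _ hq => rowγ_mem_Icc hq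

theorem isSectionGS_combSection {f g : ℝ → ℝ} (hf : ContDiffOn ℝ ∞ f (Icc (-1) 1))
    (hg : ContDiffOn ℝ ∞ g (Icc (-1) 1)) : b.IsSectionGS (b.combSection f g) := by
  refine ⟨?_, fun q hq => ⟨?_, ⟨_, rfl⟩⟩⟩
  · have hrow : ∀ i j, ContDiffOn ℝ ∞ (fun q : Conf => q.1 i j) b.Q := fun i j =>
      ((contDiff_entry i j).comp contDiff_fst).contDiffOn
    have hr : ∀ i, ContDiffOn ℝ ∞ (fun q : Conf => q.1 i) b.Q := fun i =>
      contDiffOn_pi.2 (hrow i)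
    have ha : ∀ i, ContDiffOn ℝ ∞ (fun q : Conf => q.2 i) b.Q := fun i =>
      (contDiff_pi.1 contDiff_snd i).contDiffOn
    have hϱ := contDiffOn_comp_rowγ (b := b) b.ϱ_smooth
    have h1 : ContDiffOn ℝ ∞ b.ξ₁ b.Q := by
      refine contDiffOn_const.prodMk (contDiffOn_const.prodMk (contDiffOn_pi.2 fun i => ?_))
      fin_cases i
      · exact hϱ.mul (hrow 1 2)
      · exact (hϱ.mul (hrow 0 2)).neg
    have h2 : ContDiffOn ℝ ∞ b.ξ₂ b.Q := by
      refine contDiffOn_const.prodMk (contDiffOn_const.prodMk (contDiffOn_pi.2 fun i => ?_))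
      fin_cases i
      · exact (ha 1).add (contDiffOn_dotProduct contDiffOn_s (hr 1))
      · exact (ha 0).neg.sub (contDiffOn_dotProduct contDiffOn_s (hr 0))
    exact ((contDiffOn_comp_rowγ hf).smul h1).add ((contDiffOn_comp_rowγ hg).smul h2)
  · rw [combSection, genQ_ξ hq]
    exact Dvec_mem hq _

theorem combSection_fst (f g : ℝ → ℝ) (q : Conf) : (b.combSection f g q).1 = f (rowγ q 2) := by
  simp [combSection, ξ₁, ξ₂]

theorem combSection_snd (f g : ℝ → ℝ) (q : Conf) : (b.combSection f g q).2.1 = g (rowγ q 2) := by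
  simp [combSection, ξ₁, ξ₂]

theorem nhMomentum_combSection {f g : ℝ → ℝ} (hf : ContDiffOn ℝ ∞ f (Icc (-1) 1))
    (hg : ContDiffOn ℝ ∞ g (Icc (-1) 1)) (x : b.M) :
    b.nhMomentum (b.combSection f g) x = b.kin x.1.1 (angVel x) ⬝ᵥ
      (g (rowγ x.1.1 2) • rowγ x.1.1 - f (rowγ x.1.1 2) • e₃) := by
  rw [nhMomentum_eq (isSectionGS_combSection hf hg), genAngVel, combSection_fst, combSection_snd]

theorem gInvariant_combSection {f g : ℝ → ℝ} (hf : ContDiffOn ℝ ∞ f (Icc (-1) 1))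
    (hg : ContDiffOn ℝ ∞ g (Icc (-1) 1)) : b.GInvariant (b.nhMomentum (b.combSection f g)) := by
  intro h x y hy
  have e : y.1.1 = actQ h x.1.1 := by rw [← hy]; rfl
  rw [nhMomentum_combSection hf hg, nhMomentum_combSection hf hg, e, ← hy, angVel_actM h x.2,
    rowγ_actQ, rotZ_mulVec_two, ← kin_actQ h, Matrix.mulVec_sub, Matrix.mulVec_smul,
    Matrix.mulVec_smul, rotZ_mulVec_e₃]

theorem smooth_combSection {f g : ℝ → ℝ} (hf : ContDiffOn ℝ ∞ f (Icc (-1) 1))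
    (hg : ContDiffOn ℝ ∞ g (Icc (-1) 1)) : b.Smooth (b.nhMomentum (b.combSection f g)) := by
  refine smooth_of_contDiffOn (F := fun x => b.kin x.1 (angVel x) ⬝ᵥ
      (g (rowγ x.1 2) • rowγ x.1 - f (rowγ x.1 2) • e₃)) ?_ (nhMomentum_combSection hf hg)
  have hfst : ContDiffOn ℝ ∞ (fun x : Phase => x.1) b.M := contDiff_fst.contDiffOn
  have hQ : MapsTo (fun x : Phase => x.1) b.M b.Q := fun x hx => hx.1
  have hs : ContDiffOn ℝ ∞ (fun x : Phase => b.s x.1) b.M := contDiffOn_s.comp hfst hQ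
  have hΩ : ContDiffOn ℝ ∞ angVel b.M := contDiff_mc hfst contDiff_snd.contDiffOn
  have hγ : ContDiffOn ℝ ∞ (fun x : Phase => rowγ x.1) b.M :=
    contDiffOn_pi.2 fun j => ((contDiff_entry 2 j).comp
      (contDiff_fst.comp contDiff_fst)).contDiffOn
  have hW : ContDiffOn ℝ ∞ (fun x : Phase => g (rowγ x.1 2) • rowγ x.1 - f (rowγ x.1 2) • e₃) b.M :=
    (((contDiffOn_comp_rowγ hg).comp hfst hQ).smul hγ).sub
      (((contDiffOn_comp_rowγ hf).comp hfst hQ).smul contDiffOn_const)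
  simp only [kin_dot]
  exact (contDiffOn_dotProduct hΩ (contDiffOn_matrix_mulVec contDiffOn_const hW)).add
    (contDiffOn_const.mul (contDiffOn_dotProduct (contDiffOn_cross hΩ hs) (contDiffOn_cross hW hs)))

/-- Along the motion the coefficients change at the rates f'(γ₃) γ̇₃ and g'(γ₃) γ̇₃ with γ̇₃ = (γ ×
Ω)₃. The differential system thus annihilates the residual in the direction Ω, which is X_nh(J). -/
theorem isHorizontalGaugeMomentum_combSection {f g : ℝ → ℝ} (hf : ContDiffOn ℝ ∞ f (Icc (-1) 1))
    (hg : ContDiffOn ℝ ∞ g (Icc (-1) 1))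
    (hd : ∀ t ∈ Icc (-1 : ℝ) 1,
      derivWithin f (Icc (-1) 1) t = b.solveF t (b.rhsγ t (f t) (g t)) (b.rhsE t (f t) (g t)) ∧
      derivWithin g (Icc (-1) 1) t = b.solveG t (b.rhsγ t (f t) (g t)) (b.rhsE t (f t) (g t))) :
    b.IsHorizontalGaugeMomentum (b.nhMomentum (b.combSection f g)) (b.combSection f g) := by
  have hχ := isSectionGS_combSection (b := b) hf hg
  have hJ := smooth_combSection (b := b) hf hg
  refine ⟨hJ, hχ, rfl, fun x => ?_⟩
  have hq : x.1.1 ∈ b.Q := x.2.1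
  have h := hasDerivAt_section_Qcurve hχ hq (angVel x)
  rw [dM_nhMomentum_Xnh hχ hJ x h]
  obtain ⟨h1, h2⟩ := hd _ (rowγ_mem_Icc hq)
  have h0 := Qcurve_zero hq (angVel x)
  have hc : HasDerivAt (b.Qcurve x.1.1 (angVel x))
      ((b.Qcurve x.1.1 (angVel x) 0).1 * hat (angVel x), (b.Dvec x.1.1 (angVel x)).2) 0 := by
    rw [h0]
    exact hasDerivAt_Qcurve hq _
  have hγ := hasDerivAt_pi.1 (hasDerivAt_rowγ hc) 2
  have hmem : ∀ t, rowγ (b.Qcurve x.1.1 (angVel x) t) 2 ∈ Icc (-1 : ℝ) 1 := fun t =>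
    rowγ_mem_Icc (Qcurve_mem hq _ t)
  have df := hasDerivAt_comp_profile hf hmem hγ
  have dg := hasDerivAt_comp_profile hg hmem hγ
  rw [h0] at df dg
  have ef : HasDerivAt (fun t => (b.combSection f g (b.Qcurve x.1.1 (angVel x) t)).1) _ 0 := h.fst
  have eg : HasDerivAt (fun t => (b.combSection f g (b.Qcurve x.1.1 (angVel x) t)).2.1) _ 0 :=
    h.snd.fst
  simp only [combSection_fst] at ef
  simp only [combSection_snd] at eg
  refine residual_eq_zero_of_solution x.2 ?_ ?_
  · rw [combSection_fst, combSection_snd, ← h1]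
    exact ef.unique df
  · rw [combSection_fst, combSection_snd, ← h2]
    exact eg.unique dg

end BodyOfRevolution

end Rolling

end

/-- For a strongly convex body of revolution rolling without slipping on a plane: the forms that
define `π_nh` and `π_B` are nondegenerate on `𝒞` and the reduced bracket is well defined; there are
two `G`-invariant horizontal gauge momenta whose gauge symmetries `fᵢ(γ₃) ξ₁ + gᵢ(γ₃) ξ₂` form a
basis of `𝔤_S` at every point; and every `G`-invariant horizontal gauge momentum `J` with gauge
symmetry `χ` satisfies `π_B♯(dJ) = -χ_ℳ` and descends to a Casimir function of the reduced
bracket. -/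
theorem theoremT (b : Rolling.BodyOfRevolution) :
    b.NondegOnC b.ΩM ∧ b.NondegOnC b.ΩB ∧ b.RedBracketWellDefined ∧
    (∃ f g : Fin 2 → ℝ → ℝ,
      (∀ i, ContDiffOn ℝ ∞ (f i) (Set.Icc (-1) 1) ∧ ContDiffOn ℝ ∞ (g i) (Set.Icc (-1) 1)) ∧
      (∀ t ∈ Set.Icc (-1 : ℝ) 1, f 0 t * g 1 t - f 1 t * g 0 t ≠ 0) ∧
      ∀ i, b.IsHorizontalGaugeMomentum (b.nhMomentum (b.combSection (f i) (g i)))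
          (b.combSection (f i) (g i)) ∧
        b.GInvariant (b.nhMomentum (b.combSection (f i) (g i)))) ∧
    ∀ (J : b.M → ℝ) (χ : Rolling.Conf → Rolling.LieG),
      b.IsHorizontalGaugeMomentum J χ → b.GInvariant J →
        (∀ x : b.M, b.sharp b.ΩB x (b.dM J x) = -b.secM χ x) ∧
        ∃ Jred : b.Mred → ℝ, (∀ x, Jred (b.ρ x) = J x) ∧ b.IsCasimirRed Jred := by
  refine ⟨b.nondegOnC_ΩM, b.nondegOnC_ΩB, b.redBracketWellDefined, ?_, fun J χ hJ hG =>
    ⟨Rolling.BodyOfRevolution.sharp_dM_eq_neg_secM hJ hG,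
      Rolling.BodyOfRevolution.exists_casimir hJ hG⟩⟩
  obtain ⟨f, g, hs, hw, hd⟩ := b.exists_gauge_coefficients
  exact ⟨f, g, hs, hw, fun i =>
    ⟨Rolling.BodyOfRevolution.isHorizontalGaugeMomentum_combSection (hs i).1 (hs i).2 (hd i),
      Rolling.BodyOfRevolution.gInvariant_combSection (hs i).1 (hs i).2⟩⟩
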